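/- Let $X$ be a finite set, let $M(X)=\mathbb N^X$ be the free abelian monoid on $X$ (identified with the monomials in $X$ and ordered by divisibility), let $I\subseteq M(X)$ be a monoid ideal, let $G_I$ be the group of monoid automorphisms of $M(X)$ that preserve $I$, and let $\Bbbk$ be a field with prime subfield $\mathbb F$. For a $\Bbbk$-algebra $S$ we write $I\,S[X]$ for the ideal of $S[X]$ generated by the monomials in $I$. **Notation.** Let $L'$ be the (finite) poset of least common multiples of nonempty sets of minimal generators of $I$; if $I\ne M(X)$ this is the lcm-lattice of $I$ without its bottom element $1$. Let $\Delta$ be the order complex of $L'$; its $n$-faces $a_0<\dots<a_n$ are naturally oriented. For $a\in L'$ let $C_\bullet(a)=C_\bullet(\Delta_{\le a},\Delta_{<a};\mathbb F)$, with differential $d$ and with canonical basis the faces with $a_n=a$. A *matroidal splitting* of $C_\bullet(a)$ is a chain homotopy $\sigma$ obtained as follows. For each $n$ choose a subset $X_n$ of the canonical basis of $C_n(a)$ that $d$ maps bijectively onto a basis of $d(C_n(a))$; for a canonical basis element $b\notin X_n$ let $z(b)$ be the unique cycle in $b+\mathrm{span}(X_n)$; choose a set $Z_n$ of such cycles $z(b)$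 that maps bijectively onto a basis of $H_n(C_\bullet(a))$. Then $\sigma$ is determined by $\sigma(dc)=c$ for $c\in X_{n+1}$, and $\sigma=0$ on $X_n$ and on $Z_n$. Let $MSpl(a)$ be the set of all matroidal splittings of $C_\bullet(a)$ and let $m(a)=|MSpl(a)|$ (it is finite and positive). Call $a$ *critical* if $\operatorname{char}\Bbbk$ divides $m(a)$, and let $L'_{crit}$ be the set of critical elements (empty in characteristic $0$). Let $\Bbbk'$ be the fraction field of $\Bbbk[\,y_{\sigma}\mid a\in L'_{crit},\ \sigma\in MSpl(a)]\big/\big(1-\sum_{\sigma\in MSpl(a)}y_{\sigma}\ \big|\ a\in L'_{crit}\big)$, and let $R'=\Bbbk'[X]$. Let $\mathfrak F=(F_n,\phi_n)$ be the lcm-resolution of $I R'$: $F_n$ is the free $M(X)$-graded $R'$-module on the $n$-faces $a_0<\dots<a_n$ of $\Delta$, such a face having degree $a_n$; $\phi_n$ sends it to $\sum_{i<n}(-1)^i(\text{omit }a_i)+(-1)^n(x^{a_n}/x^{a_{n-1}})(\text{omit }a_n)$; and the augmentation $F_0\to IR'$ sends a vertex $a$ to $x^a$. On $C_\bullet(a)\otimes_{\mathbb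 F} R'$ let $V_a=\sum_{\sigma\in MSpl(a)}y_\sigma\,\sigma$ if $a$ is critical and $V_a=\frac1{m(a)}\sum_{\sigma\in MSpl(a)}\sigma$ otherwise, and let $W_a=V_a dV_a(\mathrm{id}-V_a d)$. Let $W$ be the map $F_n\to F_{n+1}$, for all $n$, that agrees with $W_a$ on the span of the faces with largest vertex $a$; let $\Phi=\mathrm{id}-\phi W-W\phi$; and let $\pi=\Phi^{1+\dim L'}$, where $\dim L'$ is the largest length $n$ of a chain $a_0<\dots<a_n$ in $L'$. Let $\mathfrak M=\pi(\mathfrak F)$. **Theorem.** 1. $\Bbbk'$ is a finitely generated field extension of $\Bbbk$. It is purely transcendental over $\Bbbk$ of degree $\sum_{a\in L'_{crit}}(m(a)-1)$; in characteristic zero $\Bbbk'=\Bbbk$. 2. $\mathfrak F$ is an $M(X)$-graded free resolution of $IR'$ over $R'$. The map $\pi$ is an idempotent $M(X)$-homogeneous morphism of complexes of $R'$-modules, so that it is a projection of $\mathfrak F$ onto the direct summand $\mathfrak M$. With the induced grading, differential and augmentation, $\mathfrak M$ is a minimal free $M(X)$-graded resolution of $IR'$ over $R'$ by modules of finite rank.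 3. The group $G_I$ acts on $\Bbbk'$ by field automorphisms over $\Bbbk$, with $\gamma(y_\sigma)=y_{\gamma\sigma}$ for all $\gamma \in G_I$; here $\gamma\sigma\in MSpl(\gamma(a))$ is the conjugate of $\sigma\in MSpl(a)$ by the bijection that $\gamma$ induces on faces. For $\gamma\in G_I$ denote also by $\gamma$ the ring automorphism of $R'$ that acts on coefficients by this action and on monomials by $x^m\mapsto x^{\gamma(m)}$. 4. There is a group homomorphism $G_I\to Aut_{\Bbbk}(\mathfrak M)$, $\gamma\mapsto\mathfrak M(\gamma)$, into the group of automorphisms of the complex of $\Bbbk$-vector spaces $\mathfrak M$, where $\mathfrak M(\gamma)$ is the restriction to $\mathfrak M$ of the map $\sum_c f_c\,c\mapsto\sum_c\gamma(f_c)\,\gamma(c)$ on $\mathfrak F$ ($c$ running over faces, $f_c\in R'$). For each $\gamma$ the map $\mathfrak M(\gamma)\colon\mathfrak M\to\gamma_*\mathfrak M$ is an isomorphism of complexes of free $M(X)$-graded $R'$-modules that lifts the isomorphism $\gamma\colon IR'\to\gamma_*(IR')$. Here $\gamma_*N$ is $N$ with $f\in R'$ acting as $\gamma(f)$, graded so that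 its component of degree $e$ is the component of $N$ of degree $\gamma(e)$. -/

import Mathlib

noncomputable section

namespace LcmRes

universe u v w

/-! ### Chain complexes, chain homotopies and their flows

A nonnegatively graded chain complex of `S`-modules is given by modules `N n` and maps
`d n : N (n + 1) → N n`; a chain homotopy is a family of maps `D n : N n → N (n + 1)`. -/

section Complexes

variable {S : Type*} [CommRing S] {N : ℕ → Type*} [∀ n, AddCommGroup (N n)]
  [∀ n, Module S (N n)]

/-- The composite `D d` on `N n`, where `d` is the differential (so it is zero for `n = 0`). -/
def homotopyD (d : ∀ n, N (n + 1) →ₗ[S] N n) (D : ∀ n, N n →ₗ[S] N (n + 1)) :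
    ∀ n, N n →ₗ[S] N n
  | 0 => 0
  | n + 1 => D n ∘ₗ d n

/-- The flow (deformation along `D`) `id - d D - D d`. -/
def flow (d : ∀ n, N (n + 1) →ₗ[S] N n) (D : ∀ n, N n →ₗ[S] N (n + 1)) (n : ℕ) :
    N n →ₗ[S] N n :=
  LinearMap.id - d n ∘ₗ D n - homotopyD d D n

/-- The homotopy `D d D (id - D d)`. When `d D d = d`, this is the splitting that equals
`D (d D)⁻¹` on the image of `d D` and is zero on the image of `D d` and on
`ker (D d) ∩ ker (d D)`. -/
def hat (d : ∀ n, N (n + 1) →ₗ[S] N n) (D : ∀ n, N n →ₗ[S] N (n + 1)) (n : ℕ) :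
    N n →ₗ[S] N (n + 1) :=
  D n ∘ₗ d n ∘ₗ D n ∘ₗ (LinearMap.id - homotopyD d D n)

/-- The group of automorphisms of a chain complex: degreewise linear automorphisms that
commute with the differential. -/
def complexAut (d : ∀ n, N (n + 1) →ₗ[S] N n) : Subgroup (∀ n, N n ≃ₗ[S] N n) where
  carrier := {f | ∀ n x, d n (f (n + 1) x) = f n (d n x)}
  mul_mem' {f g} hf hg n x := by
    change d n (f (n + 1) (g (n + 1) x)) = f n (g n (d n x))
    rw [hf, hg]
  one_mem' n x := rfl
  inv_mem' {f} hf n x := by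
    change d n ((f (n + 1)).symm x) = (f n).symm (d n x)
    rw [LinearEquiv.eq_symm_apply, ← hf, LinearEquiv.apply_symm_apply]

end Complexes

/-! ### Matroidal splittings of a complex of based vector spaces -/

section Matroidal

variable {K : Type*} [Field K] {B : ℕ → Type*}

/-- The differential out of homological degree `n`; it is zero for `n = 0`. -/
def dFrom (d : ∀ n, (B (n + 1) →₀ K) →ₗ[K] (B n →₀ K)) :
    ∀ n, (B n →₀ K) →ₗ[K] (B (n - 1) →₀ K)
  | 0 => 0
  | n + 1 => d n

/-- A chain homotopy `D` on the complex with components `C n = (B n →₀ K)` is a matroidal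
splitting if it is induced by some choice, for every `n`, of

* a set `X n` of canonical basis elements of `C n` which the differential maps bijectively onto
  a basis of the space of boundaries that is its image; and
* a set `Z n` of cycles, each of the form `z = b - ∑_{c ∈ X n} r_c c` with `b ∉ X n` a canonical
  basis element, which maps bijectively onto a basis of the `n`-th homology.

Here "induced" means that `D` sends `d c` to `c` for `c ∈ X (n + 1)` and is zero on
`X n` and on `Z n`; since `C n` is the direct sum of the boundaries and the spans of `Z n` and
`X n`, this determines `D`. -/
def IsMatroidal (d : ∀ n, (B (n + 1) →₀ K) →ₗ[K] (B n →₀ K))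
    (D : ∀ n, (B n →₀ K) →ₗ[K] (B (n + 1) →₀ K)) : Prop :=
  ∃ (X : ∀ n, Set (B n)) (Z : ∀ n, Set (B n →₀ K)), ∀ n,
    (LinearIndepOn K (fun b => dFrom d n (Finsupp.single b 1)) (X n) ∧
      Submodule.span K ((fun b => dFrom d n (Finsupp.single b 1)) '' X n) =
        LinearMap.range (dFrom d n)) ∧
    (∀ z ∈ Z n, dFrom d n z = 0 ∧ ∃ b, b ∉ X n ∧
      Finsupp.single b 1 - z ∈ Submodule.span K ((fun c => Finsupp.single c (1 : K)) '' X n)) ∧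
    (LinearIndepOn K (LinearMap.range (d n)).mkQ (Z n) ∧
      Submodule.span K ((LinearMap.range (d n)).mkQ '' Z n) =
        (LinearMap.ker (dFrom d n)).map (LinearMap.range (d n)).mkQ) ∧
    (∀ c ∈ X (n + 1), D n (d n (Finsupp.single c 1)) = Finsupp.single c 1) ∧
    (∀ c ∈ X n, D n (Finsupp.single c 1) = 0) ∧
    (∀ z ∈ Z n, D n z = 0)

/-- Extension of scalars of a map of based free modules along a ring homomorphism. -/
def extendScalars {K S : Type*} [CommRing K] [CommRing S] {B B' : Type*} (f : K →+* S)
    (D : (B →₀ K) →ₗ[K] (B' →₀ K)) : (B →₀ S) →ₗ[S] (B' →₀ S) :=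
  Finsupp.linearCombination S
    (fun b => (D (Finsupp.single b 1)).mapRange f (map_zero f))

/-- Transport of chain homotopies along bijections of the canonical bases. -/
def transport {B' : ℕ → Type*} (e : ∀ n, B n ≃ B' n) :
    (∀ n, (B n →₀ K) →ₗ[K] (B (n + 1) →₀ K)) ≃
      (∀ n, (B' n →₀ K) →ₗ[K] (B' (n + 1) →₀ K)) :=
  Equiv.piCongrRight fun n =>
    (LinearEquiv.arrowCongr (Finsupp.domLCongr (R := K) (M := K) (e n))
      (Finsupp.domLCongr (R := K) (M := K) (e (n + 1)))).toEquiv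

theorem transport_apply {B' : ℕ → Type*} (e : ∀ n, B n ≃ B' n)
    (D : ∀ n, (B n →₀ K) →ₗ[K] (B (n + 1) →₀ K)) (n : ℕ) (x : B n →₀ K) :
    transport e D n (Finsupp.domLCongr (R := K) (M := K) (e n) x) =
      Finsupp.domLCongr (R := K) (M := K) (e (n + 1)) (D n x) := by
  change Finsupp.domLCongr (R := K) (M := K) (e (n + 1)) (D n
    ((Finsupp.domLCongr (R := K) (M := K) (e n)).symm
      (Finsupp.domLCongr (R := K) (M := K) (e n) x))) = _
  rw [LinearEquiv.symm_apply_apply]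

theorem IsMatroidal.transport {B' : ℕ → Type*} (e : ∀ n, B n ≃ B' n)
    {d : ∀ n, (B (n + 1) →₀ K) →ₗ[K] (B n →₀ K)}
    {d' : ∀ n, (B' (n + 1) →₀ K) →ₗ[K] (B' n →₀ K)}
    (hd : ∀ n x, d' n (Finsupp.domLCongr (R := K) (M := K) (e (n + 1)) x) =
      Finsupp.domLCongr (R := K) (M := K) (e n) (d n x))
    {D : ∀ n, (B n →₀ K) →ₗ[K] (B (n + 1) →₀ K)} (hD : IsMatroidal d D) :
    IsMatroidal d' (LcmRes.transport e D) := by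
  obtain ⟨X, Z, h⟩ := hD
  set E : ∀ n, (B n →₀ K) ≃ₗ[K] (B' n →₀ K) :=
    fun n => Finsupp.domLCongr (R := K) (M := K) (e n) with hE
  have hEs : ∀ n b, E n (Finsupp.single b 1) = Finsupp.single (e n b) 1 := fun n b => by
    simp [hE]
  have hd' : ∀ n x, d' n (E (n + 1) x) = E n (d n x) := hd
  have ht : ∀ n x, LcmRes.transport e D n (E n x) = E (n + 1) (D n x) :=
    fun n x => transport_apply e D n x
  have hF : ∀ n x, dFrom d' n (E n x) = E (n - 1) (dFrom d n x) := by
    intro n x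
    cases n with
    | zero => simp [dFrom]
    | succ n => exact hd n x
  have hrF : ∀ n, LinearMap.range (dFrom d' n) =
      (LinearMap.range (dFrom d n)).map (E (n - 1)).toLinearMap := by
    intro n
    ext y
    constructor
    · rintro ⟨x, rfl⟩
      obtain ⟨x, rfl⟩ := (E n).surjective x
      exact ⟨_, ⟨x, rfl⟩, (hF n x).symm⟩
    · rintro ⟨_, ⟨x, rfl⟩, rfl⟩
      exact ⟨E n x, hF n x⟩
  have hr : ∀ n, LinearMap.range (d' n) =
      (LinearMap.range (d n)).map (E n).toLinearMap := fun n => hrF (n + 1)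
  have hker : ∀ n, LinearMap.ker (dFrom d' n) =
      (LinearMap.ker (dFrom d n)).map (E n).toLinearMap := by
    intro n
    ext y
    obtain ⟨x, rfl⟩ := (E n).surjective y
    simp [hF]
  let Q : ∀ n, ((B n →₀ K) ⧸ LinearMap.range (d n)) ≃ₗ[K]
      ((B' n →₀ K) ⧸ LinearMap.range (d' n)) := fun n =>
    Submodule.Quotient.equiv _ _ (E n) (hr n).symm
  have hQ : ∀ n x, Q n ((LinearMap.range (d n)).mkQ x) =
      (LinearMap.range (d' n)).mkQ (E n x) := fun n x => rfl
  have himg : ∀ n, (fun b => dFrom d' n (Finsupp.single b 1)) '' (e n '' X n) =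
      E (n - 1) '' ((fun b => dFrom d n (Finsupp.single b 1)) '' X n) := by
    intro n
    rw [Set.image_image, Set.image_image]
    refine Set.image_congr fun b _ => ?_
    rw [← hF, hEs]
  have hmk : ∀ n, (LinearMap.range (d' n)).mkQ '' (E n '' Z n) =
      Q n '' ((LinearMap.range (d n)).mkQ '' Z n) := by
    intro n
    rw [Set.image_image, Set.image_image]
    exact Set.image_congr fun b _ => (hQ n b).symm
  refine ⟨fun n => e n '' X n, fun n => E n '' Z n, fun n => ?_⟩
  obtain ⟨⟨h1, h2⟩, h3, ⟨h4, h5⟩, h6, h7, h8⟩ := h n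
  refine ⟨⟨?_, ?_⟩, ?_, ⟨?_, ?_⟩, ?_, ?_, ?_⟩
  · refine LinearIndepOn.image_of_comp (e n) _ ?_
    have : ((fun b => dFrom d' n (Finsupp.single b 1)) ∘ e n) =
        (E (n - 1)).toLinearMap ∘ (fun b => dFrom d n (Finsupp.single b 1)) := by
      funext b
      simp only [Function.comp_apply, LinearEquiv.coe_coe, ← hF, hEs]
    rw [this]
    exact h1.map_injOn _ (E (n - 1)).injective.injOn
  · rw [himg, hrF, ← h2, Submodule.map_span]
    rfl
  · rintro _ ⟨z, hz, rfl⟩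
    obtain ⟨hz0, b, hb, hbz⟩ := h3 z hz
    refine ⟨by rw [hF, hz0, map_zero], e n b, ?_, ?_⟩
    · rintro ⟨b', hb', hbb⟩
      exact hb ((e n).injective hbb ▸ hb')
    · have := Submodule.mem_map_of_mem (f := (E n).toLinearMap) hbz
      rw [Submodule.map_span, Set.image_image] at this
      rw [Set.image_image]
      simpa [hEs] using this
  · refine LinearIndepOn.image_of_comp (E n) _ ?_
    have : ((LinearMap.range (d' n)).mkQ ∘ E n) =
        (Q n).toLinearMap ∘ (LinearMap.range (d n)).mkQ := by
      funext b
      exact (hQ n b).symm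
    rw [this]
    exact h4.map_injOn _ (Q n).injective.injOn
  · rw [hmk]
    have : Submodule.span K (Q n '' ((LinearMap.range (d n)).mkQ '' Z n)) =
        (Submodule.span K ((LinearMap.range (d n)).mkQ '' Z n)).map (Q n).toLinearMap := by
      rw [Submodule.map_span]; rfl
    rw [this, h5, hker, ← Submodule.map_comp, ← Submodule.map_comp]
    rfl
  · rintro _ ⟨c, hc, rfl⟩
    rw [← hEs, hd', ht, h6 c hc]
  · rintro _ ⟨c, hc, rfl⟩
    rw [← hEs, ht, h7 c hc, map_zero]
  · rintro _ ⟨z, hz, rfl⟩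
    rw [ht, h8 z hz, map_zero]

end Matroidal

/-! ### The lcm-lattice and its symmetries

The free abelian monoid `M(X)` on `X` is `X →₀ ℕ`. -/

section Lattice

variable {X : Type u}

/-- The minimal generators of a monomial ideal. -/
def minGens (I : AddSemigroupIdeal (X →₀ ℕ)) : Set (X →₀ ℕ) := {m | Minimal (· ∈ I) m}

/-- The poset `L'` of all least common multiples of nonempty finite sets of minimal generators.
If the ideal is proper, this is the lcm-lattice without its bottom element `1`. -/
def lcmPoset (I : AddSemigroupIdeal (X →₀ ℕ)) : Set (X →₀ ℕ) :=
  {a | ∃ s : Finset (X →₀ ℕ), s.Nonempty ∧ (s : Set (X →₀ ℕ)) ⊆ minGens I ∧ s.sup id = a}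

/-- The group `G_I` of all automorphisms of the monoid `M(X)` that preserve the ideal `I`.
(Mathlib writes the composition of automorphisms of an additive monoid additively.) -/
def symGroup (I : AddSemigroupIdeal (X →₀ ℕ)) :
    Subgroup (Multiplicative (AddAut (X →₀ ℕ))) where
  carrier := {γ | ∀ m, γ.toAdd m ∈ I ↔ m ∈ I}
  mul_mem' {f g} hf hg m := by
    change f.toAdd (g.toAdd m) ∈ I ↔ m ∈ I
    rw [hf, hg]
  one_mem' m := Iff.rfl
  inv_mem' {f} hf m := by
    change f.toAdd.symm m ∈ I ↔ m ∈ I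
    rw [← hf, AddEquiv.apply_symm_apply]

variable {I : AddSemigroupIdeal (X →₀ ℕ)}

/-- The automorphism of the monoid `M(X)` underlying an element of `G_I`. -/
def symAut (γ : symGroup I) : (X →₀ ℕ) ≃+ (X →₀ ℕ) := γ.1.toAdd

theorem aut_le_iff (γ : (X →₀ ℕ) ≃+ (X →₀ ℕ)) (a b : X →₀ ℕ) : γ a ≤ γ b ↔ a ≤ b := by
  constructor
  · intro h
    obtain ⟨c, hc⟩ := exists_add_of_le h
    obtain ⟨c, rfl⟩ := γ.surjective c
    rw [← map_add] at hc
    exact (γ.injective hc) ▸ le_self_add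
  · intro h
    obtain ⟨c, rfl⟩ := exists_add_of_le h
    rw [map_add]
    exact le_self_add

theorem symAut_mem_minGens (γ : symGroup I) {m : X →₀ ℕ} (hm : m ∈ minGens I) :
    symAut γ m ∈ minGens I := by
  refine ⟨(γ.2 m).2 hm.1, fun y hy hle => ?_⟩
  obtain ⟨y, rfl⟩ := (symAut γ).surjective y
  rw [aut_le_iff] at hle ⊢
  exact hm.2 ((γ.2 y).1 hy) hle

theorem symAut_mem_lcmPoset (γ : symGroup I) {a : X →₀ ℕ} (ha : a ∈ lcmPoset I) :
    symAut γ a ∈ lcmPoset I := by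
  classical
  obtain ⟨s, hs, hsI, rfl⟩ := ha
  refine ⟨s.image (symAut γ), hs.image _, ?_, ?_⟩
  · intro y hy
    obtain ⟨x, hx, rfl⟩ := Finset.mem_image.1 (Finset.mem_coe.1 hy)
    exact symAut_mem_minGens γ (hsI hx)
  · apply le_antisymm
    · refine Finset.sup_le fun y hy => ?_
      obtain ⟨x, hx, rfl⟩ := Finset.mem_image.1 hy
      exact (aut_le_iff _ _ _).2 (Finset.le_sup (f := id) hx)
    · rw [← (symAut γ).apply_symm_apply ((s.image (symAut γ)).sup id), aut_le_iff]
      refine Finset.sup_le fun x hx => ?_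
      rw [← aut_le_iff (symAut γ), (symAut γ).apply_symm_apply]
      exact Finset.le_sup (f := id) (Finset.mem_image_of_mem _ hx)

/-- The action of an element of `G_I` on the poset `L'`. -/
def latticeIso (γ : symGroup I) : lcmPoset I ≃o lcmPoset I where
  toFun a := ⟨symAut γ a, symAut_mem_lcmPoset γ a.2⟩
  invFun a := ⟨symAut γ⁻¹ a, symAut_mem_lcmPoset γ⁻¹ a.2⟩
  left_inv a := Subtype.ext ((symAut γ).symm_apply_apply a)
  right_inv a := Subtype.ext ((symAut γ).apply_symm_apply a)
  map_rel_iff' := aut_le_iff _ _ _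

end Lattice

/-! ### Faces of the order complex and the strata -/

section Faces

variable {X : Type u} {I : AddSemigroupIdeal (X →₀ ℕ)}

/-- The (canonically oriented) `n`-faces `a₀ < ⋯ < aₙ` of the order complex of `L'`. -/
abbrev Face (I : AddSemigroupIdeal (X →₀ ℕ)) (n : ℕ) : Type u := Fin (n + 1) ↪o lcmPoset I

/-- The largest vertex `aₙ` of the face `a₀ < ⋯ < aₙ`. -/
def Face.top {n : ℕ} (c : Face I n) : lcmPoset I := c (Fin.last n)

/-- The face obtained by omitting the vertex `aᵢ`. -/
def Face.del {n : ℕ} (c : Face I (n + 1)) (i : Fin (n + 2)) : Face I n :=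
  (Fin.succAboveOrderEmb i).trans c

/-- The action of an element of `G_I` on faces. -/
def faceEquiv (γ : symGroup I) (n : ℕ) : Face I n ≃ Face I n where
  toFun c := c.trans (latticeIso γ).toOrderEmbedding
  invFun c := c.trans (latticeIso γ).symm.toOrderEmbedding
  left_inv c := by ext i : 1; exact (latticeIso γ).symm_apply_apply (c i)
  right_inv c := by ext i : 1; exact (latticeIso γ).apply_symm_apply (c i)

/-- The `n`-faces with largest vertex `a`: the canonical basis of the relative simplicial chains
`Cₙ(a) = Cₙ(Δ_{≤ a}, Δ_{< a})`. -/
abbrev StratumFace (a : lcmPoset I) (n : ℕ) : Type u := {c : Face I n // c.top = a}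

open Classical in
/-- The differential of the relative simplicial chain complex of `(Δ_{≤ a}, Δ_{< a})` with
coefficients in `S`; faces whose largest vertex is not `a` are zero in it. -/
def stratumD (S : Type*) [CommRing S] (a : lcmPoset I) (n : ℕ) :
    (StratumFace a (n + 1) →₀ S) →ₗ[S] (StratumFace a n →₀ S) :=
  Finsupp.linearCombination S fun c => ∑ i : Fin (n + 2),
    if h : (c.1.del i).top = a then Finsupp.single ⟨c.1.del i, h⟩ ((-1) ^ (i : ℕ)) else 0

/-- The bijection from the faces with largest vertex `a` to those with largest vertex `γ a`. -/
def stratumEquiv (γ : symGroup I) (a : lcmPoset I) (n : ℕ) :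
    StratumFace a n ≃ StratumFace (latticeIso γ a) n :=
  (faceEquiv γ n).subtypeEquiv fun c => by
    change c (Fin.last n) = a ↔ latticeIso γ (c (Fin.last n)) = latticeIso γ a
    exact (latticeIso γ).injective.eq_iff.symm

theorem stratumD_equiv (S : Type*) [CommRing S] (γ : symGroup I) (a : lcmPoset I) (n : ℕ)
    (x : StratumFace a (n + 1) →₀ S) :
    stratumD S (latticeIso γ a) n
        (Finsupp.domLCongr (R := S) (M := S) (stratumEquiv γ a (n + 1)) x) =
      Finsupp.domLCongr (R := S) (M := S) (stratumEquiv γ a n) (stratumD S a n x) := by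
  induction x using Finsupp.induction_linear with
  | zero => simp
  | add x y hx hy => simp only [map_add, hx, hy]
  | single c r =>
    rw [Finsupp.domLCongr_single]
    simp only [stratumD, Finsupp.linearCombination_single, map_smul, map_sum]
    congr 1
    refine Finset.sum_congr rfl fun i _ => ?_
    by_cases h : (c.1.del i).top = a
    · have h' : ((stratumEquiv γ a (n + 1) c).1.del i).top = latticeIso γ a := by
        exact congrArg (latticeIso γ) h
      rw [dif_pos h, dif_pos h', Finsupp.domLCongr_single]
      rfl
    · have h' : ((stratumEquiv γ a (n + 1) c).1.del i).top ≠ latticeIso γ a := fun h' =>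
        h ((latticeIso γ).injective h')
      rw [dif_neg h, dif_neg h', map_zero]

end Faces

/-! ### Matroidal splittings of the strata and the field extension -/

section Extension

variable {X : Type u} {I : AddSemigroupIdeal (X →₀ ℕ)} (k : Type v) [Field k]

/-- The chain homotopies on the stratum at `a`, over the prime subfield of `k`. -/
abbrev StratumHomotopy (a : lcmPoset I) : Type (max u v) :=
  ∀ n, (StratumFace a n →₀ (⊥ : Subfield k)) →ₗ[(⊥ : Subfield k)]
    (StratumFace a (n + 1) →₀ (⊥ : Subfield k))

/-- The set of all matroidal splittings of the relative chain complex of `(Δ_{≤ a}, Δ_{< a})`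
over the prime subfield of `k`. -/
def MSpl (a : lcmPoset I) : Set (StratumHomotopy k a) :=
  {σ | IsMatroidal (stratumD (⊥ : Subfield k) a) σ}

/-- The number `m(a)` of matroidal splittings. -/
def msplCount (a : lcmPoset I) : ℕ := (MSpl k a).ncard

/-- The element `a` is critical if the characteristic of `k` divides `m(a)`. -/
def IsCritical (a : lcmPoset I) : Prop := ringChar k ∣ msplCount k a

/-- The action of `γ` sends homotopies on the stratum at `a` to those on the stratum at `γ a`. -/
def homotopyMap (γ : symGroup I) (a : lcmPoset I) :
    StratumHomotopy k a ≃ StratumHomotopy k (latticeIso γ a) :=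
  transport (stratumEquiv γ a)

theorem homotopyMap_mem (γ : symGroup I) (a : lcmPoset I) {σ : StratumHomotopy k a}
    (h : σ ∈ MSpl k a) : homotopyMap k γ a σ ∈ MSpl k (latticeIso γ a) :=
  IsMatroidal.transport (stratumEquiv γ a) (stratumD_equiv _ γ a) h

theorem homotopyMap_mem_iff (γ : symGroup I) (a : lcmPoset I) {σ : StratumHomotopy k a} :
    homotopyMap k γ a σ ∈ MSpl k (latticeIso γ a) ↔ σ ∈ MSpl k a := by
  refine ⟨fun h => ?_, homotopyMap_mem k γ a⟩
  have hd : ∀ n x, stratumD (⊥ : Subfield k) a n (Finsupp.domLCongr (R := (⊥ : Subfield k))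
      (M := (⊥ : Subfield k)) (stratumEquiv γ a (n + 1)).symm x) =
      Finsupp.domLCongr (R := (⊥ : Subfield k)) (M := (⊥ : Subfield k))
        (stratumEquiv γ a n).symm (stratumD (⊥ : Subfield k) (latticeIso γ a) n x) := by
    intro n x
    rw [← Finsupp.domLCongr_symm, ← Finsupp.domLCongr_symm, LinearEquiv.eq_symm_apply,
      ← stratumD_equiv, LinearEquiv.apply_symm_apply]
  have := IsMatroidal.transport (fun n => (stratumEquiv γ a n).symm) hd h
  suffices hs : σ = transport (fun n => (stratumEquiv γ a n).symm) (homotopyMap k γ a σ) by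
    rw [hs]
    exact this
  funext n
  refine LinearMap.ext fun x => ?_
  obtain ⟨x, rfl⟩ := (Finsupp.domLCongr (R := (⊥ : Subfield k)) (M := (⊥ : Subfield k))
    (stratumEquiv γ a n)).symm.surjective x
  rw [Finsupp.domLCongr_symm, transport_apply, ← Finsupp.domLCongr_symm,
    ← Finsupp.domLCongr_symm, LinearEquiv.eq_symm_apply]
  exact (transport_apply (stratumEquiv γ a) σ n _).symm.trans
    (by rw [LinearEquiv.apply_symm_apply]; rfl)

theorem msplCount_latticeIso (γ : symGroup I) (a : lcmPoset I) :
    msplCount k (latticeIso γ a) = msplCount k a := by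
  have : MSpl k (latticeIso γ a) = homotopyMap k γ a '' MSpl k a := by
    ext τ
    constructor
    · intro h
      obtain ⟨σ, rfl⟩ := (homotopyMap k γ a).surjective τ
      exact ⟨σ, (homotopyMap_mem_iff k γ a).1 h, rfl⟩
    · rintro ⟨σ, h, rfl⟩
      exact homotopyMap_mem k γ a h
  rw [msplCount, this, Set.ncard_image_of_injective _ (homotopyMap k γ a).injective, msplCount]

theorem IsCritical.latticeIso (γ : symGroup I) {a : lcmPoset I} (h : IsCritical k a) :
    IsCritical k (latticeIso γ a) := by
  rw [IsCritical, msplCount_latticeIso]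
  exact h

variable (I)

/-- The set `L'_crit` of critical elements. -/
abbrev Crit : Type u := {a : lcmPoset I // IsCritical k a}

/-- The index set of the variables `y_σ`, the disjoint union of the sets of matroidal splittings
of the strata at the critical elements. -/
abbrev YIndex : Type (max u v) := Σ a : Crit I k, MSpl k a.1

/-- The ring `k[Y] / (l_a | a critical)` where `l_a = 1 - ∑_σ y_σ`, the sum being over the
matroidal splittings of the stratum at `a`. -/
abbrev CoordRing : Type (max u v) :=
  MvPolynomial (YIndex I k) k ⧸ Ideal.span (Set.range fun a : Crit I k =>
    (1 : MvPolynomial (YIndex I k) k) - ∑ᶠ σ : MSpl k a.1, MvPolynomial.X ⟨a, σ⟩)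

/-- The extension `k'` of `k`: the ring of fractions of `k[Y] / (l_a | a critical)`. -/
def ExtField : Type (max u v) := FractionRing (CoordRing I k)

instance : CommRing (ExtField I k) := inferInstanceAs (CommRing (FractionRing (CoordRing I k)))

instance : Algebra k (ExtField I k) :=
  inferInstanceAs (Algebra k (FractionRing (CoordRing I k)))

variable {I}

/-- The element `y_σ` of `k'`. -/
def yElt (y : YIndex I k) : ExtField I k :=
  algebraMap (CoordRing I k) (FractionRing (CoordRing I k))
    (Ideal.Quotient.mk _ (MvPolynomial.X y))

/-- The action of `G_I` on the variables `y_σ`. -/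
def yMap (γ : symGroup I) (y : YIndex I k) : YIndex I k :=
  ⟨⟨latticeIso γ y.1.1, y.1.2.latticeIso k γ⟩,
    ⟨homotopyMap k γ y.1.1 y.2.1, homotopyMap_mem k γ y.1.1 y.2.2⟩⟩

end Extension

/-! ### Multigraded modules and resolutions over a polynomial ring -/

section Graded

variable {X : Type u} {S : Type v} [CommRing S]

/-- The multigrading of the polynomial ring. -/
def polyDeg (X : Type u) (S : Type v) [CommRing S] (e : X →₀ ℕ) :
    Submodule S (MvPolynomial X S) :=
  Submodule.span S {MvPolynomial.monomial e 1}

open Classical in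
/-- A family of `S`-submodules is a grading by `M(X)` of a module over `S[X]`, for which this
module is a finite free graded module (i.e. it has a finite homogeneous basis). -/
structure IsGradedFree {N : Type w} [AddCommGroup N] [Module S N]
    [Module (MvPolynomial X S) N] (gr : (X →₀ ℕ) → Submodule S N) : Prop where
  isInternal : DirectSum.IsInternal gr
  monomial_smul_mem : ∀ (e e' : X →₀ ℕ), ∀ x ∈ gr e,
    MvPolynomial.monomial e' (1 : S) • x ∈ gr (e' + e)
  exists_basis : ∃ (r : ℕ) (b : Module.Basis (Fin r) (MvPolynomial X S) N),
    ∀ i, ∃ e, b i ∈ gr e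

/-- The complex of graded modules `N`, with differential `d` and augmentation `ε`, is a
`M(X)`-graded free resolution of the ideal `J` of the polynomial ring. -/
structure IsGradedFreeResolution {N : ℕ → Type w} [∀ n, AddCommGroup (N n)]
    [∀ n, Module S (N n)] [∀ n, Module (MvPolynomial X S) (N n)]
    (gr : ∀ n, (X →₀ ℕ) → Submodule S (N n))
    (d : ∀ n, N (n + 1) →ₗ[MvPolynomial X S] N n)
    (ε : N 0 →ₗ[MvPolynomial X S] MvPolynomial X S) (J : Ideal (MvPolynomial X S)) : Prop where
  isGradedFree : ∀ n, IsGradedFree (gr n)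
  d_mem : ∀ n e, ∀ x ∈ gr (n + 1) e, d n x ∈ gr n e
  aug_mem : ∀ e, ∀ x ∈ gr 0 e, ε x ∈ polyDeg X S e
  exact_d : ∀ n, Function.Exact (d (n + 1)) (d n)
  exact_aug : Function.Exact (d 0) ε
  range_aug : LinearMap.range ε = J

/-- Minimality: the differential has image in `𝔪 N`, with `𝔪` the ideal generated by the
variables. -/
def IsMinimalComplex {N : ℕ → Type w} [∀ n, AddCommGroup (N n)]
    [∀ n, Module (MvPolynomial X S) (N n)]
    (d : ∀ n, N (n + 1) →ₗ[MvPolynomial X S] N n) : Prop :=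
  ∀ n, LinearMap.range (d n) ≤
    Ideal.span (Set.range (MvPolynomial.X : X → MvPolynomial X S)) •
      (⊤ : Submodule (MvPolynomial X S) (N n))

/-- The ideal of the polynomial ring generated by the monomials in `I`. -/
def monomialIdeal (I : AddSemigroupIdeal (X →₀ ℕ)) (S : Type v) [CommRing S] :
    Ideal (MvPolynomial X S) :=
  Ideal.span ((fun m => MvPolynomial.monomial m (1 : S)) '' (I : Set (X →₀ ℕ)))

end Graded

/-! ### The lcm-resolution -/

section Resolution

variable {X : Type u} (I : AddSemigroupIdeal (X →₀ ℕ)) (S : Type v) [CommRing S]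

/-- The modules of the lcm-resolution over `S[X]`. -/
abbrev LcmMod (n : ℕ) : Type (max u v) := Face I n →₀ MvPolynomial X S

/-- The differential of the lcm-resolution. Omitting a vertex other than the largest one does
not change the degree of the face, so the monomial below is then `1`. -/
def lcmD (n : ℕ) : LcmMod I S (n + 1) →ₗ[MvPolynomial X S] LcmMod I S n :=
  Finsupp.linearCombination (MvPolynomial X S) fun c => ∑ i : Fin (n + 2),
    Finsupp.single (c.del i)
      (MvPolynomial.monomial ((c.top : X →₀ ℕ) - ((c.del i).top : X →₀ ℕ)) ((-1) ^ (i : ℕ)))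

/-- The augmentation of the lcm-resolution, sending a vertex `a` to the monomial `x ^ a`. -/
def lcmAug : LcmMod I S 0 →ₗ[MvPolynomial X S] MvPolynomial X S :=
  Finsupp.linearCombination (MvPolynomial X S) fun c =>
    MvPolynomial.monomial (c.top : X →₀ ℕ) 1

/-- The multigrading of the lcm-resolution: a face has the degree of its largest vertex. -/
def lcmDeg (n : ℕ) (e : X →₀ ℕ) : Submodule S (LcmMod I S n) :=
  Submodule.span S {x | ∃ (c : Face I n) (e' : X →₀ ℕ), e' + (c.top : X →₀ ℕ) = e ∧
    x = Finsupp.single c (MvPolynomial.monomial e' 1)}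

variable {I S}

/-- The vector field on the lcm-resolution induced by homotopies `W a` on the strata. -/
def inducedField (W : ∀ (a : lcmPoset I) (n : ℕ),
      (StratumFace a n →₀ MvPolynomial X S) →ₗ[MvPolynomial X S]
        (StratumFace a (n + 1) →₀ MvPolynomial X S)) (n : ℕ) :
    LcmMod I S n →ₗ[MvPolynomial X S] LcmMod I S (n + 1) :=
  Finsupp.linearCombination (MvPolynomial X S) fun c =>
    (W c.top n (Finsupp.single ⟨c, rfl⟩ 1)).mapDomain Subtype.val

end Resolution

/-! ### The canonical minimal resolution -/

section Canonical

variable {X : Type u} (I : AddSemigroupIdeal (X →₀ ℕ)) (k : Type v) [Field k]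

/-- The polynomial ring `R' = k'[X]`. -/
abbrev PolyExt : Type (max u v) := MvPolynomial X (ExtField I k)

/-- The inclusion of the prime subfield of `k` in `R'`. -/
def primeToPoly : (⊥ : Subfield k) →+* PolyExt I k :=
  (algebraMap k (PolyExt I k)).comp (⊥ : Subfield k).subtype

variable {I}

open Classical in
/-- The average of all matroidal splittings of the stratum at `a`, with the generic weights `y_σ`
if `a` is critical, and with the weights `1 / m(a)` otherwise. -/
def averageHomotopy (a : lcmPoset I) (n : ℕ) :
    (StratumFace a n →₀ PolyExt I k) →ₗ[PolyExt I k] (StratumFace a (n + 1) →₀ PolyExt I k) :=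
  if h : IsCritical k a then
    ∑ᶠ σ : MSpl k a, (MvPolynomial.C (yElt k ⟨⟨a, h⟩, σ⟩) : PolyExt I k) •
      extendScalars (primeToPoly I k) (σ.1 n)
  else
    algebraMap k (PolyExt I k) ((msplCount k a : k)⁻¹) •
      ∑ᶠ σ : MSpl k a, extendScalars (primeToPoly I k) (σ.1 n)

variable (I)

/-- The canonical vector field on the lcm-resolution. -/
def vectorField (n : ℕ) :
    LcmMod I (ExtField I k) n →ₗ[PolyExt I k] LcmMod I (ExtField I k) (n + 1) :=
  inducedField (fun a => hat (stratumD (PolyExt I k) a) (averageHomotopy k a)) n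

/-- The dimension of the poset `L'`, the largest length of a chain `a₀ < ⋯ < aₙ`. -/
def lcmDim : ℕ := sSup {n | Nonempty (Face I n)}

/-- The stable iterate of the flow of the canonical vector field. -/
def proj (n : ℕ) : LcmMod I (ExtField I k) n →ₗ[PolyExt I k] LcmMod I (ExtField I k) n :=
  flow (lcmD I (ExtField I k)) (vectorField I k) n ^ (1 + lcmDim I)

/-- The modules of the canonical minimal resolution. -/
def minRes (n : ℕ) : Submodule (PolyExt I k) (LcmMod I (ExtField I k) n) :=
  LinearMap.range (proj I k n)

/-- The multigrading of the canonical minimal resolution, induced by that of the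
lcm-resolution. -/
def minResDeg (n : ℕ) (e : X →₀ ℕ) : Submodule (ExtField I k) (minRes I k n) :=
  (lcmDeg I (ExtField I k) n e).comap ((minRes I k n).subtype.restrictScalars (ExtField I k))

variable {I k}

/-- The differential of the canonical minimal resolution: the restriction of the differential of
the lcm-resolution. -/
def minResD (hd : ∀ n, ∀ x ∈ minRes I k (n + 1), lcmD I (ExtField I k) n x ∈ minRes I k n)
    (n : ℕ) : minRes I k (n + 1) →ₗ[PolyExt I k] minRes I k n :=
  (lcmD I (ExtField I k) n).restrict (hd n)

variable (I k) in
/-- The augmentation of the canonical minimal resolution: the restriction of the augmentation of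
the lcm-resolution. -/
def minResAug : minRes I k 0 →ₗ[PolyExt I k] PolyExt I k :=
  (lcmAug I (ExtField I k)).domRestrict (minRes I k 0)

/-- The ring automorphism of `k'[X]` induced by `γ` and by an automorphism `τ` of `k'`: it acts
on coefficients by `τ` and sends a monomial `x ^ m` to `x ^ γ(m)`. -/
def polyMap (τ : ExtField I k ≃ₐ[k] ExtField I k) (γ : symGroup I) :
    PolyExt I k →+* PolyExt I k :=
  MvPolynomial.eval₂Hom ((MvPolynomial.C).comp (τ : ExtField I k →+* ExtField I k))
    (fun x => MvPolynomial.monomial (symAut γ (Finsupp.single x 1)) 1)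

/-- The action on the lcm-resolution, sending a linear combination `∑ f_c c` of faces to
`∑ γ(f_c) γ(c)`. -/
def lcmMap (τ : ExtField I k ≃ₐ[k] ExtField I k) (γ : symGroup I) (n : ℕ)
    (x : LcmMod I (ExtField I k) n) : LcmMod I (ExtField I k) n :=
  (x.mapRange (polyMap τ γ) (map_zero _)).mapDomain (faceEquiv γ n)

end Canonical

end LcmRes

end

open LcmRes

/-! The lcm-resolution is exact degree by degree. In multidegree `e ∈ I` it is the augmented chain
complex of the order complex of the elements of `L'` that divide `x^e`. These have a largest
element, so the order complex is a cone, and coning contracts it (`lcmD_cone_add_cone_lcmD`,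
`lcmD_cone_add_coneAug`).

Write φ = d + l, where d keeps the largest vertex and l omits it, with coefficients in the ideal 𝔪
generated by the variables. Every matroidal splitting satisfies dσd = d. This condition is affine in
σ, so it passes to combinations whose weights have sum 1. The relations of `k'` supply such weights
at critical elements, and invertibility of `m(a)` supplies them elsewhere (`finsum_weight`). From
dVd = d it follows that W = VdV(1 - Vd) satisfies W² = 0, WdW = W and dWd = d.

Hence ΦW = W - WφW = -WlW. Each application of Φ to the image of W lowers the largest vertices
strictly, so π = Φ^(1 + dim) kills the image of W (`IsStrataSplitting.flow_pow_field`). Since Φ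
commutes with φ, π kills φW and Wφ as well; thus πΦ = π, and π is idempotent. Since Φ also commutes
with W, the map Wφ vanishes on the image of π. For x in that image, dx = dWdx = -dWlx, so φx has
coefficients in 𝔪. This is minimality (`IsStrataSplitting.lcmD_mem_of_flow_pow_eq`). Exactness
passes to direct summands.

Freeness of the image is elementary. A homogeneous idempotent differs from its constant part by a
map that strictly lowers the total degree of generators. Idempotents that agree on the pieces of a
finite filtration are conjugate (`exists_equiv_intertwining`), and the image of the constant part is
extended from a vector space.

Finally, no choice enters the construction. An element of `G_I` permutes faces, strata and weighted
splittings, so its semilinear action commutes with V, W, Φ and π (`averageHomotopy_stratumMap`,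
`lcmMap_proj`). Eliminating one variable per critical element exhibits `k'` as a rational function
field (`quotientNormEquiv`). -/

noncomputable section

namespace LcmRes

universe u v w

/-! ### Existence and finiteness of matroidal splittings. -/

section MatroidalFacts

variable {K : Type*} [Field K] {B : ℕ → Type*}
  {d : ∀ n, (B (n + 1) →₀ K) →ₗ[K] (B n →₀ K)} {D : ∀ n, (B n →₀ K) →ₗ[K] (B (n + 1) →₀ K)}

/-- A matroidal splitting inverts the differential on boundaries. -/
theorem IsMatroidal.d_D_d (h : IsMatroidal d D) (n : ℕ) (x : B (n + 1) →₀ K) :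
    d n (D n (d n x)) = d n x := by
  obtain ⟨X, Z, h⟩ := h
  have hx : d n x ∈ LinearMap.range (dFrom d (n + 1)) := ⟨x, rfl⟩
  rw [← (h (n + 1)).1.2] at hx
  have hle : Submodule.span K ((fun b => dFrom d (n + 1) (Finsupp.single b 1)) '' X (n + 1)) ≤
      LinearMap.eqLocus (d n ∘ₗ D n) LinearMap.id := by
    rw [Submodule.span_le]
    rintro _ ⟨c, hc, rfl⟩
    change d n (D n (d n (Finsupp.single c 1))) = d n (Finsupp.single c 1)
    rw [(h n).2.2.2.1 c hc]
  exact hle hx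

/-- The differential is injective on the span of `X`. This makes the cycle `z(b)` unique. -/
theorem dFrom_injOn_span {n : ℕ} {X : Set (B n)}
    (hX : LinearIndepOn K (fun b => dFrom d n (Finsupp.single b 1)) X) :
    Disjoint (Submodule.span K ((fun c => Finsupp.single c (1 : K)) '' X))
      (LinearMap.ker (dFrom d n)) := by
  have := Submodule.range_ker_disjoint (f := dFrom d n)
    (v := fun b : X => Finsupp.single (b : B n) (1 : K)) hX
  rwa [Set.image_eq_range]

/-- `X` accounts for chains modulo cycles and `Z` for cycles modulo boundaries. Hence a splitting is
determined by its values on `X`, on `Z` and on boundaries. -/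
theorem matroidal_span_eq_top {n : ℕ} {X : Set (B n)} {Z : Set (B n →₀ K)}
    (hX : Submodule.span K ((fun b => dFrom d n (Finsupp.single b 1)) '' X) =
        LinearMap.range (dFrom d n))
    (hZ : Submodule.span K ((LinearMap.range (d n)).mkQ '' Z) =
        (LinearMap.ker (dFrom d n)).map (LinearMap.range (d n)).mkQ) :
    Submodule.span K ((fun c => Finsupp.single c (1 : K)) '' X) ⊔ Submodule.span K Z ⊔
      LinearMap.range (d n) = ⊤ := by
  rw [eq_top_iff]
  intro x _
  have h1 : dFrom d n x ∈ (Submodule.span K ((fun c => Finsupp.single c (1 : K)) '' X)).map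
      (dFrom d n) := by
    rw [Submodule.map_span, Set.image_image, hX]
    exact ⟨x, rfl⟩
  obtain ⟨s, hs, hsx⟩ := h1
  have h2 : (LinearMap.range (d n)).mkQ (x - s) ∈
      (Submodule.span K Z).map (LinearMap.range (d n)).mkQ := by
    rw [Submodule.map_span, hZ]
    exact ⟨x - s, by simp [hsx], rfl⟩
  obtain ⟨z, hz, hzx⟩ := h2
  have h3 : (x - s) - z ∈ LinearMap.range (d n) := by
    rw [← Submodule.ker_mkQ (LinearMap.range (d n)), LinearMap.mem_ker, map_sub, hzx, sub_self]
  have : x = s + z + (x - s - z) := by abel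
  rw [this]
  exact Submodule.add_mem_sup (Submodule.add_mem_sup hs hz) h3

/-- In each degree only finitely many maps are components of matroidal splittings. -/
theorem finite_matroidal_component [∀ n, Finite (B n)]
    (d : ∀ n, (B (n + 1) →₀ K) →ₗ[K] (B n →₀ K)) (n : ℕ) :
    Finite {L : (B n →₀ K) →ₗ[K] (B (n + 1) →₀ K) // ∃ D, IsMatroidal d D ∧ D n = L} := by
  choose D hD hDn using fun L : {L : (B n →₀ K) →ₗ[K] (B (n + 1) →₀ K) //
    ∃ D, IsMatroidal d D ∧ D n = L} => L.2
  choose X Z h using hD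
  -- The component in degree `n` depends only on `X n`, `X (n + 1)` and `Z n`. Recording the basis
  -- elements `b` whose cycle lies in `Z n`, and not the cycles themselves, keeps the target finite
  -- over an infinite field.
  let f : {L : (B n →₀ K) →ₗ[K] (B (n + 1) →₀ K) // ∃ D, IsMatroidal d D ∧ D n = L} →
      Set (B n) × Set (B (n + 1)) × Set (B n) := fun L => (X L n, X L (n + 1),
    {b | ∃ z ∈ Z L n, Finsupp.single b 1 - z ∈
      Submodule.span K ((fun c => Finsupp.single c (1 : K)) '' X L n)})
  refine Finite.of_injective f fun L L' hL => ?_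
  simp only [f, Prod.mk.injEq] at hL
  obtain ⟨h1, h2, h3⟩ := hL
  have key : ∀ L L', X L n = X L' n →
      {b | ∃ z ∈ Z L n, Finsupp.single b 1 - z ∈
        Submodule.span K ((fun c => Finsupp.single c (1 : K)) '' X L n)} =
      {b | ∃ z ∈ Z L' n, Finsupp.single b 1 - z ∈
        Submodule.span K ((fun c => Finsupp.single c (1 : K)) '' X L' n)} →
      Z L n ⊆ Z L' n := by
    intro L L' h1 h3 z hz
    obtain ⟨hz0, b, hb, hbz⟩ := (h L n).2.1 z hz
    have : b ∈ {b | ∃ z ∈ Z L n, Finsupp.single b 1 - z ∈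
        Submodule.span K ((fun c => Finsupp.single c (1 : K)) '' X L n)} := ⟨z, hz, hbz⟩
    rw [h3] at this
    obtain ⟨z', hz', hbz'⟩ := this
    have hz0' := ((h L' n).2.1 z' hz').1
    rw [← h1] at hbz'
    -- Two cycles attached to the same `b` differ by a cycle in the span of `X`, which is zero.
    have hd := (Submodule.disjoint_def.1 (dFrom_injOn_span (h L n).1.1)) (z - z')
      (by simpa using Submodule.sub_mem _ hbz' hbz) (by simp [hz0, hz0'])
    rw [sub_eq_zero.1 hd]
    exact hz'
  have hZ : Z L n = Z L' n := (key L L' h1 h3).antisymm (key L' L h1.symm h3.symm)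
  have htop := matroidal_span_eq_top (h L n).1.2 (h L n).2.2.1.2
  have hr : LinearMap.range (d n) =
      Submodule.span K ((fun b => d n (Finsupp.single b 1)) '' X L (n + 1)) :=
    (h L (n + 1)).1.2.symm
  apply Subtype.ext
  rw [← hDn L, ← hDn L', ← LinearMap.eqLocus_eq_top, eq_top_iff, ← htop, hr]
  refine sup_le (sup_le ?_ ?_) ?_ <;> rw [Submodule.span_le]
  · rintro _ ⟨c, hc, rfl⟩
    change D L n (Finsupp.single c 1) = D L' n (Finsupp.single c 1)
    rw [(h L n).2.2.2.2.1 c hc, (h L' n).2.2.2.2.1 c (h1 ▸ hc)]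
  · intro z hz
    change D L n z = D L' n z
    rw [(h L n).2.2.2.2.2 z hz, (h L' n).2.2.2.2.2 z (hZ ▸ hz)]
  · rintro _ ⟨c, hc, rfl⟩
    change D L n (d n (Finsupp.single c 1)) = D L' n (d n (Finsupp.single c 1))
    rw [(h L n).2.2.2.1 c hc, (h L' n).2.2.2.1 c (h2 ▸ hc)]

theorem finite_isMatroidal [∀ n, Finite (B n)] {N : ℕ} (hN : ∀ n, N ≤ n → IsEmpty (B n))
    (d : ∀ n, (B (n + 1) →₀ K) →ₗ[K] (B n →₀ K)) : {D | IsMatroidal d D}.Finite := by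
  have := finite_matroidal_component d
  let f : {D | IsMatroidal d D} → ∀ n : Fin N,
      {L : (B n →₀ K) →ₗ[K] (B (n + 1) →₀ K) // ∃ D, IsMatroidal d D ∧ D n = L} :=
    fun D n => ⟨D.1 n, D.1, D.2, rfl⟩
  refine Set.finite_coe_iff.1 (Finite.of_injective f fun D D' h => ?_)
  apply Subtype.ext
  funext n
  by_cases hn : n < N
  · exact congrArg Subtype.val (congrFun h ⟨n, hn⟩)
  · have := hN n (not_lt.1 hn)
    exact Subsingleton.elim _ _

/-- A linear map can be prescribed on a linearly independent family. -/
theorem exists_linearMap_of_linearIndependent {ι V W : Type*} [AddCommGroup V] [Module K V]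
    [AddCommGroup W] [Module K W] {v : ι → V} (hv : LinearIndependent K v) (w : ι → W) :
    ∃ f : V →ₗ[K] W, ∀ i, f (v i) = w i := by
  obtain ⟨g, hg⟩ := LinearMap.exists_leftInverse_of_injective
    (Finsupp.linearCombination K v) (LinearMap.ker_eq_bot.2 hv)
  refine ⟨Finsupp.linearCombination K w ∘ₗ g, fun i => ?_⟩
  have : g (v i) = Finsupp.single i 1 := by
    have := LinearMap.congr_fun hg (Finsupp.single i 1)
    simpa using this
  simp [this]

/-- Maximal independent sets provide `X` and then `Z`. The vectors of `X n`, those of `Z n` and the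
boundaries of `X (n + 1)` are jointly independent, so `D n` can be prescribed on all of them. -/
theorem exists_isMatroidal (hd : ∀ n x, d n (d (n + 1) x) = 0) :
    ∃ D, IsMatroidal d D := by
  have hrk : ∀ n, LinearMap.range (d n) ≤ LinearMap.ker (dFrom d n) := by
    rintro n _ ⟨x, rfl⟩
    cases n with
    | zero => simp [dFrom]
    | succ n => exact hd n x
  have hXex : ∀ n, ∃ X : Set (B n),
      LinearIndepOn K (fun b => dFrom d n (Finsupp.single b 1)) X ∧
      Submodule.span K ((fun b => dFrom d n (Finsupp.single b 1)) '' X) =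
        LinearMap.range (dFrom d n) := by
    intro n
    obtain ⟨X, -, -, h1, h2⟩ := exists_linearIndepOn_extension
      (v := fun b => dFrom d n (Finsupp.single b 1)) (linearIndepOn_empty K _)
      (Set.empty_subset Set.univ)
    refine ⟨X, h2, le_antisymm ?_ ?_⟩
    · rw [Submodule.span_le]
      rintro _ ⟨b, -, rfl⟩
      exact ⟨_, rfl⟩
    · rintro _ ⟨x, rfl⟩
      induction x using Finsupp.induction_linear with
      | zero => simp
      | add x y hx hy => rw [map_add]; exact Submodule.add_mem _ hx hy
      | single b r =>
        rw [← mul_one r, ← smul_eq_mul, ← Finsupp.smul_single, map_smul]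
        exact Submodule.smul_mem _ _ (h1 ⟨b, trivial, rfl⟩)
  choose X hX1 hX2 using hXex
  have hZex : ∀ n, ∃ Z : Set (B n →₀ K),
      (∀ z ∈ Z, dFrom d n z = 0 ∧ ∃ b, b ∉ X n ∧
      Finsupp.single b 1 - z ∈ Submodule.span K ((fun c => Finsupp.single c (1 : K)) '' X n)) ∧
      LinearIndepOn K (LinearMap.range (d n)).mkQ Z ∧
      Submodule.span K ((LinearMap.range (d n)).mkQ '' Z) =
        (LinearMap.ker (dFrom d n)).map (LinearMap.range (d n)).mkQ := by
    intro n
    set t : Set (B n →₀ K) := {z | dFrom d n z = 0 ∧ ∃ b, b ∉ X n ∧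
      Finsupp.single b 1 - z ∈ Submodule.span K ((fun c => Finsupp.single c (1 : K)) '' X n)}
      with ht
    obtain ⟨Z, hZt, -, h1, h2⟩ := exists_linearIndepOn_extension
      (v := (LinearMap.range (d n)).mkQ) (linearIndepOn_empty K _) (Set.empty_subset t)
    refine ⟨Z, fun z hz => hZt hz, h2, le_antisymm ?_ ?_⟩
    · rw [Submodule.span_le]
      rintro _ ⟨z, hz, rfl⟩
      exact ⟨z, (hZt hz).1, rfl⟩
    -- The candidate cycles `z(b)` and the span of `X n` together generate all chains, so the cycles
    -- `z(b)` generate all cycles.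
    · have hall : ∀ x, x ∈ Submodule.span K t ⊔
          Submodule.span K ((fun c => Finsupp.single c (1 : K)) '' X n) := by
        intro x
        induction x using Finsupp.induction_linear with
        | zero => simp
        | add x y hx hy => exact Submodule.add_mem _ hx hy
        | single b r =>
          rw [← mul_one r, ← smul_eq_mul, ← Finsupp.smul_single]
          refine Submodule.smul_mem _ _ ?_
          by_cases hb : b ∈ X n
          · exact Submodule.mem_sup_right (Submodule.subset_span ⟨b, hb, rfl⟩)
          · have : dFrom d n (Finsupp.single b 1) ∈
                (Submodule.span K ((fun c => Finsupp.single c (1 : K)) '' X n)).map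
                  (dFrom d n) := by
              rw [Submodule.map_span, Set.image_image, hX2]
              exact ⟨_, rfl⟩
            obtain ⟨s, hs, hsb⟩ := this
            rw [← sub_add_cancel (Finsupp.single b 1) s]
            refine Submodule.add_mem_sup (Submodule.subset_span ⟨?_, b, hb, ?_⟩) hs
            · rw [map_sub, hsb, sub_self]
            · simpa using hs
      rintro _ ⟨x, hx, rfl⟩
      obtain ⟨y, hy, s, hs, rfl⟩ := Submodule.mem_sup.1 (hall x)
      have hyk : Submodule.span K t ≤ LinearMap.ker (dFrom d n) :=
        Submodule.span_le.2 fun z hz => hz.1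
      -- As `x` and `y` are cycles, so is `s`; it lies in the span of `X n` and therefore vanishes.
      have hs0 : s = 0 := Submodule.disjoint_def.1 (dFrom_injOn_span (hX1 n)) s hs (by
        simpa using Submodule.sub_mem _ hx (hyk hy))
      rw [hs0, add_zero]
      have hle : Submodule.span K t ≤ (Submodule.span K
          ((LinearMap.range (d n)).mkQ '' Z)).comap (LinearMap.range (d n)).mkQ :=
        Submodule.span_le.2 fun z hz => h1 ⟨z, hz, rfl⟩
      exact hle hy
  choose Z hZ1 hZ2 hZ3 using hZex
  have hDex : ∀ n, ∃ L : (B n →₀ K) →ₗ[K] (B (n + 1) →₀ K),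
      (∀ c ∈ X (n + 1), L (d n (Finsupp.single c 1)) = Finsupp.single c 1) ∧
      (∀ c ∈ X n, L (Finsupp.single c 1) = 0) ∧ (∀ z ∈ Z n, L z = 0) := by
    intro n
    let v₁ : X n → (B n →₀ K) := fun c => Finsupp.single (c : B n) 1
    let v₂ : Z n → (B n →₀ K) := fun z => z
    let v₃ : X (n + 1) → (B n →₀ K) := fun c => d n (Finsupp.single (c : B (n + 1)) 1)
    have hv₁ : LinearIndependent K v₁ := LinearIndependent.of_comp (dFrom d n) (hX1 n)
    have hv₂ : LinearIndependent K v₂ :=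
      LinearIndependent.of_comp (LinearMap.range (d n)).mkQ (hZ2 n)
    have hv₃ : LinearIndependent K v₃ := hX1 (n + 1)
    have h3r : Submodule.span K (Set.range v₃) ≤ LinearMap.range (d n) := by
      rw [Submodule.span_le]
      rintro _ ⟨c, rfl⟩
      exact ⟨_, rfl⟩
    have h2k : Submodule.span K (Set.range v₂) ≤ LinearMap.ker (dFrom d n) := by
      rw [Submodule.span_le]
      rintro _ ⟨z, rfl⟩
      exact (hZ1 n z z.2).1
    -- Independence of `Z n` modulo boundaries separates it from the boundaries. Below, `X n` is
    -- separated from both because it meets the cycles trivially.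
    have h23 : Disjoint (Submodule.span K (Set.range v₂)) (Submodule.span K (Set.range v₃)) := by
      have := Submodule.range_ker_disjoint (f := (LinearMap.range (d n)).mkQ) (v := v₂) (hZ2 n)
      rw [Submodule.ker_mkQ] at this
      exact this.mono_right h3r
    have hv₂₃ := hv₂.sum_type hv₃ h23
    have h1k : Disjoint (Submodule.span K (Set.range v₁)) (LinearMap.ker (dFrom d n)) :=
      Submodule.range_ker_disjoint (f := dFrom d n) (v := v₁) (hX1 n)
    have hv := hv₁.sum_type hv₂₃ (h1k.mono_right (by
      rw [Set.Sum.elim_range, Submodule.span_union]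
      exact sup_le h2k (h3r.trans (hrk n))))
    obtain ⟨L, hL⟩ := exists_linearMap_of_linearIndependent hv
      (Sum.elim 0 (Sum.elim 0 (fun c : X (n + 1) => Finsupp.single (c : B (n + 1)) (1 : K))))
    exact ⟨L, fun c hc => hL (Sum.inr (Sum.inr ⟨c, hc⟩)), fun c hc => hL (Sum.inl ⟨c, hc⟩),
      fun z hz => hL (Sum.inr (Sum.inl ⟨z, hz⟩))⟩
  choose D hD using hDex
  exact ⟨D, X, Z, fun n => ⟨⟨hX1 n, hX2 n⟩, hZ1 n, ⟨hZ2 n, hZ3 n⟩, (hD n).1, (hD n).2.1,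
    (hD n).2.2⟩⟩

end MatroidalFacts

/-! ### Finiteness of `L'` and largest elements below a monomial. -/

section LatticeFacts

variable {X : Type u} (I : AddSemigroupIdeal (X →₀ ℕ))

/-- Dickson's lemma: minimal elements form an antichain in a well-quasi-order. -/
theorem finite_minGens [Finite X] : (minGens I).Finite := by
  refine WellQuasiOrderedLE.finite_of_isAntichain fun a ha b hb hab hle => hab ?_
  exact le_antisymm hle (hb.2 ha.1 hle)

instance finite_lcmPoset [Finite X] : Finite (lcmPoset I) := by
  classical
  have : lcmPoset I ⊆ (fun s : Finset (X →₀ ℕ) => s.sup id) ''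
      ((finite_minGens I).toFinset.powerset : Set (Finset (X →₀ ℕ))) := by
    rintro _ ⟨s, -, hs, rfl⟩
    refine ⟨s, ?_, rfl⟩
    simp only [Finset.coe_powerset, Set.mem_preimage, Set.Finite.coe_toFinset, Set.mem_powerset_iff]
    exact hs
  exact Set.Finite.subset ((Finset.finite_toSet _).image _) this

theorem mem_ideal_of_le {a e : X →₀ ℕ} (ha : a ∈ I) (h : a ≤ e) : e ∈ I := by
  obtain ⟨c, rfl⟩ := exists_add_of_le h
  rw [add_comm]
  exact I.add_mem c ha

theorem mem_ideal_of_mem_lcmPoset {a : X →₀ ℕ} (ha : a ∈ lcmPoset I) : a ∈ I := by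
  obtain ⟨s, ⟨g, hg⟩, hs, rfl⟩ := ha
  exact mem_ideal_of_le I (hs hg).1 (Finset.le_sup (f := id) hg)

/-- Every monomial of the ideal is divisible by a largest element of `L'`. -/
theorem exists_greatest_lcmPoset [Finite X] {e : X →₀ ℕ} (he : e ∈ I) :
    ∃ m : lcmPoset I, (m : X →₀ ℕ) ≤ e ∧ ∀ a : lcmPoset I, (a : X →₀ ℕ) ≤ e → a ≤ m := by
  classical
  obtain ⟨g, hmin, hg⟩ := exists_minimal_le_of_wellFoundedLT (· ∈ I) e he
  -- The witness is the lcm of all minimal generators that divide `e`; there is at least one because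
  -- `e ∈ I`.
  let s := (finite_minGens I).toFinset.filter (· ≤ e)
  refine ⟨⟨s.sup id, s, ⟨g, by simpa [s, minGens, hg] using hmin⟩, fun x hx => ?_, rfl⟩, ?_, ?_⟩
  · simp only [s, Finset.coe_filter, Set.Finite.mem_toFinset] at hx
    exact hx.1
  · exact Finset.sup_le fun x hx => (Finset.mem_filter.1 hx).2
  · rintro ⟨a, ha⟩ hle
    obtain ⟨t, ht0, ht, rfl⟩ := ha
    refine Finset.sup_le (α := X →₀ ℕ) (s := t) fun x hx => ?_
    refine Finset.le_sup (α := X →₀ ℕ) (f := id) (s := s) (Finset.mem_filter.2 ⟨?_, ?_⟩)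
    · simpa using ht hx
    · exact (Finset.le_sup (α := X →₀ ℕ) (f := id) hx).trans hle

end LatticeFacts

/-! ### Faces and the identities `d ∘ d = 0`. -/

section FaceFacts

variable {X : Type u} {I : AddSemigroupIdeal (X →₀ ℕ)}

instance finite_face [Finite X] (n : ℕ) : Finite (Face I n) := DFunLike.finite _

instance finite_stratumFace [Finite X] (a : lcmPoset I) (n : ℕ) : Finite (StratumFace a n) :=
  inferInstanceAs (Finite {c : Face I n // c.top = a})

theorem Face.lt_card [Finite X] {n : ℕ} (c : Face I n) : n < Nat.card (lcmPoset I) := by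
  have := Finite.card_le_of_embedding c.toEmbedding
  simpa using this

/-- In `ℕ` the supremum of an unbounded set is 0, so `lcmDim` is meaningful only thanks to the
cardinality bound on lengths of chains. -/
theorem Face.le_lcmDim [Finite X] {n : ℕ} (c : Face I n) : n ≤ lcmDim I :=
  le_csSup ⟨Nat.card (lcmPoset I), fun _ ⟨c⟩ => c.lt_card.le⟩ ⟨c⟩

theorem isEmpty_stratumFace [Finite X] (a : lcmPoset I) (n : ℕ)
    (hn : Nat.card (lcmPoset I) ≤ n) : IsEmpty (StratumFace a n) :=
  ⟨fun c => hn.not_gt c.1.lt_card⟩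

theorem LTSeries.length_le_lcmDim [Finite X] (p : LTSeries (lcmPoset I)) :
    p.length ≤ lcmDim I :=
  Face.le_lcmDim (OrderEmbedding.ofStrictMono p.toFun p.strictMono)

theorem Face.del_top_le {n : ℕ} (c : Face I (n + 1)) (i : Fin (n + 2)) : (c.del i).top ≤ c.top :=
  c.monotone (Fin.le_last _)

theorem Face.del_castSucc_top {n : ℕ} (c : Face I (n + 1)) (i : Fin (n + 1)) :
    (c.del i.castSucc).top = c.top := by
  change c (i.castSucc.succAbove (Fin.last n)) = c (Fin.last (n + 1))
  rw [Fin.succAbove_ne_last_last (Fin.castSucc_lt_last i).ne]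

theorem Face.del_last_top_lt {n : ℕ} (c : Face I (n + 1)) : (c.del (Fin.last _)).top < c.top := by
  change c ((Fin.last _).succAbove (Fin.last n)) < c (Fin.last (n + 1))
  rw [Fin.succAbove_last, c.lt_iff_lt]
  exact Fin.castSucc_lt_last _

/-- The simplicial identity behind `d ∘ d = 0`, for an arbitrary function on faces. -/
theorem sum_del_del {A : Type*} [AddCommGroup A] {n : ℕ} (g : Face I n → A) (c : Face I (n + 2)) :
    ∑ i : Fin (n + 3), ∑ j : Fin (n + 2),
      ((-1 : ℤ) ^ ((i : ℕ) + (j : ℕ))) • g ((c.del i).del j) = 0 := by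
  rw [← Fintype.sum_prod_type' (f := fun (i : Fin (n + 3)) (j : Fin (n + 2)) =>
    ((-1 : ℤ) ^ ((i : ℕ) + (j : ℕ))) • g ((c.del i).del j))]
  -- The involution exchanges the two orders in which the same pair of vertices can be omitted; the
  -- sign changes.
  refine Finset.sum_involution (fun p _ => (p.1.succAbove p.2, p.2.predAbove p.1)) ?_ ?_ ?_ ?_
  · rintro ⟨i, j⟩ -
    have : ((c.del (i.succAbove j)).del (j.predAbove i)) = (c.del i).del j := by
      ext k : 1
      exact congrArg c (Fin.succAbove_succAbove_succAbove_predAbove i j k)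
    simp only [this, Fin.neg_one_pow_succAbove_add_predAbove, neg_smul, add_neg_cancel]
  · rintro ⟨i, j⟩ - - h
    exact Fin.succAbove_ne i j (Prod.ext_iff.1 h).1
  · intros
    exact Finset.mem_univ _
  · rintro ⟨i, j⟩ -
    exact Prod.ext (Fin.succAbove_succAbove_predAbove i j)
      (Fin.predAbove_predAbove_succAbove i j)

open Classical in
theorem stratumD_single (S : Type*) [CommRing S] (a : lcmPoset I) (n : ℕ)
    (c : StratumFace a (n + 1)) :
    stratumD S a n (Finsupp.single c 1) = ∑ i : Fin (n + 2), ((-1 : ℤ) ^ (i : ℕ)) •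
      if h : (c.1.del i).top = a then Finsupp.single ⟨c.1.del i, h⟩ (1 : S) else 0 := by
  rw [stratumD, Finsupp.linearCombination_single, one_smul]
  refine Finset.sum_congr rfl fun i _ => ?_
  split_ifs with h
  · rw [Finsupp.smul_single]
    simp
  · rw [smul_zero]

theorem stratumD_comp (S : Type*) [CommRing S] (a : lcmPoset I) (n : ℕ)
    (x : StratumFace a (n + 2) →₀ S) : stratumD S a n (stratumD S a (n + 1) x) = 0 := by
  classical
  induction x using Finsupp.induction_linear with
  | zero => simp
  | add x y hx hy => simp [hx, hy]
  | single c r =>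
    rw [← mul_one r, ← smul_eq_mul, ← Finsupp.smul_single, map_smul, map_smul, stratumD_single,
      map_sum]
    have := sum_del_del (fun b : Face I n => if h : b.top = a then
      Finsupp.single (⟨b, h⟩ : StratumFace a n) (1 : S) else 0) c.1
    refine (congrArg (r • ·) (Eq.trans (Finset.sum_congr rfl fun i _ => ?_) this)).trans
      (smul_zero r)
    rw [map_zsmul]
    simp only [pow_add, mul_smul]
    rw [← Finset.smul_sum]
    congr 1
    split_ifs with h
    · rw [stratumD_single]
    -- Once an omission has lowered the largest vertex, a second one cannot restore it, so all these
    -- truncated terms are zero.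
    · rw [map_zero, eq_comm]
      refine Finset.sum_eq_zero fun j _ => ?_
      rw [dif_neg, smul_zero]
      intro h'
      refine h (le_antisymm ((c.1.del_top_le i).trans_eq c.2) ?_)
      exact h'.ge.trans (Face.del_top_le _ _)

theorem lcmD_single (S : Type*) [CommRing S] (n : ℕ) (c : Face I (n + 1)) :
    lcmD I S n (Finsupp.single c 1) = ∑ i : Fin (n + 2), ((-1 : ℤ) ^ (i : ℕ)) •
      Finsupp.single (c.del i)
        (MvPolynomial.monomial ((c.top : X →₀ ℕ) - ((c.del i).top : X →₀ ℕ)) (1 : S)) := by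
  rw [lcmD, Finsupp.linearCombination_single, one_smul]
  refine Finset.sum_congr rfl fun i _ => ?_
  rw [Finsupp.smul_single, zsmul_eq_mul, ← map_intCast (MvPolynomial.C (σ := X) (R := S)),
    MvPolynomial.C_mul_monomial]
  simp

theorem lcmD_single' (S : Type*) [CommRing S] (n : ℕ) (c : Face I (n + 1))
    (f : MvPolynomial X S) :
    lcmD I S n (Finsupp.single c f) = ∑ i : Fin (n + 2), ((-1 : ℤ) ^ (i : ℕ)) •
      Finsupp.single (c.del i)
        (f * MvPolynomial.monomial ((c.top : X →₀ ℕ) - ((c.del i).top : X →₀ ℕ)) (1 : S)) := by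
  rw [← mul_one f, ← smul_eq_mul, ← Finsupp.smul_single, map_smul, lcmD_single, Finset.smul_sum]
  refine Finset.sum_congr rfl fun i _ => ?_
  rw [smul_comm, Finsupp.smul_single, smul_eq_mul, smul_eq_mul, mul_one]

/-- The monomials of two successive omissions multiply to `x^(top c - top b)`, which depends only on
the final face `b`. So the simplicial identity applies to a function of `b`. -/
theorem lcmD_comp (S : Type*) [CommRing S] (n : ℕ) (x : LcmMod I S (n + 2)) :
    lcmD I S n (lcmD I S (n + 1) x) = 0 := by
  induction x using Finsupp.induction_linear with
  | zero => simp
  | add x y hx hy => simp [hx, hy]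
  | single c f =>
    rw [lcmD_single', map_sum]
    have := sum_del_del (fun b : Face I n => Finsupp.single b (f * MvPolynomial.monomial
      ((c.top : X →₀ ℕ) - (b.top : X →₀ ℕ)) (1 : S))) c
    rw [← this]
    refine Finset.sum_congr rfl fun i _ => ?_
    rw [map_zsmul, lcmD_single', Finset.smul_sum]
    refine Finset.sum_congr rfl fun j _ => ?_
    rw [smul_smul, pow_add, mul_assoc f, MvPolynomial.monomial_mul, one_mul,
      tsub_add_tsub_cancel (α := X →₀ ℕ) (c.del_top_le i) ((c.del i).del_top_le j)]

end FaceFacts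

/-! ### Adjoining a new largest vertex to a face. -/

section Cone

variable {X : Type u} {I : AddSemigroupIdeal (X →₀ ℕ)}

/-- The face obtained by adding a new largest vertex. -/
def Face.snoc {n : ℕ} (c : Face I n) (m : lcmPoset I) (h : c.top < m) : Face I (n + 1) :=
  OrderEmbedding.ofStrictMono (Fin.snoc (α := fun _ => lcmPoset I) c m) (by
    intro i j hij
    induction j using Fin.lastCases with
    | last =>
      rw [Fin.snoc_last]
      obtain ⟨i, rfl⟩ := Fin.exists_castSucc_eq.2 hij.ne
      rw [Fin.snoc_castSucc]
      exact (c.monotone (Fin.le_last i)).trans_lt h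
    | cast j =>
      obtain ⟨i, rfl⟩ := Fin.exists_castSucc_eq.2 (hij.trans (Fin.castSucc_lt_last j)).ne
      rw [Fin.snoc_castSucc, Fin.snoc_castSucc]
      exact c.strictMono (Fin.castSucc_lt_castSucc_iff.1 hij))

theorem Face.snoc_top {n : ℕ} (c : Face I n) (m : lcmPoset I) (h : c.top < m) :
    (c.snoc m h).top = m :=
  Fin.snoc_last (α := fun _ => lcmPoset I) m c

theorem Face.snoc_castSucc {n : ℕ} (c : Face I n) (m : lcmPoset I) (h : c.top < m)
    (i : Fin (n + 1)) : c.snoc m h i.castSucc = c i :=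
  Fin.snoc_castSucc (α := fun _ => lcmPoset I) m c i

theorem Face.snoc_del_last {n : ℕ} (c : Face I n) (m : lcmPoset I) (h : c.top < m) :
    (c.snoc m h).del (Fin.last _) = c := by
  ext i : 1
  change c.snoc m h ((Fin.last _).succAbove i) = c i
  rw [Fin.succAbove_last, c.snoc_castSucc]

theorem Face.snoc_del_castSucc {n : ℕ} (c : Face I (n + 1)) (m : lcmPoset I) (h : c.top < m)
    (i : Fin (n + 2)) : (c.snoc m h).del i.castSucc =
      (c.del i).snoc m ((c.del_top_le i).trans_lt h) := by
  ext j : 1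
  induction j using Fin.lastCases with
  | last =>
    exact (Face.del_castSucc_top (c.snoc m h) i).trans ((c.snoc_top m h).trans
      (Face.snoc_top _ _ _).symm)
  | cast j =>
    rw [Face.snoc_castSucc]
    change c.snoc m h (i.castSucc.succAbove j.castSucc) = c (i.succAbove j)
    rw [Fin.castSucc_succAbove_castSucc, Face.snoc_castSucc]

theorem Face.del_last_snoc {n : ℕ} (c : Face I (n + 1)) :
    (c.del (Fin.last _)).snoc c.top c.del_last_top_lt = c := by
  ext j : 1
  induction j using Fin.lastCases with
  | last => exact Face.snoc_top _ _ _
  | cast j =>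
    rw [Face.snoc_castSucc]
    change c ((Fin.last _).succAbove j) = _
    rw [Fin.succAbove_last]

theorem face_ext_top {c c' : Face I 0} (h : c.top = c'.top) : c = c' := by
  ext i : 1
  rw [Fin.eq_zero i]
  exact h

/-- The vertex `a`, as a face. -/
def Face.vertex (a : lcmPoset I) : Face I 0 :=
  OrderEmbedding.ofStrictMono (fun _ => a) (fun i j h => by
    rw [Fin.eq_zero i, Fin.eq_zero j] at h
    exact absurd h (lt_irrefl _))

theorem Face.vertex_top (a : lcmPoset I) : (Face.vertex a).top = a := rfl

end Cone

/-! ### The contracting homotopy and exactness of the lcm-resolution. -/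

section Contraction

variable {X : Type u} (I : AddSemigroupIdeal (X →₀ ℕ)) (S : Type v) [CommRing S]

/-- The `S`-linear map out of a free `S[X]`-module with given values on the elements `x ^ e c`. -/
def monomialLift {X : Type u} {S : Type v} [CommRing S] {P ι : Type*} [AddCommGroup P] [Module S P]
    (g : ι → (X →₀ ℕ) → P) : (ι →₀ MvPolynomial X S) →ₗ[S] P :=
  Finsupp.lsum S fun c => (MvPolynomial.basisMonomials X S).constr S (g c)

theorem monomialLift_single {X : Type u} {S : Type v} [CommRing S] {P ι : Type*} [AddCommGroup P]
    [Module S P] (g : ι → (X →₀ ℕ) → P) (c : ι) (e : X →₀ ℕ) :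
    monomialLift (S := S) g (Finsupp.single c (MvPolynomial.monomial e 1)) = g c e := by
  rw [monomialLift, Finsupp.lsum_single]
  exact (MvPolynomial.basisMonomials X S).constr_basis S (g c) e

theorem monomial_hom_ext {X : Type u} {S : Type v} [CommRing S] {P ι : Type*} [AddCommGroup P]
    [Module S P] {f g : (ι →₀ MvPolynomial X S) →ₗ[S] P}
    (h : ∀ c e, f (Finsupp.single c (MvPolynomial.monomial e 1)) =
      g (Finsupp.single c (MvPolynomial.monomial e 1))) : f = g := by
  refine Finsupp.lhom_ext' fun c => (MvPolynomial.basisMonomials X S).ext fun e => ?_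
  simpa using h c e

variable [Finite X]

open Classical in
/-- The largest element of `L'` below `e` (if there is one). -/
def maxBelow (e : X →₀ ℕ) (h : e ∈ I) : lcmPoset I := (exists_greatest_lcmPoset I h).choose

theorem maxBelow_le (e : X →₀ ℕ) (h : e ∈ I) : (maxBelow I e h : X →₀ ℕ) ≤ e :=
  (exists_greatest_lcmPoset I h).choose_spec.1

theorem le_maxBelow (e : X →₀ ℕ) (h : e ∈ I) {a : lcmPoset I} (ha : (a : X →₀ ℕ) ≤ e) :
    a ≤ maxBelow I e h :=
  (exists_greatest_lcmPoset I h).choose_spec.2 a ha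

omit [Finite X] in
theorem add_top_mem {n : ℕ} (c : Face I n) (e : X →₀ ℕ) : e + (c.top : X →₀ ℕ) ∈ I :=
  I.add_mem e (mem_ideal_of_mem_lcmPoset I c.top.2)

theorem top_le_maxBelow {n : ℕ} (c : Face I n) {e : X →₀ ℕ} (h : e ∈ I)
    (hc : (c.top : X →₀ ℕ) ≤ e) : c.top ≤ maxBelow I e h :=
  le_maxBelow I _ _ hc

open Classical in
/-- The cone construction: `x ^ (e - top) c` is sent to the face with a new largest vertex
`maxBelow e`, with a sign. -/
def coneTerm {n : ℕ} (c : Face I n) (e : X →₀ ℕ) : LcmMod I S (n + 1) :=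
  if h : ∃ he : e ∈ I, c.top < maxBelow I e he then
    -- This sign cancels the sign with which the differential omits the new last vertex, so that the
    -- original face returns with coefficient 1.
    ((-1 : ℤ) ^ (n + 1)) • Finsupp.single (c.snoc (maxBelow I e h.1) h.2)
      (MvPolynomial.monomial (e - (maxBelow I e h.1 : X →₀ ℕ)) (1 : S))
  else 0

/-- The contracting homotopy of the lcm-resolution. -/
def cone (n : ℕ) : LcmMod I S n →ₗ[S] LcmMod I S (n + 1) :=
  monomialLift fun c e => coneTerm I S c (e + (c.top : X →₀ ℕ))

open Classical in
/-- The contracting homotopy of the lcm-resolution in degree `-1`. -/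
def coneAug : MvPolynomial X S →ₗ[S] LcmMod I S 0 :=
  (MvPolynomial.basisMonomials X S).constr S fun e =>
    if h : e ∈ I then Finsupp.single (Face.vertex (maxBelow I e h))
      (MvPolynomial.monomial (e - (maxBelow I e h : X →₀ ℕ)) (1 : S)) else 0

theorem cone_single {n : ℕ} (c : Face I n) (e : X →₀ ℕ) :
    cone I S n (Finsupp.single c (MvPolynomial.monomial e 1)) = coneTerm I S c (e + (c.top : X →₀ ℕ)) :=
  monomialLift_single _ _ _

theorem coneAug_monomial (e : X →₀ ℕ) (h : e ∈ I) :
    coneAug I S (MvPolynomial.monomial e 1) = Finsupp.single (Face.vertex (maxBelow I e h))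
      (MvPolynomial.monomial (e - (maxBelow I e h : X →₀ ℕ)) (1 : S)) := by
  refine ((MvPolynomial.basisMonomials X S).constr_basis S _ e).trans ?_
  rw [dif_pos h]

theorem coneTerm_of_lt {n : ℕ} (c : Face I n) (e : X →₀ ℕ) (he : e ∈ I)
    (h : c.top < maxBelow I e he) : coneTerm I S c e =
      ((-1 : ℤ) ^ (n + 1)) • Finsupp.single (c.snoc (maxBelow I e he) h)
      (MvPolynomial.monomial (e - (maxBelow I e he : X →₀ ℕ)) (1 : S)) :=
  dif_pos ⟨he, h⟩

theorem coneTerm_of_eq {n : ℕ} (c : Face I n) (e : X →₀ ℕ) (he : e ∈ I)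
    (h : c.top = maxBelow I e he) : coneTerm I S c e = 0 :=
  dif_neg fun h' => (h'.2.ne h)

omit [Finite X] in
theorem lcmD_single_monomial (n : ℕ) (c : Face I (n + 1)) (e : X →₀ ℕ) :
    lcmD I S n (Finsupp.single c (MvPolynomial.monomial e 1)) =
      ∑ i : Fin (n + 2), ((-1 : ℤ) ^ (i : ℕ)) • Finsupp.single (c.del i)
        (MvPolynomial.monomial (e + (c.top : X →₀ ℕ) - ((c.del i).top : X →₀ ℕ)) (1 : S)) := by
  rw [lcmD_single']
  refine Finset.sum_congr rfl fun i _ => ?_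
  rw [MvPolynomial.monomial_mul, one_mul, add_tsub_assoc_of_le]
  exact c.del_top_le i

theorem cone_lcmD_single (n : ℕ) (c : Face I (n + 1)) (e : X →₀ ℕ) :
    cone I S n (lcmD I S n (Finsupp.single c (MvPolynomial.monomial e 1))) =
      ∑ i : Fin (n + 2), ((-1 : ℤ) ^ (i : ℕ)) • coneTerm I S (c.del i) (e + (c.top : X →₀ ℕ)) := by
  rw [lcmD_single_monomial, map_sum]
  refine Finset.sum_congr rfl fun i _ => ?_
  rw [map_zsmul, cone_single, tsub_add_cancel_of_le]
  exact (show ((c.del i).top : X →₀ ℕ) ≤ c.top from c.del_top_le i).trans le_add_self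

theorem lcmD_coneTerm_of_lt {n : ℕ} (c : Face I n) (e : X →₀ ℕ)
    (he : e ∈ I) (h : c.top < maxBelow I e he) : lcmD I S n (coneTerm I S c e) =
      (∑ i : Fin (n + 1), ((-1 : ℤ) ^ (n + 1 + (i : ℕ))) •
        Finsupp.single ((c.snoc _ h).del i.castSucc)
          (MvPolynomial.monomial (e - (maxBelow I e he : X →₀ ℕ)) (1 : S))) +
      Finsupp.single c (MvPolynomial.monomial (e - (c.top : X →₀ ℕ)) 1) := by
  rw [coneTerm_of_lt I S c e he h, map_zsmul, lcmD_single_monomial, Fin.sum_univ_castSucc,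
    smul_add, Finset.smul_sum]
  congr 1
  · refine Finset.sum_congr rfl fun i _ => ?_
    rw [smul_smul, ← pow_add, Face.del_castSucc_top, add_tsub_cancel_right]
    rfl
  · rw [smul_smul, ← pow_add, Fin.val_last, ← two_mul, pow_mul, neg_one_sq, one_pow, one_smul,
      Face.snoc_del_last, Face.snoc_top, tsub_add_cancel_of_le (maxBelow_le I e he)]

/-- The differential preserves the multidegree `e + top c`, so all faces that occur are coned to the
same apex, the largest element of `L'` below this degree. -/
theorem lcmD_cone_add_cone_lcmD (n : ℕ) (x : LcmMod I S (n + 1)) :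
    lcmD I S (n + 1) (cone I S (n + 1) x) + cone I S n (lcmD I S n x) = x := by
  suffices h : (lcmD I S (n + 1)).restrictScalars S ∘ₗ cone I S (n + 1) +
      cone I S n ∘ₗ (lcmD I S n).restrictScalars S = LinearMap.id from LinearMap.congr_fun h x
  refine monomial_hom_ext fun c e => ?_
  change lcmD I S (n + 1) (cone I S (n + 1) (Finsupp.single c (MvPolynomial.monomial e 1))) +
    cone I S n (lcmD I S n (Finsupp.single c (MvPolynomial.monomial e 1))) =
      Finsupp.single c (MvPolynomial.monomial e 1)
  have he := add_top_mem I c e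
  have hle : (c.top : X →₀ ℕ) ≤ e + (c.top : X →₀ ℕ) := le_add_self
  rw [cone_single, cone_lcmD_single]
  rcases (top_le_maxBelow I c he hle).lt_or_eq with h | h
  -- The largest vertex is below the apex: coning commutes with omission up to sign, and only the
  -- term that omits the apex survives.
  · rw [lcmD_coneTerm_of_lt I S c _ he h, add_right_comm, ← Finset.sum_add_distrib,
      Finset.sum_eq_zero, zero_add, add_tsub_cancel_right (α := X →₀ ℕ)]
    intro i _
    rw [coneTerm_of_lt I S (c.del i) _ he ((c.del_top_le i).trans_lt h), smul_smul, ← pow_add,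
      Face.snoc_del_castSucc, ← add_smul]
    rw [show n + 1 + 1 + (i : ℕ) = (i : ℕ) + (n + 1) + 1 by ring, pow_succ]
    simp
  -- The apex already belongs to `c`: only the face without it has a nonzero cone, and that cone is
  -- `c`.
  · rw [coneTerm_of_eq I S c _ he h, map_zero, zero_add, Fin.sum_univ_castSucc,
      Finset.sum_eq_zero, zero_add]
    · have h' : (c.del (Fin.last (n + 1))).top < maxBelow I _ he := h ▸ c.del_last_top_lt
      rw [coneTerm_of_lt I S _ _ he h', smul_smul, ← pow_add, Fin.val_last, ← two_mul, pow_mul,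
        neg_one_sq, one_pow, one_smul]
      have h1 : (c.del (Fin.last (n + 1))).snoc _ h' = c := by
        conv_rhs => rw [← c.del_last_snoc]
        congr 1
        exact h.symm
      rw [h1, ← h, add_tsub_cancel_right (α := X →₀ ℕ)]
    · intro i _
      rw [coneTerm_of_eq I S _ _ he ((Face.del_castSucc_top c i).trans h), smul_zero]

omit [Finite X] in
theorem lcmAug_single (c : Face I 0) (f : MvPolynomial X S) :
    lcmAug I S (Finsupp.single c f) = f * MvPolynomial.monomial (c.top : X →₀ ℕ) 1 := by
  rw [lcmAug, Finsupp.linearCombination_single, smul_eq_mul]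

/-- In degree 0, omitting the original vertex from the edge to the apex leaves the apex itself;
`coneAug` after the augmentation supplies exactly this vertex with the opposite sign. -/
theorem lcmD_cone_add_coneAug (x : LcmMod I S 0) :
    lcmD I S 0 (cone I S 0 x) + coneAug I S (lcmAug I S x) = x := by
  suffices h : (lcmD I S 0).restrictScalars S ∘ₗ cone I S 0 +
      coneAug I S ∘ₗ (lcmAug I S).restrictScalars S = LinearMap.id from LinearMap.congr_fun h x
  refine monomial_hom_ext fun c e => ?_
  change lcmD I S 0 (cone I S 0 (Finsupp.single c (MvPolynomial.monomial e 1))) +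
    coneAug I S (lcmAug I S (Finsupp.single c (MvPolynomial.monomial e 1))) =
      Finsupp.single c (MvPolynomial.monomial e 1)
  have he := add_top_mem I c e
  have hle : (c.top : X →₀ ℕ) ≤ e + (c.top : X →₀ ℕ) := le_add_self
  rw [cone_single, lcmAug_single, MvPolynomial.monomial_mul, one_mul, coneAug_monomial I S _ he]
  rcases (top_le_maxBelow I c he hle).lt_or_eq with h | h
  · rw [lcmD_coneTerm_of_lt I S c _ he h, Fin.sum_univ_one, add_tsub_cancel_right (α := X →₀ ℕ)]
    have : (c.snoc _ h).del (Fin.castSucc 0) = Face.vertex (maxBelow I _ he) :=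
      face_ext_top ((Face.del_castSucc_top _ _).trans (Face.snoc_top _ _ _))
    rw [this]
    simp
  · rw [coneTerm_of_eq I S c _ he h, map_zero, zero_add,
      show Face.vertex (maxBelow I _ he) = c from face_ext_top h.symm, ← h, add_tsub_cancel_right (α := X →₀ ℕ)]

theorem lcmAug_coneAug_monomial (e : X →₀ ℕ) (h : e ∈ I) :
    lcmAug I S (coneAug I S (MvPolynomial.monomial e 1)) = MvPolynomial.monomial e 1 := by
  rw [coneAug_monomial I S e h, lcmAug_single, MvPolynomial.monomial_mul, one_mul,
    Face.vertex_top, tsub_add_cancel_of_le (maxBelow_le I e h)]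

omit [Finite X] in
theorem lcmAug_lcmD (x : LcmMod I S 1) : lcmAug I S (lcmD I S 0 x) = 0 := by
  suffices h : (lcmAug I S).restrictScalars S ∘ₗ (lcmD I S 0).restrictScalars S = 0 from
    LinearMap.congr_fun h x
  refine monomial_hom_ext fun c e => ?_
  change lcmAug I S (lcmD I S 0 (Finsupp.single c (MvPolynomial.monomial e 1))) = 0
  rw [lcmD_single_monomial, map_sum, Fin.sum_univ_two]
  have h : ∀ i, ((c.del i).top : X →₀ ℕ) ≤ e + (c.top : X →₀ ℕ) := fun i =>
    (show ((c.del i).top : X →₀ ℕ) ≤ c.top from c.del_top_le i).trans le_add_self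
  simp [lcmAug_single, MvPolynomial.monomial_mul, tsub_add_cancel_of_le (h _)]

theorem exact_lcmD (n : ℕ) : Function.Exact (lcmD I S (n + 1)) (lcmD I S n) := by
  refine fun x => ⟨fun hx => ⟨cone I S (n + 1) x, ?_⟩, ?_⟩
  · have := lcmD_cone_add_cone_lcmD I S n x
    rwa [hx, map_zero, add_zero] at this
  · rintro ⟨y, rfl⟩
    exact lcmD_comp S n y

theorem exact_lcmAug : Function.Exact (lcmD I S 0) (lcmAug I S) := by
  refine fun x => ⟨fun hx => ⟨cone I S 0 x, ?_⟩, ?_⟩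
  · have := lcmD_cone_add_coneAug I S x
    rwa [hx, map_zero, add_zero] at this
  · rintro ⟨y, rfl⟩
    exact lcmAug_lcmD I S y

theorem range_lcmAug : LinearMap.range (lcmAug I S) = monomialIdeal I S := by
  apply le_antisymm
  · rintro _ ⟨x, rfl⟩
    induction x using Finsupp.induction_linear with
    | zero => simp
    | add x y hx hy => rw [map_add]; exact add_mem hx hy
    | single c f =>
      rw [lcmAug_single]
      exact Ideal.mul_mem_left _ _
        (Ideal.subset_span ⟨_, mem_ideal_of_mem_lcmPoset I c.top.2, rfl⟩)
  · refine Ideal.span_le.2 ?_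
    rintro _ ⟨e, he, rfl⟩
    exact ⟨_, lcmAug_coneAug_monomial I S e he⟩

end Contraction

/-! ### Criteria for internal gradings. -/

section InternalGrading

variable {S : Type*} [CommRing S] {E : Type*} [DecidableEq E]

/-- A criterion for gradings, by maps that separate the components. -/
theorem isInternal_of_separating {N P : Type*} [AddCommGroup N] [Module S N] [AddCommGroup P]
    [Module S P] (gr : E → Submodule S N) (p : E → N →ₗ[S] P)
    (hp : ∀ e, ∀ x ∈ gr e, p e x = 0 → x = 0) (hp' : ∀ e e', e' ≠ e → ∀ x ∈ gr e', p e x = 0)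
    (htop : ⨆ e, gr e = ⊤) : DirectSum.IsInternal gr := by
  rw [DirectSum.isInternal_submodule_iff_iSupIndep_and_iSup_eq_top]
  refine ⟨fun e => ?_, htop⟩
  rw [Submodule.disjoint_def]
  intro x hx hx'
  refine hp e x hx ?_
  have : ⨆ j, ⨆ (_ : j ≠ e), gr j ≤ LinearMap.ker (p e) :=
    iSup_le fun j => iSup_le fun hj y hy => hp' e j hj y hy
  exact this hx'

/-- Separation is inherited along the injection `i`. The pieces span because `r` is surjective and
`i ∘ r` is homogeneous: a decomposition upstairs is pushed down by `r`. -/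
theorem isInternal_comap {N P M : Type*} [AddCommGroup N] [Module S N] [AddCommGroup P]
    [Module S P] [AddCommGroup M] [Module S M] (gr : E → Submodule S N) (p : E → N →ₗ[S] P)
    (hp : ∀ e, ∀ x ∈ gr e, p e x = 0 → x = 0) (hp' : ∀ e e', e' ≠ e → ∀ x ∈ gr e', p e x = 0)
    (htop : ⨆ e, gr e = ⊤) (i : M →ₗ[S] N) (hi : Function.Injective i) (r : N →ₗ[S] M)
    (hr : Function.Surjective r) (hir : ∀ e, ∀ x ∈ gr e, i (r x) ∈ gr e) :
    DirectSum.IsInternal fun e => (gr e).comap i := by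
  refine isInternal_of_separating _ (fun e => p e ∘ₗ i)
    (fun e x hx h => hi ((hp e _ hx h).trans (map_zero i).symm))
    (fun e e' hne x hx => hp' e e' hne _ hx) ?_
  rw [eq_top_iff, ← LinearMap.range_eq_top.2 hr, ← Submodule.map_top, ← htop, Submodule.map_iSup]
  refine iSup_mono fun e => ?_
  rintro _ ⟨x, hx, rfl⟩
  exact hir e x hx

theorem isInternal_comap_range {R N P : Type*} [CommRing R] [Algebra S R] [AddCommGroup N]
    [Module S N] [Module R N] [IsScalarTower S R N] [AddCommGroup P] [Module S P]
    (gr : E → Submodule S N) (p : E → N →ₗ[S] P)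
    (hp : ∀ e, ∀ x ∈ gr e, p e x = 0 → x = 0) (hp' : ∀ e e', e' ≠ e → ∀ x ∈ gr e', p e x = 0)
    (htop : ⨆ e, gr e = ⊤) (A : N →ₗ[R] N) (hA : ∀ e, ∀ x ∈ gr e, A x ∈ gr e) :
    DirectSum.IsInternal fun e => (gr e).comap ((LinearMap.range A).subtype.restrictScalars S) :=
  isInternal_comap gr p hp hp' htop
    ((LinearMap.range A).subtype.restrictScalars S) Subtype.val_injective
    (A.rangeRestrict.restrictScalars S) A.surjective_rangeRestrict hA

end InternalGrading

/-! ### Multigraded free modules over a polynomial ring. -/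

section FinsuppGrading

variable {X : Type u} {S : Type v} [CommRing S] {ι : Type w} (deg : ι → (X →₀ ℕ))

/-- The multigrading of the free `S[X]`-module on a set of generators with given degrees. -/
def finsuppDeg (e : X →₀ ℕ) : Submodule S (ι →₀ MvPolynomial X S) :=
  Submodule.span S {x | ∃ (c : ι) (e' : X →₀ ℕ), e' + deg c = e ∧
    x = Finsupp.single c (MvPolynomial.monomial e' 1)}

variable {deg}

theorem single_monomial_mem_finsuppDeg (c : ι) (e : X →₀ ℕ) :
    Finsupp.single c (MvPolynomial.monomial e (1 : S)) ∈ finsuppDeg deg (e + deg c) :=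
  Submodule.subset_span ⟨c, e, rfl, rfl⟩

theorem single_one_mem_finsuppDeg (c : ι) :
    Finsupp.single c (1 : MvPolynomial X S) ∈ finsuppDeg deg (deg c) :=
  Submodule.subset_span ⟨c, 0, zero_add _, rfl⟩

theorem monomial_smul_mem_finsuppDeg (e e' : X →₀ ℕ) {x : ι →₀ MvPolynomial X S}
    (hx : x ∈ finsuppDeg deg e) :
    MvPolynomial.monomial e' (1 : S) • x ∈ finsuppDeg deg (e' + e) := by
  suffices h : finsuppDeg deg e ≤ (finsuppDeg deg (e' + e)).comap
      (((LinearMap.lsmul (MvPolynomial X S) (ι →₀ MvPolynomial X S))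
        (MvPolynomial.monomial e' (1 : S))).restrictScalars S) from h hx
  refine Submodule.span_le.2 ?_
  rintro _ ⟨c, m, rfl, rfl⟩
  refine Submodule.subset_span ⟨c, e' + m, add_assoc _ _ _, ?_⟩
  simp [MvPolynomial.monomial_mul]

theorem add_deg_eq_of_mem_finsuppDeg {e : X →₀ ℕ} {x : ι →₀ MvPolynomial X S}
    (hx : x ∈ finsuppDeg deg e) (c : ι) (m : X →₀ ℕ) (h : (x c).coeff m ≠ 0) : m + deg c = e := by
  classical
  by_contra hne
  refine h ?_
  suffices h : finsuppDeg deg e ≤ LinearMap.ker ((MvPolynomial.lcoeff S m) ∘ₗ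
      (Finsupp.lapply (R := S) c : (ι →₀ MvPolynomial X S) →ₗ[S] MvPolynomial X S)) from h hx
  refine Submodule.span_le.2 ?_
  rintro _ ⟨c', m', h', rfl⟩
  change MvPolynomial.coeff m ((Finsupp.single c' (MvPolynomial.monomial m' (1 : S))) c) = 0
  rw [Finsupp.single_apply]
  split_ifs with hc
  · subst hc
    rw [MvPolynomial.coeff_monomial, if_neg]
    rintro rfl
    exact hne h'
  · simp

/-- A criterion for homogeneity of a linear map out of a graded free module. -/
theorem map_mem_of_single {P : Type*} [AddCommGroup P] [Module S P] [Module (MvPolynomial X S) P]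
    [IsScalarTower S (MvPolynomial X S) P] (gr : (X →₀ ℕ) → Submodule S P)
    (hgr : ∀ e e', ∀ x ∈ gr e, MvPolynomial.monomial e' (1 : S) • x ∈ gr (e' + e))
    (f : (ι →₀ MvPolynomial X S) →ₗ[MvPolynomial X S] P)
    (hf : ∀ c, f (Finsupp.single c 1) ∈ gr (deg c)) (e : X →₀ ℕ) (x : ι →₀ MvPolynomial X S)
    (hx : x ∈ finsuppDeg deg e) : f x ∈ gr e := by
  suffices h : finsuppDeg deg e ≤ (gr e).comap (f.restrictScalars S) from h hx
  refine Submodule.span_le.2 ?_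
  rintro _ ⟨c, m, rfl, rfl⟩
  have := hgr _ m _ (hf c)
  rw [← map_smul, Finsupp.smul_single, smul_eq_mul, mul_one] at this
  exact this

open Classical in
/-- The projection to the component of degree `e`. -/
def finsuppDegProj (deg : ι → (X →₀ ℕ)) (e : X →₀ ℕ) :
    (ι →₀ MvPolynomial X S) →ₗ[S] (ι →₀ MvPolynomial X S) :=
  monomialLift fun c m => if m + deg c = e then
    Finsupp.single c (MvPolynomial.monomial m 1) else 0

theorem finsuppDegProj_of_mem {e : X →₀ ℕ} {x : ι →₀ MvPolynomial X S}
    (hx : x ∈ finsuppDeg deg e) : finsuppDegProj deg e x = x := by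
  suffices h : finsuppDeg deg e ≤ LinearMap.eqLocus (finsuppDegProj deg e) LinearMap.id from h hx
  refine Submodule.span_le.2 ?_
  rintro _ ⟨c, m, rfl, rfl⟩
  exact (monomialLift_single _ _ _).trans (if_pos rfl)

theorem finsuppDegProj_of_mem_of_ne {e e' : X →₀ ℕ} (hne : e' ≠ e) {x : ι →₀ MvPolynomial X S}
    (hx : x ∈ finsuppDeg deg e') : finsuppDegProj deg e x = 0 := by
  suffices h : finsuppDeg deg e' ≤ LinearMap.ker (finsuppDegProj deg e) from h hx
  refine Submodule.span_le.2 ?_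
  rintro _ ⟨c, m, rfl, rfl⟩
  exact (monomialLift_single _ _ _).trans (if_neg hne)

theorem iSup_finsuppDeg : ⨆ e, finsuppDeg (S := S) deg e = ⊤ := by
  rw [eq_top_iff]
  intro x _
  have h : ∀ c e, Finsupp.single c (MvPolynomial.monomial e (1 : S)) ∈
      ⨆ e, finsuppDeg (S := S) deg e := fun c e =>
    Submodule.mem_iSup_of_mem _ (single_monomial_mem_finsuppDeg c e)
  have := monomial_hom_ext (f := (⨆ e, finsuppDeg (S := S) deg e).mkQ) (g := 0) (fun c e => by
    rw [LinearMap.zero_apply, Submodule.mkQ_apply, Submodule.Quotient.mk_eq_zero]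
    exact h c e)
  have hx := LinearMap.congr_fun this x
  rwa [LinearMap.zero_apply, Submodule.mkQ_apply, Submodule.Quotient.mk_eq_zero] at hx

open Classical in
theorem isInternal_finsuppDeg : DirectSum.IsInternal (finsuppDeg (S := S) deg) :=
  isInternal_of_separating _ (finsuppDegProj deg)
    (fun e x hx h => by rwa [finsuppDegProj_of_mem hx] at h)
    (fun e e' hne x hx => finsuppDegProj_of_mem_of_ne hne hx) iSup_finsuppDeg

theorem isGradedFree_finsuppDeg [Finite ι] : IsGradedFree (finsuppDeg (S := S) deg) where
  isInternal := isInternal_finsuppDeg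
  monomial_smul_mem e e' x hx := monomial_smul_mem_finsuppDeg e e' hx
  exists_basis := by
    obtain ⟨r, ⟨f⟩⟩ := Finite.exists_equiv_fin ι
    refine ⟨r, Finsupp.basisSingleOne.reindex f, fun i => ⟨deg (f.symm i), ?_⟩⟩
    rw [Module.Basis.reindex_apply, Finsupp.coe_basisSingleOne]
    exact single_one_mem_finsuppDeg _

end FinsuppGrading

/-! ### Images of homogeneous idempotents are graded free. -/

/-- The hypothesis is `IsField` because `ExtField` carries only a ring structure; the field
structure is introduced locally. -/
theorem exists_linearIndepOn_spanning {S V ι : Type*} [CommRing S] (hS : IsField S)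
    [AddCommGroup V] [Module S V] (v : ι → V) :
    ∃ B : Set ι, LinearIndepOn S v B ∧ ∀ i, v i ∈ Submodule.span S (v '' B) := by
  let _ := hS.toField
  obtain ⟨B, -, -, h1, h2⟩ := exists_linearIndepOn_extension
    (v := v) (linearIndepOn_empty S _) (Set.empty_subset Set.univ)
  exact ⟨B, h2, fun i => h1 ⟨i, trivial, rfl⟩⟩

/-- Idempotents that agree on the graded pieces of a finite filtration are conjugate. -/
theorem exists_equiv_intertwining {R M : Type*} [CommRing R] [AddCommGroup M] [Module R M]
    (A P : Module.End R M) (hA : ∀ x, A (A x) = A x) (hP : ∀ x, P (P x) = P x)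
    (F : ℕ → Submodule R M) (h0 : F 0 = ⊥) {K : ℕ} (hK : F K = ⊤)
    (hPF : ∀ k, ∀ x ∈ F k, P x ∈ F k) (hAF : ∀ k, ∀ x ∈ F (k + 1), A x - P x ∈ F k) :
    ∃ T : M ≃ₗ[R] M, (∀ x, T (P x) = A (P x)) ∧ ∀ x, A (T x) = A (P x) := by
  -- With this choice `1 + D = A P + (1 - A)(1 - P)`, which maps the decomposition given by `P` to
  -- the one given by `A`. It is invertible because `D` is nilpotent: `2 P - 1` preserves the
  -- filtration and `A - P` lowers it.
  set D : Module.End R M := (A - P) * (2 • P - 1) with hD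
  have hDx : ∀ x, D x = A (P x + P x - x) - P (P x + P x - x) := by
    intro x
    rw [hD, Module.End.mul_apply, LinearMap.sub_apply, LinearMap.sub_apply, two_smul,
      LinearMap.add_apply, Module.End.one_apply]
  have hDF : ∀ k, ∀ x ∈ F k, (D ^ k) x = 0 := by
    intro k
    induction k with
    | zero =>
      intro x hx
      rw [h0, Submodule.mem_bot] at hx
      rw [hx, map_zero]
    | succ k ih =>
      intro x hx
      rw [pow_succ]
      refine ih (D x) ?_
      rw [hDx]
      exact hAF k _ (Submodule.sub_mem _ (Submodule.add_mem _ (hPF _ x hx) (hPF _ x hx)) hx)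
  have hnil : IsNilpotent D := ⟨K, LinearMap.ext fun x => hDF K x (hK ▸ trivial)⟩
  have hT := (Module.End.isUnit_iff _).1 hnil.isUnit_one_add
  have hTx : ∀ x, (1 + D : Module.End R M) x = A (P x) + A (P x) - A x - P x + x := by
    intro x
    rw [LinearMap.add_apply, Module.End.one_apply, hDx]
    simp only [map_sub, map_add, hP]
    abel
  refine ⟨LinearEquiv.ofBijective _ hT, fun x => ?_, fun x => ?_⟩
  · rw [LinearEquiv.ofBijective_apply, hTx, hP]
    abel
  · rw [LinearEquiv.ofBijective_apply, hTx]
    simp only [map_sub, map_add, hA]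
    abel

section IdempotentImage

variable {X : Type u} {S : Type v} [CommRing S] {ι : Type w}

/-- Extension of scalars from `S` to `S[X]` on free modules. -/
def mapC : (ι →₀ S) →ₗ[S] (ι →₀ MvPolynomial X S) :=
  Finsupp.mapRange.linearMap (Algebra.linearMap S (MvPolynomial X S))

theorem mapC_apply (x : ι →₀ S) (i : ι) : (mapC x : ι →₀ MvPolynomial X S) i =
    MvPolynomial.C (x i) := rfl

/-- Reduction modulo the variables on free modules. -/
def evalZero : (ι →₀ MvPolynomial X S) →ₗ[S] (ι →₀ S) :=
  Finsupp.mapRange.linearMap (MvPolynomial.aeval (fun _ : X => (0 : S))).toLinearMap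

theorem evalZero_apply (x : ι →₀ MvPolynomial X S) (i : ι) :
    evalZero x i = MvPolynomial.constantCoeff (x i) := by
  change MvPolynomial.aeval (fun _ : X => (0 : S)) (x i) = _
  rw [MvPolynomial.aeval_zero']
  rfl

theorem evalZero_smul (f : MvPolynomial X S) (x : ι →₀ MvPolynomial X S) :
    evalZero (f • x) = MvPolynomial.constantCoeff f • evalZero x := by
  ext i
  simp [evalZero_apply]

/-- Linear independence is preserved under extension of scalars to a polynomial ring. -/
theorem linearIndependent_mapC {κ : Type*} [Finite κ] {v : κ → (ι →₀ S)}
    (hv : LinearIndependent S v) :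
    LinearIndependent (MvPolynomial X S) fun i => (mapC (v i) : ι →₀ MvPolynomial X S) := by
  have := Fintype.ofFinite κ
  rw [Fintype.linearIndependent_iff] at hv ⊢
  intro g hg i
  ext m
  -- For each monomial, its coefficients in a relation over the polynomial ring form a relation over
  -- `S`.
  refine hv (fun i => (g i).coeff m) ?_ i
  ext j
  have := congrArg (fun x : ι →₀ MvPolynomial X S => (x j).coeff m) hg
  simp only [Finsupp.coe_finsetSum, Finset.sum_apply, Finsupp.smul_apply, smul_eq_mul, mapC_apply,
    MvPolynomial.coeff_sum, mul_comm _ (MvPolynomial.C _), MvPolynomial.coeff_C_mul] at this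
  simpa [mul_comm] using this

/-- The part of an endomorphism of a free `S[X]`-module that does not involve the variables. -/
def constPart (A : (ι →₀ MvPolynomial X S) →ₗ[MvPolynomial X S] (ι →₀ MvPolynomial X S)) :
    (ι →₀ MvPolynomial X S) →ₗ[MvPolynomial X S] (ι →₀ MvPolynomial X S) :=
  Finsupp.linearCombination (MvPolynomial X S) fun i => mapC (evalZero (A (Finsupp.single i 1)))

variable (A : (ι →₀ MvPolynomial X S) →ₗ[MvPolynomial X S] (ι →₀ MvPolynomial X S))

theorem constPart_single (i : ι) :
    constPart A (Finsupp.single i 1) = mapC (evalZero (A (Finsupp.single i 1))) := by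
  rw [constPart, Finsupp.linearCombination_single, one_smul]

/-- `constPart A` is `A` modulo the variables, with scalars extended back. Reduction respects
composition, so idempotence is inherited. -/
theorem constPart_mapC_evalZero (x : ι →₀ MvPolynomial X S) :
    constPart A (mapC (evalZero x)) = mapC (evalZero (A x)) := by
  classical
  induction x using Finsupp.induction_linear with
  | zero => simp
  | add x y hx hy => simp only [map_add, hx, hy]
  | single i f =>
    have h1 : (mapC (evalZero (Finsupp.single i f)) : ι →₀ MvPolynomial X S) =
        MvPolynomial.constantCoeff f • Finsupp.single i (1 : MvPolynomial X S) := by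
      rw [← mul_one f, ← smul_eq_mul, ← Finsupp.smul_single, evalZero_smul, map_smul]
      congr 1
      · simp
      · ext j : 1
        rw [mapC_apply, evalZero_apply, Finsupp.single_apply]
        split_ifs <;> simp
    have h2 : A (Finsupp.single i f) = f • A (Finsupp.single i 1) := by
      rw [← map_smul, Finsupp.smul_single, smul_eq_mul, mul_one]
    rw [h1, h2, evalZero_smul]
    refine (((constPart A).restrictScalars S).map_smul _ _).trans ?_
    rw [map_smul, ← constPart_single]
    rfl

variable {A}

theorem constPart_idem (hA : ∀ x, A (A x) = A x) (x : ι →₀ MvPolynomial X S) :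
    constPart A (constPart A x) = constPart A x := by
  suffices h : constPart A ∘ₗ constPart A = constPart A from LinearMap.congr_fun h x
  refine Finsupp.lhom_ext' fun i => LinearMap.ext_ring ?_
  change constPart A (constPart A (Finsupp.single i 1)) = constPart A (Finsupp.single i 1)
  rw [constPart_single, constPart_mapC_evalZero, hA]

variable {deg : ι → (X →₀ ℕ)}

/-- The submodule spanned by the generators of total degree less than `k`. -/
def lowDegree (S : Type v) [CommRing S] (deg : ι → (X →₀ ℕ)) (k : ℕ) :
    Submodule (MvPolynomial X S) (ι →₀ MvPolynomial X S) :=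
  Finsupp.supported (MvPolynomial X S) (MvPolynomial X S) {i | (deg i).degree < k}

theorem mem_lowDegree {k : ℕ} {x : ι →₀ MvPolynomial X S} :
    x ∈ lowDegree S deg k ↔ ∀ i, x i ≠ 0 → (deg i).degree < k := by
  rw [lowDegree, Finsupp.mem_supported]
  exact ⟨fun h i hi => h (Finsupp.mem_support_iff.2 hi),
    fun h i hi => h i (Finsupp.mem_support_iff.1 hi)⟩

theorem map_mem_lowDegree {k l : ℕ}
    (hA : ∀ i, (deg i).degree < k → A (Finsupp.single i 1) ∈ lowDegree S deg l)
    {x : ι →₀ MvPolynomial X S} (hx : x ∈ lowDegree S deg k) : A x ∈ lowDegree S deg l := by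
  rw [lowDegree, Finsupp.supported_eq_span_single] at hx
  refine (Submodule.span_le.2 ?_ : _ ≤ (lowDegree S deg l).comap A) hx
  rintro _ ⟨i, hi, rfl⟩
  exact hA i hi

theorem lowDegree_zero : lowDegree S deg 0 = ⊥ := by
  rw [eq_bot_iff]
  intro x hx
  rw [Submodule.mem_bot]
  ext1 i
  by_contra h
  exact absurd (mem_lowDegree.1 hx i h) (Nat.not_lt_zero _)

theorem exists_lowDegree_eq_top [Finite ι] : ∃ K, lowDegree S deg K = ⊤ := by
  obtain ⟨K, hK⟩ := (Set.finite_range fun i => (deg i).degree).bddAbove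
  refine ⟨K + 1, eq_top_iff.2 fun x _ => mem_lowDegree.2 fun i _ => Nat.lt_succ_of_le (hK ⟨i, rfl⟩)⟩

/-- By homogeneity, the matrix entries of the constant part `P` join generators of equal degree,
while those of `A - P` lead to generators of smaller total degree. So `A` and `P` are conjugate, and
a basis of the image of `P` chosen over the field `S` can be moved to the image of `A`. -/
theorem exists_homogeneous_basis_range [Finite ι] (hS : IsField S)
    (hA : ∀ x, A (A x) = A x)
    (hdeg : ∀ e, ∀ x ∈ finsuppDeg deg e, A x ∈ finsuppDeg deg e) :
    ∃ (r : ℕ) (b : Module.Basis (Fin r) (MvPolynomial X S) (LinearMap.range A)),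
      ∀ i, ∃ e, (b i : ι →₀ MvPolynomial X S) ∈ finsuppDeg deg e := by
  obtain ⟨P, hP⟩ : ∃ P, P = constPart A := ⟨_, rfl⟩
  have hPP : ∀ x, P (P x) = P x := hP ▸ constPart_idem hA
  have hAe : ∀ i, A (Finsupp.single i 1) ∈ finsuppDeg deg (deg i) := fun i =>
    hdeg _ _ (single_one_mem_finsuppDeg i)
  have hPj : ∀ i j, P (Finsupp.single i 1) j =
      MvPolynomial.C (MvPolynomial.constantCoeff (A (Finsupp.single i 1) j)) := fun i j => by
    rw [hP, constPart_single, mapC_apply, evalZero_apply]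
  have hPdeg : ∀ i j, P (Finsupp.single i 1) j ≠ 0 → deg j = deg i := by
    intro i j h
    rw [hPj, Ne, MvPolynomial.C_eq_zero] at h
    have := add_deg_eq_of_mem_finsuppDeg (hAe i) j 0 h
    rwa [zero_add] at this
  classical
  -- A nonconstant monomial in the entry uses up a positive part of the degree of generator `i`.
  have hAPdeg : ∀ i j, (A (Finsupp.single i 1) - P (Finsupp.single i 1)) j ≠ 0 →
      (deg j).degree < (deg i).degree := by
    intro i j h
    rw [Finsupp.sub_apply, hPj] at h
    obtain ⟨m, hm⟩ := MvPolynomial.ne_zero_iff.1 h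
    rw [MvPolynomial.coeff_sub] at hm
    have hm0 : m ≠ 0 := by
      rintro rfl
      rw [MvPolynomial.coeff_zero_C, ← MvPolynomial.constantCoeff_eq, sub_self] at hm
      exact hm rfl
    rw [MvPolynomial.coeff_C, if_neg hm0.symm, sub_zero] at hm
    rw [← add_deg_eq_of_mem_finsuppDeg (hAe i) j m hm, map_add]
    have : m.degree ≠ 0 := by rwa [Ne, Finsupp.degree_eq_zero_iff]
    omega
  obtain ⟨K, hK⟩ := exists_lowDegree_eq_top (S := S) (deg := deg)
  obtain ⟨T, hTP, hAT⟩ := exists_equiv_intertwining A P hA hPP (lowDegree S deg) lowDegree_zero hK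
    (fun k x hx => map_mem_lowDegree (fun i hi => mem_lowDegree.2 fun j hj =>
      hPdeg i j hj ▸ hi) hx)
    (fun k x hx => map_mem_lowDegree (A := A - P) (fun i hi => mem_lowDegree.2 fun j hj =>
      (hAPdeg i j hj).trans_le (Nat.lt_succ_iff.1 hi)) hx)
  obtain ⟨B, hB1, hB2⟩ := exists_linearIndepOn_spanning hS
    (fun i => evalZero (A (Finsupp.single i (1 : MvPolynomial X S))))
  have hPi : ∀ i, P (Finsupp.single i 1) = mapC (evalZero (A (Finsupp.single i 1))) :=
    hP ▸ constPart_single A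
  let v : B → LinearMap.range A := fun i => ⟨A (P (Finsupp.single (i : ι) 1)), ⟨_, rfl⟩⟩
  have hv1 : LinearIndependent (MvPolynomial X S) v := by
    refine LinearIndependent.of_comp (LinearMap.range A).subtype ?_
    have : (LinearMap.range A).subtype ∘ v =
        T ∘ fun i : B => mapC (evalZero (A (Finsupp.single (i : ι) 1))) := by
      funext i
      rw [Function.comp_apply, Function.comp_apply, ← hPi, hTP]
      rfl
    rw [this]
    exact (linearIndependent_mapC hB1).map' T.toLinearMap T.ker
  -- Since `T` is surjective and `A T = A P`, the image of `A` is the image under `A` of the image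
  -- of `P`.
  have hv2 : ⊤ ≤ Submodule.span (MvPolynomial X S) (Set.range v) := by
    rintro ⟨_, y, rfl⟩ -
    obtain ⟨y, rfl⟩ := T.surjective y
    have hmap : (Submodule.span (MvPolynomial X S) (Set.range v)).map
        (LinearMap.range A).subtype = (Submodule.span (MvPolynomial X S)
          (Set.range fun i : B => mapC (evalZero (A (Finsupp.single (i : ι) 1))))).map A := by
      rw [Submodule.map_span, Submodule.map_span, ← Set.range_comp, ← Set.range_comp]
      congr 2
      funext i
      change A (P _) = A (mapC _)
      rw [hPi]
    suffices h : A (T y) ∈ (Submodule.span (MvPolynomial X S) (Set.range v)).map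
        (LinearMap.range A).subtype by
      obtain ⟨z, hz, hzy⟩ := h
      exact (Subtype.ext hzy : z = ⟨A (T y), _⟩) ▸ hz
    rw [hmap, hAT]
    refine Submodule.mem_map_of_mem ?_
    induction y using Finsupp.induction_linear with
    | zero => simp
    | add x y hx hy => rw [map_add]; exact Submodule.add_mem _ hx hy
    | single i f =>
      rw [← mul_one f, ← smul_eq_mul, ← Finsupp.smul_single, map_smul]
      refine Submodule.smul_mem _ _ ?_
      rw [hPi]
      have := Submodule.mem_map_of_mem (f := (mapC : (ι →₀ S) →ₗ[S] (ι →₀ MvPolynomial X S)))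
        (hB2 i)
      rw [Submodule.map_span, Set.image_image] at this
      rw [Set.image_eq_range] at this
      exact Submodule.span_le_restrictScalars S (MvPolynomial X S) _ this
  obtain ⟨r, ⟨f⟩⟩ := Finite.exists_equiv_fin B
  refine ⟨r, (Module.Basis.mk hv1 hv2).reindex f, fun i => ⟨deg (f.symm i), ?_⟩⟩
  rw [Module.Basis.reindex_apply, Module.Basis.mk_apply]
  -- The remaining element is a combination, with constant coefficients, of generators of one
  -- degree.
  refine hdeg _ _ ?_
  rw [← Finsupp.sum_single (P _)]
  refine Submodule.sum_mem _ fun j hj => ?_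
  have hj' := hPdeg _ j (Finsupp.mem_support_iff.1 hj)
  rw [← hj', hPj, ← mul_one (MvPolynomial.C _), ← MvPolynomial.smul_eq_C_mul,
    ← Finsupp.smul_single]
  exact Submodule.smul_mem _ _ (single_one_mem_finsuppDeg j)

/-- The image of a homogeneous idempotent endomorphism of a finite free graded module over a
polynomial ring over a field is a finite free graded module. -/
theorem isGradedFree_range [Finite ι] (hS : IsField S)
    (hA : ∀ x, A (A x) = A x)
    (hdeg : ∀ e, ∀ x ∈ finsuppDeg deg e, A x ∈ finsuppDeg deg e) :
    IsGradedFree (N := LinearMap.range A) (fun e => (finsuppDeg (S := S) deg e).comap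
      ((LinearMap.range A).subtype.restrictScalars S)) where
  isInternal := by
    classical
    exact isInternal_comap_range (finsuppDeg (S := S) deg) (finsuppDegProj deg)
      (fun e x hx h => by rwa [finsuppDegProj_of_mem hx] at h)
      (fun e e' hne x hx => finsuppDegProj_of_mem_of_ne hne hx) iSup_finsuppDeg A hdeg
  monomial_smul_mem e e' x hx := monomial_smul_mem_finsuppDeg e e' hx
  exists_basis := exists_homogeneous_basis_range hS hA hdeg

end IdempotentImage

/-! ### The flow of a chain homotopy and its powers. -/

section Flow

variable {S : Type*} [CommRing S] {N : ℕ → Type*} [∀ n, AddCommGroup (N n)]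
  [∀ n, Module S (N n)] {d : ∀ n, N (n + 1) →ₗ[S] N n} {D : ∀ n, N n →ₗ[S] N (n + 1)}

theorem flow_apply (n : ℕ) (x : N n) : flow d D n x = x - d n (D n x) - homotopyD d D n x := rfl

theorem homotopyD_d (hd : ∀ n x, d n (d (n + 1) x) = 0) (n : ℕ) (x : N (n + 1)) :
    homotopyD d D n (d n x) = 0 := by
  cases n with
  | zero => rfl
  | succ n =>
    change D n (d n (d (n + 1) x)) = 0
    rw [hd, map_zero]

theorem D_homotopyD (hD : ∀ n x, D (n + 1) (D n x) = 0) (n : ℕ) (x : N n) :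
    D n (homotopyD d D n x) = 0 := by
  cases n with
  | zero => exact map_zero _
  | succ n => exact hD n _

theorem d_flow (hd : ∀ n x, d n (d (n + 1) x) = 0) (n : ℕ) (x : N (n + 1)) :
    d n (flow d D (n + 1) x) = flow d D n (d n x) := by
  rw [flow_apply, flow_apply, homotopyD_d hd, map_sub, map_sub, hd]
  change d n x - 0 - d n (D n (d n x)) = _
  abel

theorem flow_D (hD : ∀ n x, D (n + 1) (D n x) = 0) (n : ℕ) (x : N n) :
    flow d D (n + 1) (D n x) = D n x - D n (d n (D n x)) := by
  rw [flow_apply, hD, map_zero, sub_zero]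
  rfl

/-- As `D² = 0`, both composites equal `D - D d D`. -/
theorem D_flow (hD : ∀ n x, D (n + 1) (D n x) = 0) (n : ℕ) (x : N n) :
    D n (flow d D n x) = flow d D (n + 1) (D n x) := by
  rw [flow_D hD, flow_apply, map_sub, map_sub, D_homotopyD hD, sub_zero]

theorem d_flow_pow (hd : ∀ n x, d n (d (n + 1) x) = 0) (j n : ℕ) (x : N (n + 1)) :
    d n ((flow d D (n + 1) ^ j) x) = (flow d D n ^ j) (d n x) := by
  induction j generalizing x with
  | zero => rfl
  | succ j ih => rw [pow_succ, pow_succ, Module.End.mul_apply, Module.End.mul_apply, ih, d_flow hd]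

theorem D_flow_pow (hD : ∀ n x, D (n + 1) (D n x) = 0) (j n : ℕ) (x : N n) :
    D n ((flow d D n ^ j) x) = (flow d D (n + 1) ^ j) (D n x) := by
  induction j generalizing x with
  | zero => rfl
  | succ j ih => rw [pow_succ, pow_succ, Module.End.mul_apply, Module.End.mul_apply, ih, D_flow hD]

/-- A power of the flow that kills the image of `D` kills the images of `D d` and, by commuting with
`d`, of `d D`. Only the identity term of the flow survives. -/
theorem flow_pow_flow (hd : ∀ n x, d n (d (n + 1) x) = 0) {j : ℕ}
    (hj : ∀ n x, (flow d D (n + 1) ^ j) (D n x) = 0) (n : ℕ) (x : N n) :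
    (flow d D n ^ j) (flow d D n x) = (flow d D n ^ j) x := by
  have h : (flow d D n ^ j) (homotopyD d D n x) = 0 := by
    cases n with
    | zero => exact map_zero _
    | succ n => exact hj n _
  rw [flow_apply, map_sub, map_sub, h, ← d_flow_pow hd, hj, map_zero, sub_zero, sub_zero]

/-- A power of the flow that annihilates the homotopy is idempotent. -/
theorem flow_pow_idem (hd : ∀ n x, d n (d (n + 1) x) = 0) {j : ℕ}
    (hj : ∀ n x, (flow d D (n + 1) ^ j) (D n x) = 0) (n : ℕ) (x : N n) :
    (flow d D n ^ j) ((flow d D n ^ j) x) = (flow d D n ^ j) x := by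
  have h : ∀ i, (flow d D n ^ j) ((flow d D n ^ i) x) = (flow d D n ^ j) x := by
    intro i
    induction i with
    | zero => rfl
    | succ i ih => rw [pow_succ', Module.End.mul_apply, flow_pow_flow hd hj, ih]
  exact h j

end Flow

/-! ### Turning a homotopy with `d D d = d` into a splitting. -/

section Hat

variable {S : Type*} [CommRing S] {N : ℕ → Type*} [∀ n, AddCommGroup (N n)]
  [∀ n, Module S (N n)] {d : ∀ n, N (n + 1) →ₗ[S] N n} {D : ∀ n, N n →ₗ[S] N (n + 1)}

theorem hat_apply (n : ℕ) (x : N n) :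
    hat d D n x = D n (d n (D n (x - homotopyD d D n x))) := rfl

/-- Because `d² = 0`, the factor `id - D d` is the identity on boundaries, and there `hat` agrees
with `D`. -/
theorem d_hat_d (hd : ∀ n x, d n (d (n + 1) x) = 0) (hD : ∀ n x, d n (D n (d n x)) = d n x)
    (n : ℕ) (x : N (n + 1)) : d n (hat d D n (d n x)) = d n x := by
  rw [hat_apply, homotopyD_d hd, sub_zero, hD, hD]

/-- Values of `hat` have the form `D d D z`. They are fixed by `D d`, hence killed by the factor `id
- D d`. -/
theorem hat_hat (hD : ∀ n x, d n (D n (d n x)) = d n x) (n : ℕ) (x : N n) :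
    hat d D (n + 1) (hat d D n x) = 0 := by
  rw [hat_apply, hat_apply]
  change D (n + 1) (d (n + 1) (D (n + 1) (_ - D n (d n _)))) = 0
  rw [hD, sub_self, map_zero, map_zero, map_zero]

theorem hat_d_hat (hd : ∀ n x, d n (d (n + 1) x) = 0) (hD : ∀ n x, d n (D n (d n x)) = d n x)
    (n : ℕ) (x : N n) : hat d D n (d n (hat d D n x)) = hat d D n x := by
  rw [hat_apply, homotopyD_d hd, sub_zero, hD, hat_apply, hD]

end Hat

/-! ### Stratification of the lcm-resolution by largest vertices. -/

section Assembly

variable {X : Type u} {I : AddSemigroupIdeal (X →₀ ℕ)} {S : Type v} [CommRing S]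

/-- The inclusion of the chains of a stratum in the lcm-resolution. -/
def stratumIncl (I : AddSemigroupIdeal (X →₀ ℕ)) (S : Type v) [CommRing S] (a : lcmPoset I)
    (n : ℕ) : (StratumFace a n →₀ MvPolynomial X S) →ₗ[MvPolynomial X S] LcmMod I S n :=
  Finsupp.lmapDomain _ _ Subtype.val

theorem stratumIncl_single (a : lcmPoset I) (n : ℕ) (c : StratumFace a n) (f : MvPolynomial X S) :
    stratumIncl I S a n (Finsupp.single c f) = Finsupp.single c.1 f :=
  Finsupp.mapDomain_single

/-- The map of the modules of the lcm-resolution with given restrictions to the strata. -/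
def assemble {n m : ℕ} (L : ∀ a : lcmPoset I, (StratumFace a n →₀ MvPolynomial X S)
    →ₗ[MvPolynomial X S] (StratumFace a m →₀ MvPolynomial X S)) :
    LcmMod I S n →ₗ[MvPolynomial X S] LcmMod I S m :=
  Finsupp.linearCombination (MvPolynomial X S) fun c =>
    stratumIncl I S c.top m (L c.top (Finsupp.single ⟨c, rfl⟩ 1))

theorem assemble_stratumIncl {n m : ℕ} (L : ∀ a : lcmPoset I, (StratumFace a n →₀ MvPolynomial X S)
    →ₗ[MvPolynomial X S] (StratumFace a m →₀ MvPolynomial X S)) (a : lcmPoset I)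
    (x : StratumFace a n →₀ MvPolynomial X S) :
    assemble L (stratumIncl I S a n x) = stratumIncl I S a m (L a x) := by
  suffices h : assemble L ∘ₗ stratumIncl I S a n = stratumIncl I S a m ∘ₗ L a from
    LinearMap.congr_fun h x
  refine Finsupp.lhom_ext' fun c => LinearMap.ext_ring ?_
  obtain ⟨c, rfl⟩ := c
  change assemble L (stratumIncl I S _ n (Finsupp.single _ 1)) =
    stratumIncl I S _ m (L _ (Finsupp.single _ 1))
  rw [stratumIncl_single, assemble, Finsupp.linearCombination_single, one_smul]

theorem lcmMod_ext_strata {P : Type*} [AddCommGroup P] [Module (MvPolynomial X S) P] {n : ℕ}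
    {f g : LcmMod I S n →ₗ[MvPolynomial X S] P}
    (h : ∀ a x, f (stratumIncl I S a n x) = g (stratumIncl I S a n x)) (x : LcmMod I S n) :
    f x = g x := by
  suffices h : f = g from LinearMap.congr_fun h x
  refine Finsupp.lhom_ext' fun c => LinearMap.ext_ring ?_
  have := h c.top (Finsupp.single ⟨c, rfl⟩ 1)
  rwa [stratumIncl_single] at this

/-- The part of the differential of the lcm-resolution that preserves the largest vertex. -/
def strataD (I : AddSemigroupIdeal (X →₀ ℕ)) (S : Type v) [CommRing S] (n : ℕ) :
    LcmMod I S (n + 1) →ₗ[MvPolynomial X S] LcmMod I S n :=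
  assemble fun a => stratumD (MvPolynomial X S) a n

theorem strataD_single (n : ℕ) (c : Face I (n + 1)) :
    strataD I S n (Finsupp.single c 1) = ∑ i : Fin (n + 1), ((-1 : ℤ) ^ (i : ℕ)) •
      Finsupp.single (c.del i.castSucc) (1 : MvPolynomial X S) := by
  classical
  rw [strataD, assemble, Finsupp.linearCombination_single, one_smul, stratumD_single, map_sum,
    Fin.sum_univ_castSucc, dif_neg c.del_last_top_lt.ne, smul_zero, map_zero, add_zero]
  refine Finset.sum_congr rfl fun i _ => ?_
  rw [dif_pos (c.del_castSucc_top i), map_zsmul, stratumIncl_single]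
  rfl

theorem lcmD_single_eq_strataD_add (n : ℕ) (c : Face I (n + 1)) :
    lcmD I S n (Finsupp.single c 1) = strataD I S n (Finsupp.single c 1) +
      ((-1 : ℤ) ^ (n + 1)) • Finsupp.single (c.del (Fin.last _)) (MvPolynomial.monomial
        ((c.top : X →₀ ℕ) - ((c.del (Fin.last _)).top : X →₀ ℕ)) (1 : S)) := by
  rw [lcmD_single, strataD_single, Fin.sum_univ_castSucc]
  congr 1
  refine Finset.sum_congr rfl fun i _ => ?_
  rw [c.del_castSucc_top, tsub_self]
  rfl

/-- The part of the differential of the lcm-resolution that lowers the largest vertex. -/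
def lowerD (I : AddSemigroupIdeal (X →₀ ℕ)) (S : Type v) [CommRing S] (n : ℕ) :
    LcmMod I S (n + 1) →ₗ[MvPolynomial X S] LcmMod I S n :=
  lcmD I S n - strataD I S n

theorem lowerD_single (n : ℕ) (c : Face I (n + 1)) : lowerD I S n (Finsupp.single c 1) =
      ((-1 : ℤ) ^ (n + 1)) • Finsupp.single (c.del (Fin.last _)) (MvPolynomial.monomial
        ((c.top : X →₀ ℕ) - ((c.del (Fin.last _)).top : X →₀ ℕ)) (1 : S)) := by
  rw [lowerD, LinearMap.sub_apply, lcmD_single_eq_strataD_add, add_sub_cancel_left]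

theorem lcmD_eq (n : ℕ) (x : LcmMod I S (n + 1)) :
    lcmD I S n x = strataD I S n x + lowerD I S n x := by
  rw [lowerD, LinearMap.sub_apply, add_sub_cancel]

/-- The ideal generated by the variables. -/
abbrev varIdeal (X : Type u) (S : Type v) [CommRing S] : Ideal (MvPolynomial X S) :=
  Ideal.span (Set.range (MvPolynomial.X : X → MvPolynomial X S))

theorem monomial_mem_varIdeal {e : X →₀ ℕ} (he : e ≠ 0) :
    MvPolynomial.monomial e (1 : S) ∈ varIdeal X S := by
  obtain ⟨i, hi⟩ := Finsupp.ne_iff.1 he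
  have h : MvPolynomial.monomial e (1 : S) =
      MvPolynomial.monomial (e - Finsupp.single i 1) 1 * MvPolynomial.X i := by
    rw [MvPolynomial.X, MvPolynomial.monomial_mul, one_mul, tsub_add_cancel_of_le]
    exact Finsupp.single_le_iff.2 (Nat.one_le_iff_ne_zero.2 hi)
  rw [h]
  exact Ideal.mul_mem_left _ _ (Ideal.subset_span ⟨i, rfl⟩)

theorem linearMap_mem_smul_top {R M P : Type*} [CommRing R] [AddCommMonoid M] [Module R M]
    [AddCommMonoid P] [Module R P] (J : Ideal R) (f : M →ₗ[R] P) {x : M}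
    (hx : x ∈ J • (⊤ : Submodule R M)) : f x ∈ J • (⊤ : Submodule R P) := by
  have := Submodule.mem_map_of_mem (f := f) hx
  rw [Submodule.map_smul''] at this
  exact Submodule.smul_mono le_rfl le_top this

/-- Omitting the last vertex strictly lowers the degree of the face, so the compensating monomial is
not 1. -/
theorem lowerD_mem (n : ℕ) (x : LcmMod I S (n + 1)) :
    lowerD I S n x ∈ varIdeal X S • (⊤ : Submodule (MvPolynomial X S) (LcmMod I S n)) := by
  induction x using Finsupp.induction_linear with
  | zero => rw [map_zero]; exact Submodule.zero_mem _
  | add x y hx hy => rw [map_add]; exact Submodule.add_mem _ hx hy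
  | single c f =>
    rw [← mul_one f, ← smul_eq_mul, ← Finsupp.smul_single, map_smul, lowerD_single]
    refine Submodule.smul_mem _ _ (Submodule.smul_of_tower_mem _ _ ?_)
    rw [← mul_one (MvPolynomial.monomial _ _), ← smul_eq_mul, ← Finsupp.smul_single]
    refine Submodule.smul_mem_smul (monomial_mem_varIdeal ?_) trivial
    intro h
    exact c.del_last_top_lt.not_ge ((tsub_eq_zero_iff_le (α := X →₀ ℕ)).1 h)

/-- The chains on faces with a chain of length `j` above their largest vertex. -/
def heightFil (I : AddSemigroupIdeal (X →₀ ℕ)) (S : Type v) [CommRing S] (n j : ℕ) :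
    Submodule (MvPolynomial X S) (LcmMod I S n) :=
  Finsupp.supported _ _ {c | ∃ p : LTSeries (lcmPoset I), p.head = c.top ∧ p.length = j}

theorem map_mem_heightFil {n m j l : ℕ} (f : LcmMod I S n →ₗ[MvPolynomial X S] LcmMod I S m)
    (hf : ∀ c : Face I n, (∃ p : LTSeries (lcmPoset I), p.head = c.top ∧ p.length = j) →
      f (Finsupp.single c 1) ∈ heightFil I S m l) {x : LcmMod I S n}
    (hx : x ∈ heightFil I S n j) : f x ∈ heightFil I S m l := by
  rw [heightFil, Finsupp.supported_eq_span_single] at hx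
  refine (Submodule.span_le.2 ?_ : _ ≤ (heightFil I S m l).comap f) hx
  rintro _ ⟨c, hc, rfl⟩
  exact hf c hc

theorem heightFil_zero (n : ℕ) (x : LcmMod I S n) : x ∈ heightFil I S n 0 := by
  rw [heightFil, Finsupp.mem_supported]
  intro c _
  exact ⟨RelSeries.singleton _ c.top, rfl, rfl⟩

/-- No chain in `L'` is longer than the dimension, so the filtration ends at zero. This determines
the exponent in `proj`. -/
theorem eq_zero_of_mem_heightFil [Finite X] (n : ℕ) {j : ℕ} (hj : lcmDim I < j)
    {x : LcmMod I S n} (hx : x ∈ heightFil I S n j) : x = 0 := by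
  rw [heightFil, Finsupp.mem_supported] at hx
  ext1 c
  by_contra h
  obtain ⟨p, -, hp⟩ := hx (Finsupp.mem_support_iff.2 h)
  exact (hp ▸ LTSeries.length_le_lcmDim p).not_gt hj

theorem assemble_mem_heightFil {n m : ℕ} (L : ∀ a : lcmPoset I,
    (StratumFace a n →₀ MvPolynomial X S) →ₗ[MvPolynomial X S]
      (StratumFace a m →₀ MvPolynomial X S)) {j : ℕ} {x : LcmMod I S n}
    (hx : x ∈ heightFil I S n j) : assemble L x ∈ heightFil I S m j := by
  classical
  refine map_mem_heightFil _ (fun c hc => ?_) hx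
  rw [assemble, Finsupp.linearCombination_single, one_smul, heightFil, Finsupp.mem_supported]
  intro c' hc'
  obtain ⟨b, -, rfl⟩ := Finset.mem_image.1 (Finsupp.mapDomain_support hc')
  obtain ⟨p, hp, hj⟩ := hc
  exact ⟨p, hp.trans b.2.symm, hj⟩

theorem lowerD_mem_heightFil {n j : ℕ} {x : LcmMod I S (n + 1)}
    (hx : x ∈ heightFil I S (n + 1) j) : lowerD I S n x ∈ heightFil I S n (j + 1) := by
  refine map_mem_heightFil _ (fun c hc => ?_) hx
  rw [lowerD_single]
  refine Submodule.smul_of_tower_mem _ _ (Finsupp.single_mem_supported _ _ ?_)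
  obtain ⟨p, hp, rfl⟩ := hc
  -- The new largest vertex lies strictly below the old one and extends the chain downwards by one
  -- step.
  exact ⟨p.cons (c.del (Fin.last _)).top (hp ▸ c.del_last_top_lt), RelSeries.head_cons _ _ _,
    RelSeries.cons_length _ _ _⟩

end Assembly

/-! ### Maps of based modules defined over the coefficient ring. -/

section ConstantMaps

variable {R S : Type*} [CommRing R] [CommRing S] [Algebra S R]

/-- The elements of a based free `R`-module with coefficients in the subring `S`. -/
def constants (S : Type*) (R : Type*) [CommRing R] [CommRing S] [Algebra S R] (B : Type*) :
    Submodule S (B →₀ R) :=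
  Submodule.span S (Set.range fun b => Finsupp.single b (1 : R))

theorem single_mem_constants {B : Type*} (b : B) : Finsupp.single b (1 : R) ∈ constants S R B :=
  Submodule.subset_span ⟨b, rfl⟩

/-- A map of based free modules is defined over `S`. -/
def IsConstant (S : Type*) {R : Type*} [CommRing R] [CommRing S] [Algebra S R] {B B' : Type*}
    (f : (B →₀ R) →ₗ[R] (B' →₀ R)) : Prop :=
  ∀ b, f (Finsupp.single b 1) ∈ constants S R B'

variable {B B' B'' : Type*}

theorem IsConstant.map_mem {f : (B →₀ R) →ₗ[R] (B' →₀ R)} (hf : IsConstant S f) {x : B →₀ R}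
    (hx : x ∈ constants S R B) : f x ∈ constants S R B' := by
  refine (Submodule.span_le.2 ?_ : constants S R B ≤
    (constants S R B').comap (f.restrictScalars S)) hx
  rintro _ ⟨b, rfl⟩
  exact hf b

theorem IsConstant.comp {f : (B →₀ R) →ₗ[R] (B' →₀ R)} {g : (B' →₀ R) →ₗ[R] (B'' →₀ R)}
    (hg : IsConstant S g) (hf : IsConstant S f) : IsConstant S (g ∘ₗ f) :=
  fun b => hg.map_mem (hf b)

theorem IsConstant.sub {f g : (B →₀ R) →ₗ[R] (B' →₀ R)} (hf : IsConstant S f)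
    (hg : IsConstant S g) : IsConstant S (f - g) :=
  fun b => Submodule.sub_mem _ (hf b) (hg b)

theorem IsConstant.sum {ι : Type*} (s : Finset ι) {f : ι → ((B →₀ R) →ₗ[R] (B' →₀ R))}
    (hf : ∀ i, IsConstant S (f i)) : IsConstant S (∑ i ∈ s, f i) := fun b => by
  rw [LinearMap.sum_apply]
  exact Submodule.sum_mem _ fun i _ => hf i b

theorem IsConstant.algebraMap_smul {f : (B →₀ R) →ₗ[R] (B' →₀ R)} (hf : IsConstant S f) (s : S) :
    IsConstant S (algebraMap S R s • f) := fun b => by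
  rw [LinearMap.smul_apply, _root_.algebraMap_smul]
  exact Submodule.smul_mem _ _ (hf b)

theorem isConstant_id : IsConstant S (LinearMap.id : (B →₀ R) →ₗ[R] (B →₀ R)) :=
  fun b => single_mem_constants b

theorem isConstant_zero : IsConstant S (0 : (B →₀ R) →ₗ[R] (B' →₀ R)) :=
  fun _ => Submodule.zero_mem _

theorem isConstant_hat {B : ℕ → Type*} {d : ∀ n, (B (n + 1) →₀ R) →ₗ[R] (B n →₀ R)}
    {D : ∀ n, (B n →₀ R) →ₗ[R] (B (n + 1) →₀ R)} (hd : ∀ n, IsConstant S (d n))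
    (hD : ∀ n, IsConstant S (D n)) (n : ℕ) : IsConstant S (hat d D n) := by
  refine (hD n).comp ((hd n).comp ((hD n).comp (isConstant_id.sub ?_)))
  cases n with
  | zero => exact isConstant_zero
  | succ n => exact (hD n).comp (hd n)

end ConstantMaps

/-! ### The flow of a splitting of the strata. -/

section Splitting

variable {X : Type u} {I : AddSemigroupIdeal (X →₀ ℕ)} {S : Type v} [CommRing S]

theorem isConstant_stratumD (a : lcmPoset I) (n : ℕ) :
    IsConstant S (stratumD (MvPolynomial X S) a n) := fun c => by
  classical
  rw [stratumD_single]
  refine Submodule.sum_mem _ fun i _ => Submodule.smul_of_tower_mem _ _ ?_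
  split_ifs with h
  · exact single_mem_constants _
  · exact Submodule.zero_mem _

/-- Homotopies on the strata that are splittings and are defined over the coefficient ring. -/
structure IsStrataSplitting (W : ∀ (a : lcmPoset I) (n : ℕ),
      (StratumFace a n →₀ MvPolynomial X S) →ₗ[MvPolynomial X S]
        (StratumFace a (n + 1) →₀ MvPolynomial X S)) : Prop where
  comp_self : ∀ a n x, W a (n + 1) (W a n x) = 0
  W_d_W : ∀ a n x, W a n (stratumD (MvPolynomial X S) a n (W a n x)) = W a n x
  d_W_d : ∀ a n x, stratumD (MvPolynomial X S) a n (W a n (stratumD (MvPolynomial X S) a n x)) =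
    stratumD (MvPolynomial X S) a n x
  isConstant : ∀ a n, IsConstant S (W a n)

theorem isStrataSplitting_hat {V : ∀ (a : lcmPoset I) (n : ℕ),
      (StratumFace a n →₀ MvPolynomial X S) →ₗ[MvPolynomial X S]
        (StratumFace a (n + 1) →₀ MvPolynomial X S)}
    (hV : ∀ a n x, stratumD (MvPolynomial X S) a n (V a n (stratumD (MvPolynomial X S) a n x)) =
      stratumD (MvPolynomial X S) a n x) (hc : ∀ a n, IsConstant S (V a n)) :
    IsStrataSplitting fun a => hat (stratumD (MvPolynomial X S) a) (V a) where
  comp_self a := hat_hat (hV a)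
  W_d_W a := hat_d_hat (stratumD_comp _ a) (hV a)
  d_W_d a n x := d_hat_d (N := fun n => StratumFace a n →₀ MvPolynomial X S) (stratumD_comp _ a) (hV a) n x
  isConstant a := isConstant_hat (isConstant_stratumD a) (hc a)

variable {W : ∀ (a : lcmPoset I) (n : ℕ),
      (StratumFace a n →₀ MvPolynomial X S) →ₗ[MvPolynomial X S]
        (StratumFace a (n + 1) →₀ MvPolynomial X S)}

theorem inducedField_stratumIncl (a : lcmPoset I) (n : ℕ)
    (x : StratumFace a n →₀ MvPolynomial X S) :
    inducedField W n (stratumIncl I S a n x) = stratumIncl I S a (n + 1) (W a n x) :=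
  assemble_stratumIncl (fun a => W a n) a x

theorem strataD_stratumIncl (a : lcmPoset I) (n : ℕ)
    (x : StratumFace a (n + 1) →₀ MvPolynomial X S) :
    strataD I S n (stratumIncl I S a (n + 1) x) =
      stratumIncl I S a n (stratumD (MvPolynomial X S) a n x) :=
  assemble_stratumIncl _ a x

variable (hW : IsStrataSplitting W)
include hW

theorem IsStrataSplitting.field_field (n : ℕ) (x : LcmMod I S n) :
    inducedField W (n + 1) (inducedField W n x) = 0 := by
  refine lcmMod_ext_strata (f := inducedField W (n + 1) ∘ₗ inducedField W n) (g := 0)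
    (fun a x => ?_) x
  change inducedField W (n + 1) (inducedField W n _) = 0
  rw [inducedField_stratumIncl, inducedField_stratumIncl, hW.comp_self, map_zero]

theorem IsStrataSplitting.field_strataD_field (n : ℕ) (x : LcmMod I S n) :
    inducedField W n (strataD I S n (inducedField W n x)) = inducedField W n x := by
  refine lcmMod_ext_strata (f := inducedField W n ∘ₗ strataD I S n ∘ₗ inducedField W n)
    (fun a x => ?_) x
  change inducedField W n (strataD I S n (inducedField W n _)) = _
  rw [inducedField_stratumIncl, strataD_stratumIncl, inducedField_stratumIncl, hW.W_d_W]

theorem IsStrataSplitting.strataD_field_strataD (n : ℕ) (x : LcmMod I S (n + 1)) :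
    strataD I S n (inducedField W n (strataD I S n x)) = strataD I S n x := by
  refine lcmMod_ext_strata (f := strataD I S n ∘ₗ inducedField W n ∘ₗ strataD I S n)
    (fun a x => ?_) x
  change strataD I S n (inducedField W n (strataD I S n _)) = _
  rw [strataD_stratumIncl, inducedField_stratumIncl, strataD_stratumIncl, hW.d_W_d]

/-- Let W be the induced field, d and l the two parts of the differential, and Φ the flow. As WdW =
W, the value ΦWy is W(-lWy). Here W preserves the largest vertex and l lowers it, so the filtration
index increases by one. -/
theorem IsStrataSplitting.exists_flow_pow_field (j n : ℕ) (x : LcmMod I S n) :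
    ∃ y ∈ heightFil I S n j, (flow (lcmD I S) (inducedField W) (n + 1) ^ j) (inducedField W n x) =
      inducedField W n y := by
  induction j with
  | zero => exact ⟨x, heightFil_zero n x, rfl⟩
  | succ j ih =>
    obtain ⟨y, hy, h⟩ := ih
    refine ⟨-lowerD I S n (inducedField W n y), Submodule.neg_mem _
      (lowerD_mem_heightFil (assemble_mem_heightFil (fun a => W a n) hy)), ?_⟩
    rw [pow_succ', Module.End.mul_apply, h, flow_D hW.field_field, lcmD_eq, map_add,
      hW.field_strataD_field, map_neg]
    abel

theorem IsStrataSplitting.flow_pow_field [Finite X] (n : ℕ) (x : LcmMod I S n) :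
    (flow (lcmD I S) (inducedField W) (n + 1) ^ (1 + lcmDim I)) (inducedField W n x) = 0 := by
  obtain ⟨y, hy, h⟩ := hW.exists_flow_pow_field (1 + lcmDim I) n x
  rw [h, eq_zero_of_mem_heightFil n (by omega) hy, map_zero]

/-- The field keeps the largest vertex, which carries the degree, and its coefficients involve no
variables. This is the purpose of `isConstant`. -/
theorem IsStrataSplitting.field_mem_lcmDeg (n : ℕ) (e : X →₀ ℕ) (x : LcmMod I S n)
    (hx : x ∈ lcmDeg I S n e) : inducedField W n x ∈ lcmDeg I S (n + 1) e := by
  refine map_mem_of_single (deg := fun c : Face I n => (c.top : X →₀ ℕ)) (lcmDeg I S (n + 1))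
    (fun e e' x hx => monomial_smul_mem_finsuppDeg e e' hx) (inducedField W n) (fun c => ?_) e x hx
  have h : constants S (MvPolynomial X S) (StratumFace c.top (n + 1)) ≤
      (lcmDeg I S (n + 1) c.top).comap ((stratumIncl I S c.top (n + 1)).restrictScalars S) := by
    refine Submodule.span_le.2 ?_
    rintro _ ⟨b, rfl⟩
    change stratumIncl I S c.top (n + 1) (Finsupp.single b 1) ∈ lcmDeg I S (n + 1) c.top
    rw [stratumIncl_single]
    exact Submodule.subset_span ⟨b.1, 0, by rw [b.2, zero_add], rfl⟩
  have := h (hW.isConstant c.top n ⟨c, rfl⟩)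
  rwa [inducedField, Finsupp.linearCombination_single, one_smul]

omit hW in
theorem lcmD_mem_lcmDeg (n : ℕ) (e : X →₀ ℕ) (x : LcmMod I S (n + 1))
    (hx : x ∈ lcmDeg I S (n + 1) e) : lcmD I S n x ∈ lcmDeg I S n e := by
  refine map_mem_of_single (deg := fun c : Face I (n + 1) => (c.top : X →₀ ℕ)) (lcmDeg I S n)
    (fun e e' x hx => monomial_smul_mem_finsuppDeg e e' hx) (lcmD I S n) (fun c => ?_) e x hx
  rw [lcmD_single]
  refine Submodule.sum_mem _ fun i _ => Submodule.smul_of_tower_mem _ _ ?_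
  exact Submodule.subset_span ⟨c.del i, _, tsub_add_cancel_of_le (c.del_top_le i), rfl⟩

theorem IsStrataSplitting.flow_mem_lcmDeg (n : ℕ) (e : X →₀ ℕ) (x : LcmMod I S n)
    (hx : x ∈ lcmDeg I S n e) : flow (lcmD I S) (inducedField W) n x ∈ lcmDeg I S n e := by
  rw [flow_apply]
  refine Submodule.sub_mem _ (Submodule.sub_mem _ hx (lcmD_mem_lcmDeg n e _
    (hW.field_mem_lcmDeg n e x hx))) ?_
  cases n with
  | zero => exact Submodule.zero_mem _
  | succ n => exact hW.field_mem_lcmDeg n e _ (lcmD_mem_lcmDeg n e x hx)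

theorem IsStrataSplitting.flow_pow_mem_lcmDeg (j n : ℕ) (e : X →₀ ℕ) (x : LcmMod I S n)
    (hx : x ∈ lcmDeg I S n e) :
    (flow (lcmD I S) (inducedField W) n ^ j) x ∈ lcmDeg I S n e := by
  induction j with
  | zero => exact hx
  | succ j ih =>
    rw [pow_succ', Module.End.mul_apply]
    exact hW.flow_mem_lcmDeg n e _ ih

omit hW in
-- In degree 0 the flow is `id - d D`, and the augmentation kills boundaries.
theorem lcmAug_flow_pow (j : ℕ) (x : LcmMod I S 0) :
    lcmAug I S ((flow (lcmD I S) (inducedField W) 0 ^ j) x) = lcmAug I S x := by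
  induction j generalizing x with
  | zero => rfl
  | succ j ih =>
    rw [pow_succ, Module.End.mul_apply, ih, flow_apply, map_sub, map_sub, lcmAug_lcmD, sub_zero]
    change lcmAug I S x - lcmAug I S 0 = _
    rw [map_zero, sub_zero]

theorem IsStrataSplitting.lcmD_mem_of_flow_pow_eq [Finite X] (n : ℕ) (x : LcmMod I S (n + 1))
    (hx : (flow (lcmD I S) (inducedField W) (n + 1) ^ (1 + lcmDim I)) x = x) :
    lcmD I S n x ∈ varIdeal X S • (⊤ : Submodule (MvPolynomial X S) (LcmMod I S n)) := by
  -- `x` equals its stable iterate, which can be moved past the differential and past the field;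
  -- there it annihilates the image of the field.
  have h1 : inducedField W n (lcmD I S n x) = 0 := by
    rw [← hx, d_flow_pow (lcmD_comp S), D_flow_pow hW.field_field, hW.flow_pow_field]
  -- This combines dWd = d with the vanishing of W(dx + lx). So the part dx, which has unit
  -- coefficients, is rewritten in terms of lx.
  have h2 : strataD I S n x = -strataD I S n (inducedField W n (lowerD I S n x)) := by
    rw [lcmD_eq, map_add] at h1
    rw [← hW.strataD_field_strataD, eq_neg_of_add_eq_zero_left h1, map_neg]
  rw [lcmD_eq, h2]
  exact Submodule.add_mem _ (Submodule.neg_mem _ (linearMap_mem_smul_top _ _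
    (linearMap_mem_smul_top _ _ (lowerD_mem n x)))) (lowerD_mem n x)

end Splitting

/-! ### The lcm-resolution is a graded free resolution. -/

section LcmResolution

variable {X : Type u} [Finite X] (I : AddSemigroupIdeal (X →₀ ℕ)) (S : Type v) [CommRing S]

omit [Finite X] in
theorem lcmAug_mem (e : X →₀ ℕ) (x : LcmMod I S 0) (hx : x ∈ lcmDeg I S 0 e) :
    lcmAug I S x ∈ polyDeg X S e := by
  refine (Submodule.span_le.2 ?_ : lcmDeg I S 0 e ≤
    (polyDeg X S e).comap ((lcmAug I S).restrictScalars S)) hx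
  rintro _ ⟨c, e', rfl, rfl⟩
  change lcmAug I S _ ∈ polyDeg X S _
  rw [lcmAug_single, MvPolynomial.monomial_mul, one_mul]
  exact Submodule.subset_span rfl

theorem isGradedFreeResolution_lcm : IsGradedFreeResolution (lcmDeg I S) (lcmD I S) (lcmAug I S)
    (monomialIdeal I S) where
  isGradedFree n := isGradedFree_finsuppDeg (deg := fun c : Face I n => (c.top : X →₀ ℕ))
  d_mem := lcmD_mem_lcmDeg
  aug_mem := lcmAug_mem I S
  exact_d := exact_lcmD I S
  exact_aug := exact_lcmAug I S
  range_aug := range_lcmAug I S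

end LcmResolution

/-! ### The action of `G_I` on splittings and variables. -/

section ChainAction

variable {X : Type u} {I : AddSemigroupIdeal (X →₀ ℕ)}

/-- The action of an automorphism on chains of the strata. -/
abbrev stratumChainEquiv (K : Type w) [CommRing K] (γ : symGroup I) (a : lcmPoset I) (n : ℕ) :
    (StratumFace a n →₀ K) ≃ₗ[K] (StratumFace (latticeIso γ a) n →₀ K) :=
  Finsupp.domLCongr (R := K) (M := K) (stratumEquiv γ a n)

theorem stratumChainEquiv_mul (K : Type w) [CommRing K] (γ δ : symGroup I) (a : lcmPoset I) (n : ℕ)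
    (x : StratumFace a n →₀ K) : stratumChainEquiv K (γ * δ) a n x =
      stratumChainEquiv K γ (latticeIso δ a) n (stratumChainEquiv K δ a n x) :=
  Finsupp.ext fun _ => rfl

theorem stratumChainEquiv_one (K : Type w) [CommRing K] (a : lcmPoset I) (n : ℕ)
    (x : StratumFace a n →₀ K) : stratumChainEquiv K (1 : symGroup I) a n x = x :=
  Finsupp.ext fun _ => rfl

variable (k : Type v) [Field k]

theorem homotopyMap_apply (γ : symGroup I) (a : lcmPoset I) (σ : StratumHomotopy k a) (n : ℕ)
    (x : StratumFace a n →₀ (⊥ : Subfield k)) :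
    homotopyMap k γ a σ n (stratumChainEquiv _ γ a n x) =
      stratumChainEquiv _ γ a (n + 1) (σ n x) :=
  transport_apply (stratumEquiv γ a) σ n x

/-- The two sides live over `latticeIso (γ * δ) a` and `latticeIso γ (latticeIso δ a)`. These agree
definitionally, so no cast is needed. -/
theorem homotopyMap_mul (γ δ : symGroup I) (a : lcmPoset I) (σ : StratumHomotopy k a) :
    homotopyMap k (γ * δ) a σ = homotopyMap k γ (latticeIso δ a) (homotopyMap k δ a σ) := by
  funext n
  refine LinearMap.ext fun x => ?_
  obtain ⟨x, rfl⟩ := (stratumChainEquiv _ (γ * δ) a n).surjective x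
  have h := homotopyMap_apply k γ (latticeIso δ a) (homotopyMap k δ a σ) n
    (stratumChainEquiv _ δ a n x)
  rw [homotopyMap_apply k δ a] at h
  refine (homotopyMap_apply k (γ * δ) a σ n x).trans ?_
  refine (stratumChainEquiv_mul _ γ δ a (n + 1) (σ n x)).trans ?_
  refine h.symm.trans ?_
  exact congrArg _ (stratumChainEquiv_mul _ γ δ a n x).symm

theorem homotopyMap_one (a : lcmPoset I) (σ : StratumHomotopy k a) :
    homotopyMap k (1 : symGroup I) a σ = σ := by
  funext n
  refine LinearMap.ext fun x => ?_
  have h := homotopyMap_apply k (1 : symGroup I) a σ n x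
  refine (congrArg _ (stratumChainEquiv_one _ a n x).symm).trans (h.trans ?_)
  exact stratumChainEquiv_one _ a (n + 1) (σ n x)

theorem yMap_mul (γ δ : symGroup I) (y : YIndex I k) :
    yMap k (γ * δ) y = yMap k γ (yMap k δ y) := by
  obtain ⟨⟨a, ha⟩, σ, hσ⟩ := y
  exact Sigma.ext rfl (heq_of_eq (Subtype.ext (homotopyMap_mul k γ δ a σ)))

theorem yMap_one (y : YIndex I k) : yMap k 1 y = y := by
  obtain ⟨⟨a, ha⟩, σ, hσ⟩ := y
  exact Sigma.ext rfl (heq_of_eq (Subtype.ext (homotopyMap_one k a σ)))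

end ChainAction

/-! ### Elimination of one variable from each normalization relation. -/

section Elimination

variable (k : Type v) [Field k] {A : Type*} {T : A → Type*} [∀ a, Finite (T a)]

/-- The ideal generated by the elements `1 - ∑ y_t`, the sums being over the blocks of variables. -/
abbrev normIdeal (k : Type*) [Field k] {A : Type*} (T : A → Type*) :
    Ideal (MvPolynomial (Σ a, T a) k) :=
  Ideal.span (Set.range fun a : A =>
    (1 : MvPolynomial (Σ a, T a) k) - ∑ᶠ t : T a, MvPolynomial.X ⟨a, t⟩)

variable (t₀ : ∀ a, T a)

theorem finsum_eq_add_finsum_ne {α M : Type*} [Finite α] [AddCommMonoid M] (f : α → M) (a : α) :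
    ∑ᶠ i, f i = f a + ∑ᶠ i : {i // i ≠ a}, f i := by
  classical
  have := Fintype.ofFinite α
  rw [finsum_eq_sum_of_fintype, finsum_eq_sum_of_fintype, Fintype.sum_eq_add_sum_subtype_ne]

open Classical in
/-- Elimination of one variable in each block. -/
def eliminate : MvPolynomial (Σ a, T a) k →ₐ[k] MvPolynomial (Σ a, {t : T a // t ≠ t₀ a}) k :=
  MvPolynomial.aeval fun y => if h : y.2 = t₀ y.1 then
    1 - ∑ᶠ s : {t : T y.1 // t ≠ t₀ y.1}, MvPolynomial.X ⟨y.1, s⟩ else MvPolynomial.X ⟨y.1, y.2, h⟩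

omit [∀ a, Finite (T a)] in
theorem eliminate_X_self (a : A) : eliminate k t₀ (MvPolynomial.X ⟨a, t₀ a⟩) =
    1 - ∑ᶠ s : {t : T a // t ≠ t₀ a}, MvPolynomial.X ⟨a, s⟩ := by
  rw [eliminate, MvPolynomial.aeval_X, dif_pos rfl]

omit [∀ a, Finite (T a)] in
theorem eliminate_X_ne (a : A) (t : {t : T a // t ≠ t₀ a}) :
    eliminate k t₀ (MvPolynomial.X ⟨a, t⟩) = MvPolynomial.X ⟨a, t⟩ := by
  rw [eliminate, MvPolynomial.aeval_X, dif_neg t.2]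

theorem eliminate_eq_zero (x : MvPolynomial (Σ a, T a) k) (hx : x ∈ normIdeal k T) :
    eliminate k t₀ x = 0 := by
  refine (Ideal.span_le.2 ?_ : normIdeal k T ≤ RingHom.ker (eliminate k t₀)) hx
  rintro _ ⟨a, rfl⟩
  change eliminate k t₀ _ = 0
  rw [map_sub, map_one, finsum_eq_add_finsum_ne _ (t₀ a), map_add, eliminate_X_self,
    map_finsum _ (Set.toFinite _)]
  simp only [eliminate_X_ne]
  abel

/-- The quotient by the ideal generated by the elements `1 - ∑ y_t` is a polynomial ring in the
remaining variables. -/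
def quotientNormEquiv : (MvPolynomial (Σ a, T a) k ⧸ normIdeal k T) ≃ₐ[k]
    MvPolynomial (Σ a, {t : T a // t ≠ t₀ a}) k :=
  AlgEquiv.ofAlgHom (Ideal.Quotient.liftₐ (normIdeal k T) (eliminate k t₀) (eliminate_eq_zero k t₀))
    ((Ideal.Quotient.mkₐ k (normIdeal k T)).comp
      (MvPolynomial.rename fun y => (⟨y.1, y.2.1⟩ : Σ a, T a)))
    (by
      refine MvPolynomial.algHom_ext fun y => ?_
      rw [AlgHom.comp_apply, AlgHom.comp_apply, MvPolynomial.rename_X]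
      exact eliminate_X_ne k t₀ y.1 y.2)
    (by
      refine Ideal.Quotient.algHom_ext _ (MvPolynomial.algHom_ext fun y => ?_)
      obtain ⟨a, t⟩ := y
      change (Ideal.Quotient.mkₐ k (normIdeal k T)) (MvPolynomial.rename
        (fun y : (Σ a, {t : T a // t ≠ t₀ a}) => (⟨y.1, y.2.1⟩ : Σ a, T a))
        (eliminate k t₀ (MvPolynomial.X ⟨a, t⟩))) =
        Ideal.Quotient.mk (normIdeal k T) (MvPolynomial.X ⟨a, t⟩)
      -- The eliminated variable returns as 1 minus the sum of the others in its block, which is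
      -- congruent to it by the defining relation.
      by_cases h : t = t₀ a
      · subst h
        rw [eliminate_X_self, map_sub, map_one, map_finsum _ (Set.toFinite _)]
        simp only [MvPolynomial.rename_X]
        refine (Ideal.Quotient.eq.2 ?_)
        have : (1 : MvPolynomial (Σ a, T a) k) - ∑ᶠ t : T a, MvPolynomial.X ⟨a, t⟩ ∈
            normIdeal k T := Ideal.subset_span ⟨a, rfl⟩
        rw [finsum_eq_add_finsum_ne _ (t₀ a)] at this
        convert this using 1
        abel
      · rw [eliminate_X_ne k t₀ a ⟨t, h⟩, MvPolynomial.rename_X]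
        rfl)

end Elimination

/-! ### The extension field `k'`. -/

section Counting

variable {X : Type u} [Finite X] {I : AddSemigroupIdeal (X →₀ ℕ)} (k : Type v) [Field k]

theorem finite_MSpl (a : lcmPoset I) : (MSpl k a).Finite :=
  finite_isMatroidal (isEmpty_stratumFace a) _

instance instFiniteMSpl (a : lcmPoset I) : Finite (MSpl k a) := finite_MSpl k a

omit [Finite X] in
theorem nonempty_MSpl (a : lcmPoset I) : (MSpl k a).Nonempty :=
  exists_isMatroidal (stratumD_comp _ a)

theorem msplCount_pos (a : lcmPoset I) : 0 < msplCount k a :=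
  (Set.ncard_pos (finite_MSpl k a)).2 (nonempty_MSpl k a)

variable (I)

instance instFiniteCrit : Finite (Crit I k) := Subtype.finite

/-- The remaining variables after elimination of one variable for each critical element. -/
abbrev FreeIndex : Type (max u v) :=
  Σ a : Crit I k, {σ : MSpl k a.1 // σ ≠ ⟨_, (nonempty_MSpl k a.1).some_mem⟩}

/-- The coordinate ring is a polynomial ring. -/
def coordRingEquiv : CoordRing I k ≃ₐ[k] MvPolynomial (FreeIndex I k) k :=
  quotientNormEquiv k (A := Crit I k) (T := fun a => MSpl k a.1) _

instance instIsDomainCoordRing : IsDomain (CoordRing I k) :=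
  (coordRingEquiv I k).toMulEquiv.isDomain _

theorem isField_extField : IsField (ExtField I k) :=
  Field.toIsField (FractionRing (CoordRing I k))

theorem essFiniteType_extField : Algebra.EssFiniteType k (ExtField I k) :=
  inferInstanceAs (Algebra.EssFiniteType k (FractionRing (CoordRing I k)))

theorem card_freeIndex :
    Nat.card (FreeIndex I k) = ∑ᶠ a : Crit I k, (msplCount k a.1 - 1) := by
  classical
  have := Fintype.ofFinite (Crit I k)
  rw [Nat.card_sigma, finsum_eq_sum_of_fintype]
  refine Finset.sum_congr rfl fun a _ => ?_
  have := Fintype.ofFinite (MSpl k a.1)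
  rw [Nat.card_eq_fintype_card, Fintype.card_subtype_compl, Fintype.card_subtype_eq,
    ← Nat.card_eq_fintype_card]
  rfl

theorem nonempty_extField_equiv : Nonempty (ExtField I k ≃ₐ[k]
    FractionRing (MvPolynomial (Fin (∑ᶠ a : Crit I k, (msplCount k a.1 - 1))) k)) := by
  have e : FreeIndex I k ≃ Fin (∑ᶠ a : Crit I k, (msplCount k a.1 - 1)) :=
    Finite.equivFinOfCardEq (card_freeIndex I k)
  exact ⟨(IsFractionRing.algEquivOfAlgEquiv
    ((coordRingEquiv I k).trans (MvPolynomial.renameEquiv k e)) :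
      FractionRing (CoordRing I k) ≃ₐ[k] _)⟩

theorem bijective_algebraMap_of_charZero [CharZero k] :
    Function.Bijective (algebraMap k (ExtField I k)) := by
  -- Zero does not divide the positive number `m(a)`, so nothing is critical and there are no
  -- variables.
  have hc : IsEmpty (Crit I k) := ⟨fun a => by
    have := a.2
    rw [IsCritical, ringChar.eq_zero, zero_dvd_iff] at this
    exact (msplCount_pos k a.1).ne' this⟩
  have e := IsFractionRing.algEquivOfAlgEquiv (K := FractionRing (CoordRing I k))
    (L := FractionRing k) ((coordRingEquiv I k).trans (MvPolynomial.isEmptyAlgEquiv k _))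
  have h1 : Function.Bijective (algebraMap k (FractionRing k)) :=
    (Field.toIsField k).localization_map_bijective (M := nonZeroDivisors k)
      (by simp)
  have h2 : (algebraMap k (FractionRing (CoordRing I k)) : k → _) =
      e.symm ∘ algebraMap k (FractionRing k) := by
    funext x
    exact (e.symm.commutes x).symm
  change Function.Bijective (algebraMap k (FractionRing (CoordRing I k)))
  rw [h2]
  exact e.symm.bijective.comp h1

end Counting

/-! ### Extension of scalars from the prime field. -/

section ExtendScalars

variable {K S : Type*} [CommRing K] [CommRing S] (f : K →+* S)

theorem extendScalars_single {B B' : Type*} (D : (B →₀ K) →ₗ[K] (B' →₀ K)) (b : B) :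
    extendScalars f D (Finsupp.single b 1) =
      (D (Finsupp.single b 1)).mapRange f (map_zero f) := by
  rw [extendScalars, Finsupp.linearCombination_single, one_smul]

theorem extendScalars_mapRange {B B' : Type*} (D : (B →₀ K) →ₗ[K] (B' →₀ K)) (x : B →₀ K) :
    extendScalars f D (x.mapRange f (map_zero f)) = (D x).mapRange f (map_zero f) := by
  induction x using Finsupp.induction_linear with
  | zero => simp
  | add x y hx hy =>
    simp only [Finsupp.mapRange_add (map_add f), map_add, hx, hy]
  | single b r =>
    have h : D (Finsupp.single b r) = r • D (Finsupp.single b 1) := by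
      rw [← map_smul, Finsupp.smul_single, smul_eq_mul, mul_one]
    rw [h, Finsupp.mapRange_single, extendScalars, Finsupp.linearCombination_single]
    ext b'
    simp

variable {X : Type u} {I : AddSemigroupIdeal (X →₀ ℕ)}

theorem stratumD_eq_extendScalars (a : lcmPoset I) (n : ℕ) :
    stratumD S a n = extendScalars f (stratumD K a n) := by
  classical
  refine Finsupp.lhom_ext' fun c => LinearMap.ext_ring ?_
  change stratumD S a n (Finsupp.single c 1) = extendScalars f _ (Finsupp.single c 1)
  rw [extendScalars_single, stratumD_single, stratumD_single]
  change _ = Finsupp.mapRange.addMonoidHom f.toAddMonoidHom _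
  rw [map_sum]
  refine Finset.sum_congr rfl fun i _ => ?_
  rw [map_zsmul]
  congr 1
  split_ifs with h
  · simp
  · rw [map_zero]

/-- The differential itself is extended from `K`, so the identity need only be checked on basis
elements, where it comes from `K`. -/
theorem stratumD_extendScalars_stratumD (a : lcmPoset I) (n : ℕ)
    (D : (StratumFace a n →₀ K) →ₗ[K] (StratumFace a (n + 1) →₀ K))
    (hD : ∀ x, stratumD K a n (D (stratumD K a n x)) = stratumD K a n x)
    (x : StratumFace a (n + 1) →₀ S) :
    stratumD S a n (extendScalars f D (stratumD S a n x)) = stratumD S a n x := by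
  suffices h : stratumD S a n ∘ₗ extendScalars f D ∘ₗ stratumD S a n = stratumD S a n from
    LinearMap.congr_fun h x
  refine Finsupp.lhom_ext' fun c => LinearMap.ext_ring ?_
  change stratumD S a n (extendScalars f D (stratumD S a n (Finsupp.single c 1))) =
    stratumD S a n (Finsupp.single c 1)
  rw [stratumD_eq_extendScalars f, extendScalars_single, extendScalars_mapRange,
    extendScalars_mapRange, hD]

end ExtendScalars

/-! ### The averaged homotopy. -/

section Average

variable {X : Type u} [Finite X] {I : AddSemigroupIdeal (X →₀ ℕ)} (k : Type v) [Field k]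

open Classical in
/-- The weights with which the matroidal splittings of a stratum are averaged. -/
def weight (a : lcmPoset I) (σ : MSpl k a) : ExtField I k :=
  if h : IsCritical k a then yElt k ⟨⟨a, h⟩, σ⟩ else
    algebraMap k (ExtField I k) ((msplCount k a : k)⁻¹)

theorem finsum_yElt (a : Crit I k) : ∑ᶠ σ : MSpl k a.1, yElt k ⟨a, σ⟩ = 1 := by
  have h : (1 : MvPolynomial (YIndex I k) k) - ∑ᶠ σ : MSpl k a.1, MvPolynomial.X ⟨a, σ⟩ ∈
      normIdeal k (A := Crit I k) (fun a => MSpl k a.1) := Ideal.subset_span ⟨a, rfl⟩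
  have h1 := Ideal.Quotient.eq_zero_iff_mem.2 h
  rw [map_sub, map_one, map_finsum _ (Set.toFinite _), sub_eq_zero] at h1
  have h2 := congrArg (algebraMap (CoordRing I k) (FractionRing (CoordRing I k))) h1
  rw [map_one, map_finsum _ (Set.toFinite _)] at h2
  exact h2.symm

/-- At critical elements this is the defining relation of `k'`; elsewhere `m(a)` is nonzero in `k`.
-/
theorem finsum_weight (a : lcmPoset I) : ∑ᶠ σ : MSpl k a, weight k a σ = 1 := by
  by_cases h : IsCritical k a
  · simp only [weight, dif_pos h]
    exact finsum_yElt k ⟨a, h⟩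
  · have := Fintype.ofFinite (MSpl k a)
    have hm : (msplCount k a : k) ≠ 0 := fun h0 => h ((ringChar.spec k _).1 h0)
    simp only [weight, dif_neg h]
    rw [finsum_eq_sum_of_fintype, Finset.sum_const, Finset.card_univ, ← Nat.card_eq_fintype_card,
      show Nat.card (MSpl k a) = msplCount k a from rfl, ← map_nsmul, nsmul_eq_mul,
      mul_inv_cancel₀ hm, map_one]

theorem averageHomotopy_eq (a : lcmPoset I) (n : ℕ) :
    averageHomotopy k a n = ∑ᶠ σ : MSpl k a, (MvPolynomial.C (weight k a σ) : PolyExt I k) •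
      extendScalars (primeToPoly I k) (σ.1 n) := by
  by_cases h : IsCritical k a
  · simp only [averageHomotopy, weight, dif_pos h]
  · simp only [averageHomotopy, weight, dif_neg h]
    rw [smul_finsum' _ (Set.toFinite _)]
    rfl

/-- Each splitting satisfies `d σ d = d`, and the weights add up to 1. -/
theorem stratumD_averageHomotopy_stratumD (a : lcmPoset I) (n : ℕ)
    (x : StratumFace a (n + 1) →₀ PolyExt I k) :
    stratumD (PolyExt I k) a n (averageHomotopy k a n (stratumD (PolyExt I k) a n x)) =
      stratumD (PolyExt I k) a n x := by
  have := Fintype.ofFinite (MSpl k a)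
  have hw := congrArg (MvPolynomial.C (σ := X)) (finsum_weight k a)
  rw [finsum_eq_sum_of_fintype, map_sum, map_one] at hw
  rw [averageHomotopy_eq, finsum_eq_sum_of_fintype, LinearMap.sum_apply, map_sum]
  conv_rhs => rw [← one_smul (PolyExt I k) (stratumD (PolyExt I k) a n x), ← hw, Finset.sum_smul]
  refine Finset.sum_congr rfl fun σ _ => ?_
  rw [LinearMap.smul_apply, map_smul]
  congr 1
  exact stratumD_extendScalars_stratumD _ a n _ (IsMatroidal.d_D_d σ.2 n) x

omit [Finite X] in
theorem isConstant_extendScalars_primeToPoly {B B' : Type*}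
    (D : (B →₀ (⊥ : Subfield k)) →ₗ[(⊥ : Subfield k)] (B' →₀ (⊥ : Subfield k))) :
    IsConstant (ExtField I k) (extendScalars (primeToPoly I k) D) := by
  intro b
  rw [extendScalars_single]
  induction D (Finsupp.single b 1) using Finsupp.induction_linear with
  | zero => rw [Finsupp.mapRange_zero]; exact Submodule.zero_mem _
  | add x y hx hy =>
    rw [Finsupp.mapRange_add (map_add _)]
    exact Submodule.add_mem _ hx hy
  | single c r =>
    rw [Finsupp.mapRange_single]
    have : (Finsupp.single c (primeToPoly I k r) : B' →₀ PolyExt I k) =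
        algebraMap k (ExtField I k) r • Finsupp.single c (1 : PolyExt I k) := by
      rw [Finsupp.smul_single, MvPolynomial.smul_eq_C_mul, mul_one]
      rfl
    rw [this]
    exact Submodule.smul_mem _ _ (single_mem_constants c)

theorem isConstant_averageHomotopy (a : lcmPoset I) (n : ℕ) :
    IsConstant (ExtField I k) (averageHomotopy k a n) := by
  have := Fintype.ofFinite (MSpl k a)
  rw [averageHomotopy_eq, finsum_eq_sum_of_fintype]
  exact IsConstant.sum _ fun σ =>
    (isConstant_extendScalars_primeToPoly k (σ.1 n)).algebraMap_smul (weight k a σ)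

theorem isStrataSplitting_average : IsStrataSplitting (I := I) (S := ExtField I k)
    fun a => hat (stratumD (PolyExt I k) a) (averageHomotopy k a) :=
  isStrataSplitting_hat (stratumD_averageHomotopy_stratumD k) (isConstant_averageHomotopy k)

end Average

/-! ### The image of the projection is a minimal resolution. -/

section MinimalResolution

variable {X : Type u} [Finite X] (I : AddSemigroupIdeal (X →₀ ℕ)) (k : Type v) [Field k]

omit [Finite X] in
theorem lcmD_proj (n : ℕ) (x : LcmMod I (ExtField I k) (n + 1)) :
    lcmD I (ExtField I k) n (proj I k (n + 1) x) = proj I k n (lcmD I (ExtField I k) n x) :=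
  d_flow_pow (N := LcmMod I (ExtField I k)) (lcmD_comp _) _ n x

theorem proj_mem_lcmDeg (n : ℕ) (e : X →₀ ℕ) (x : LcmMod I (ExtField I k) n)
    (hx : x ∈ lcmDeg I (ExtField I k) n e) : proj I k n x ∈ lcmDeg I (ExtField I k) n e :=
  (isStrataSplitting_average k).flow_pow_mem_lcmDeg _ n e x hx

theorem proj_proj (n : ℕ) (x : LcmMod I (ExtField I k) n) :
    proj I k n (proj I k n x) = proj I k n x :=
  flow_pow_idem (N := LcmMod I (ExtField I k)) (lcmD_comp _) (isStrataSplitting_average k).flow_pow_field n x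

theorem proj_of_mem {n : ℕ} {x : LcmMod I (ExtField I k) n} (hx : x ∈ minRes I k n) :
    proj I k n x = x := by
  obtain ⟨y, rfl⟩ := hx
  exact proj_proj I k n y

omit [Finite X] in
theorem lcmD_mem_minRes (n : ℕ) (x : LcmMod I (ExtField I k) (n + 1))
    (hx : x ∈ minRes I k (n + 1)) : lcmD I (ExtField I k) n x ∈ minRes I k n := by
  obtain ⟨y, rfl⟩ := hx
  exact ⟨_, (lcmD_proj I k n y).symm⟩

omit [Finite X] in
theorem lcmAug_proj (x : LcmMod I (ExtField I k) 0) :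
    lcmAug I (ExtField I k) (proj I k 0 x) = lcmAug I (ExtField I k) x :=
  lcmAug_flow_pow (W := fun a => hat (stratumD (PolyExt I k) a) (averageHomotopy k a)) _ x

theorem isGradedFree_minRes (n : ℕ) : IsGradedFree (N := minRes I k n) (minResDeg I k n) :=
  isGradedFree_range (A := proj I k n) (deg := fun c : Face I n => (c.top : X →₀ ℕ))
    (isField_extField I k) (proj_proj I k n) (proj_mem_lcmDeg I k n)

theorem exact_minResD (n : ℕ) : Function.Exact (minResD (lcmD_mem_minRes I k) (n + 1))
    (minResD (lcmD_mem_minRes I k) n) := by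
  intro x
  constructor
  · intro hx
    obtain ⟨y, hy⟩ := (exact_lcmD I (ExtField I k) n x).1 (congrArg Subtype.val hx)
    -- Projecting a preimage again gives a preimage: `proj` commutes with the differential and fixes
    -- `x`.
    refine ⟨⟨proj I k (n + 2) y, y, rfl⟩, Subtype.ext ?_⟩
    change lcmD I (ExtField I k) (n + 1) (proj I k (n + 2) y) = x
    rw [lcmD_proj, hy, proj_of_mem I k x.2]
  · rintro ⟨y, rfl⟩
    exact Subtype.ext (lcmD_comp _ n y.1)

theorem exact_minResAug :
    Function.Exact (minResD (lcmD_mem_minRes I k) 0) (minResAug I k) := by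
  intro x
  constructor
  · intro hx
    obtain ⟨y, hy⟩ := (exact_lcmAug I (ExtField I k) x).1 hx
    refine ⟨⟨proj I k 1 y, y, rfl⟩, Subtype.ext ?_⟩
    change lcmD I (ExtField I k) 0 (proj I k 1 y) = x
    rw [lcmD_proj, hy, proj_of_mem I k x.2]
  · rintro ⟨y, rfl⟩
    exact lcmAug_lcmD I _ y.1

theorem range_minResAug : LinearMap.range (minResAug I k) = monomialIdeal I (ExtField I k) := by
  rw [← range_lcmAug]
  apply le_antisymm
  · rintro _ ⟨x, rfl⟩
    exact ⟨x, rfl⟩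
  · rintro _ ⟨x, rfl⟩
    exact ⟨⟨proj I k 0 x, x, rfl⟩, lcmAug_proj I k x⟩

theorem isGradedFreeResolution_minRes : IsGradedFreeResolution (N := fun n => minRes I k n)
    (minResDeg I k) (minResD (lcmD_mem_minRes I k)) (minResAug I k)
    (monomialIdeal I (ExtField I k)) where
  isGradedFree := isGradedFree_minRes I k
  d_mem n e x hx := lcmD_mem_lcmDeg n e x.1 hx
  aug_mem e x hx := lcmAug_mem I _ e x.1 hx
  exact_d := exact_minResD I k
  exact_aug := exact_minResAug I k
  range_aug := range_minResAug I k

theorem isMinimalComplex_minRes : IsMinimalComplex (N := fun n => minRes I k n)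
    (minResD (lcmD_mem_minRes I k)) := by
  rintro n _ ⟨x, rfl⟩
  have h := (isStrataSplitting_average k).lcmD_mem_of_flow_pow_eq n x (proj_of_mem I k x.2)
  -- So far the boundary lies in 𝔪 times the whole lcm-resolution. Applying the projection, which
  -- fixes it, places it in 𝔪 times the summand.
  have h' := linearMap_mem_smul_top _ (proj I k n).rangeRestrict h
  have : (proj I k n).rangeRestrict (lcmD I (ExtField I k) n x) =
      minResD (lcmD_mem_minRes I k) n x :=
    Subtype.ext (proj_of_mem I k (lcmD_mem_minRes I k n x x.2))
  rw [this] at h'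
  exact h'

end MinimalResolution

/-! ### The action of `G_I` on `k'`. -/

section CoefficientAction

variable {X : Type u} [Finite X] {I : AddSemigroupIdeal (X →₀ ℕ)} (k : Type v) [Field k]

/-- The action of `G_I` on matroidal splittings. -/
def msplEquiv (γ : symGroup I) (a : lcmPoset I) : MSpl k a ≃ MSpl k (latticeIso γ a) :=
  (homotopyMap k γ a).subtypeEquiv fun _ => (homotopyMap_mem_iff k γ a).symm

/-- The action of `G_I` on the variables, as a permutation. -/
def yEquiv (γ : symGroup I) : YIndex I k ≃ YIndex I k where
  toFun := yMap k γ
  invFun := yMap k γ⁻¹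
  left_inv y := by rw [← yMap_mul, inv_mul_cancel, yMap_one]
  right_inv y := by rw [← yMap_mul, mul_inv_cancel, yMap_one]

/-- The action of `G_I` on critical elements. -/
def critMap (γ : symGroup I) (a : Crit I k) : Crit I k :=
  ⟨latticeIso γ a.1, a.2.latticeIso k γ⟩

/-- Since γ maps the splittings at `a` bijectively to those at `γ a`, it permutes the normalization
relations. This makes the action descend to the quotient. -/
theorem rename_norm (γ : symGroup I) (a : Crit I k) :
    MvPolynomial.rename (yEquiv k γ)
      ((1 : MvPolynomial (YIndex I k) k) - ∑ᶠ σ : MSpl k a.1, MvPolynomial.X ⟨a, σ⟩) =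
    1 - ∑ᶠ σ : MSpl k (critMap k γ a).1, MvPolynomial.X ⟨critMap k γ a, σ⟩ := by
  rw [map_sub, map_one, map_finsum _ (Set.toFinite _)]
  simp only [MvPolynomial.rename_X]
  congr 1
  exact finsum_comp_equiv (msplEquiv k γ a.1)
    (f := fun σ => (MvPolynomial.X ⟨critMap k γ a, σ⟩ : MvPolynomial (YIndex I k) k))

omit [Finite X] in
theorem critMap_surjective (γ : symGroup I) : Function.Surjective (critMap k γ) := fun a =>
  ⟨critMap k γ⁻¹ a, Subtype.ext (show latticeIso γ (latticeIso γ⁻¹ a.1) = a.1 from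
    (latticeIso γ).apply_symm_apply a.1)⟩

theorem map_normIdeal (γ : symGroup I) :
    normIdeal k (A := Crit I k) (fun a => MSpl k a.1) =
      (normIdeal k (A := Crit I k) (fun a => MSpl k a.1)).map
        (MvPolynomial.renameEquiv k (yEquiv k γ) : MvPolynomial (YIndex I k) k →+* _) := by
  rw [normIdeal, Ideal.map_span, ← Set.range_comp]
  congr 1
  rw [← (critMap_surjective k γ).range_comp]
  congr 1
  funext a
  exact (rename_norm k γ a).symm

/-- The action of an element of `G_I` on the coordinate ring. -/
def coordAut (γ : symGroup I) : CoordRing I k ≃ₐ[k] CoordRing I k :=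
  Ideal.quotientEquivAlg _ _ (MvPolynomial.renameEquiv k (yEquiv k γ)) (map_normIdeal k γ)

/-- The action of an element of `G_I` on the extension field. -/
def extAut (γ : symGroup I) : ExtField I k ≃ₐ[k] ExtField I k :=
  (IsFractionRing.algEquivOfAlgEquiv (coordAut k γ) :
    FractionRing (CoordRing I k) ≃ₐ[k] FractionRing (CoordRing I k))

theorem extAut_yElt (γ : symGroup I) (y : YIndex I k) :
    extAut k γ (yElt k y) = yElt k (yMap k γ y) := by
  refine (IsFractionRing.algEquivOfAlgEquiv_algebraMap (K := FractionRing (CoordRing I k))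
    (L := FractionRing (CoordRing I k)) (coordAut k γ) _).trans ?_
  refine congrArg (algebraMap (CoordRing I k) (FractionRing (CoordRing I k))) ?_
  change Ideal.Quotient.mk _ (MvPolynomial.rename (yEquiv k γ) (MvPolynomial.X y)) = _
  rw [MvPolynomial.rename_X]
  rfl

omit [Finite X] in
-- The elements `y_σ` generate `k'` as a field over `k`. Hence the group laws need to be checked
-- only on them.
theorem extField_algEquiv_ext {f g : ExtField I k ≃ₐ[k] ExtField I k}
    (h : ∀ y, f (yElt k y) = g (yElt k y)) : f = g := by
  let F : FractionRing (CoordRing I k) →+* FractionRing (CoordRing I k) :=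
    (f : ExtField I k →+* ExtField I k)
  let G : FractionRing (CoordRing I k) →+* FractionRing (CoordRing I k) :=
    (g : ExtField I k →+* ExtField I k)
  have h1 : F = G := by
    refine IsLocalization.ringHom_ext (nonZeroDivisors (CoordRing I k)) ?_
    refine Ideal.Quotient.ringHom_ext (MvPolynomial.ringHom_ext (fun r => ?_) h)
    exact (f.commutes r).trans (g.commutes r).symm
  exact AlgEquiv.ext fun x => RingHom.congr_fun h1 x

/-- The action of `G_I` on the extension field. -/
def extAction : symGroup I →* (ExtField I k ≃ₐ[k] ExtField I k) where
  toFun := extAut k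
  map_one' := extField_algEquiv_ext k fun y => by
    rw [extAut_yElt, yMap_one]
    rfl
  map_mul' γ δ := extField_algEquiv_ext k fun y => by
    rw [extAut_yElt, yMap_mul, AlgEquiv.mul_apply, extAut_yElt, extAut_yElt]

theorem extAction_yElt (γ : symGroup I) (y : YIndex I k) :
    extAction k γ (yElt k y) = yElt k (yMap k γ y) :=
  extAut_yElt k γ y

omit [Finite X] in
theorem isCritical_latticeIso_iff (γ : symGroup I) (a : lcmPoset I) :
    IsCritical k (latticeIso γ a) ↔ IsCritical k a := by
  rw [IsCritical, msplCount_latticeIso, IsCritical]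

theorem extAction_weight (γ : symGroup I) (a : lcmPoset I) (σ : MSpl k a) :
    extAction k γ (weight k a σ) = weight k (latticeIso γ a) (msplEquiv k γ a σ) := by
  by_cases h : IsCritical k a
  · rw [weight, weight, dif_pos h, dif_pos ((isCritical_latticeIso_iff k γ a).2 h),
      extAction_yElt]
    rfl
  · rw [weight, weight, dif_neg h, dif_neg (mt (isCritical_latticeIso_iff k γ a).1 h),
      msplCount_latticeIso, AlgEquiv.commutes]

end CoefficientAction

/-! ### Semilinear maps of based free modules. -/

section SemilinearMaps

variable {R : Type*} [CommRing R]

/-- The semilinear map of based free modules given by a map of scalars and one of bases. -/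
def semiMap (φ : R →+* R) {B B' : Type*} (e : B ≃ B') : (B →₀ R) →ₛₗ[φ] (B' →₀ R) where
  toFun x := (x.mapRange φ (map_zero φ)).mapDomain e
  map_add' x y := by rw [Finsupp.mapRange_add (map_add φ), Finsupp.mapDomain_add]
  map_smul' r x := by
    rw [Finsupp.mapRange_smul' (v := x) r (φ r) (fun s => by simp), Finsupp.mapDomain_smul]

theorem semiMap_apply (φ : R →+* R) {B B' : Type*} (e : B ≃ B') (x : B →₀ R) :
    semiMap φ e x = (x.mapRange φ (map_zero φ)).mapDomain e := rfl

theorem semiMap_single (φ : R →+* R) {B B' : Type*} (e : B ≃ B') (b : B) (r : R) :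
    semiMap φ e (Finsupp.single b r) = Finsupp.single (e b) (φ r) := by
  rw [semiMap_apply, Finsupp.mapRange_single, Finsupp.mapDomain_single]

theorem semiMap_comm (φ : R →+* R) {B B' C C' : Type*} (e : B ≃ B') (e' : C ≃ C')
    (L : (B →₀ R) →ₗ[R] (C →₀ R)) (L' : (B' →₀ R) →ₗ[R] (C' →₀ R))
    (h : ∀ b, L' (Finsupp.single (e b) 1) = semiMap φ e' (L (Finsupp.single b 1)))
    (x : B →₀ R) : L' (semiMap φ e x) = semiMap φ e' (L x) := by
  induction x using Finsupp.induction_linear with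
  | zero => simp only [map_zero]
  | add x y hx hy => simp only [map_add, hx, hy]
  | single b r =>
    have h1 : L (Finsupp.single b r) = r • L (Finsupp.single b 1) := by
      rw [← map_smul, Finsupp.smul_single, smul_eq_mul, mul_one]
    have h2 : L' (Finsupp.single (e b) (φ r)) = φ r • L' (Finsupp.single (e b) 1) := by
      rw [← map_smul, Finsupp.smul_single, smul_eq_mul, mul_one]
    rw [semiMap_single, h1, h2, LinearMap.map_smulₛₗ, h]

theorem semiMap_extendScalars {K : Type*} [CommRing K] (f : K →+* R) (φ : R →+* R)
    (hφ : ∀ r, φ (f r) = f r) {B B' C C' : Type*} (e : B ≃ B') (e' : C ≃ C')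
    (L : (B →₀ K) →ₗ[K] (C →₀ K)) (L' : (B' →₀ K) →ₗ[K] (C' →₀ K))
    (h : ∀ b, L' (Finsupp.single (e b) 1) = (L (Finsupp.single b 1)).mapDomain e') (x : B →₀ R) :
    extendScalars f L' (semiMap φ e x) = semiMap φ e' (extendScalars f L x) := by
  refine semiMap_comm φ e e' _ _ (fun b => ?_) x
  rw [extendScalars_single, extendScalars_single, h, semiMap_apply]
  ext c
  obtain ⟨c, rfl⟩ := e'.surjective c
  rw [Finsupp.mapRange_apply, Finsupp.mapDomain_apply e'.injective,
    Finsupp.mapDomain_apply e'.injective, Finsupp.mapRange_apply, Finsupp.mapRange_apply, hφ]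

end SemilinearMaps

/-! ### Equivariance of the lcm-resolution. -/

section Equivariance

variable {X : Type u} {I : AddSemigroupIdeal (X →₀ ℕ)} {k : Type v} [Field k]

theorem polyMap_monomial (τ : ExtField I k ≃ₐ[k] ExtField I k) (γ : symGroup I) (e : X →₀ ℕ)
    (r : ExtField I k) : polyMap τ γ (MvPolynomial.monomial e r) =
      MvPolynomial.monomial (symAut γ e) (τ r) := by
  have h : ∀ e : X →₀ ℕ, polyMap τ γ (MvPolynomial.monomial e 1) =
      MvPolynomial.monomial (symAut γ e) 1 := by
    intro e
    induction e using Finsupp.induction_linear with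
    | zero => rw [map_zero]; exact map_one (polyMap τ γ)
    | add e e' he he' =>
      have h1 : ∀ e e' : X →₀ ℕ, (MvPolynomial.monomial (e + e') 1 : PolyExt I k) =
          MvPolynomial.monomial e 1 * MvPolynomial.monomial e' 1 := fun e e' => by
        rw [MvPolynomial.monomial_mul, one_mul]
      rw [h1, map_mul, he, he', map_add, h1]
    | single i n =>
      rw [← MvPolynomial.X_pow_eq_monomial, map_pow, polyMap, MvPolynomial.eval₂Hom_X',
        MvPolynomial.monomial_pow, one_pow, ← map_nsmul, Finsupp.smul_single, smul_eq_mul, mul_one]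
  rw [← mul_one r, ← smul_eq_mul, ← MvPolynomial.smul_monomial, MvPolynomial.smul_eq_C_mul,
    map_mul, h, polyMap, MvPolynomial.eval₂Hom_C, smul_eq_mul, mul_one]
  exact (MvPolynomial.C_mul_monomial).trans (by rw [mul_one]; rfl)

theorem polyMap_C (τ : ExtField I k ≃ₐ[k] ExtField I k) (γ : symGroup I) (r : ExtField I k) :
    polyMap τ γ (MvPolynomial.C r) = MvPolynomial.C (τ r) := by
  rw [polyMap, MvPolynomial.eval₂Hom_C]
  rfl

theorem polyMap_algebraMap (τ : ExtField I k ≃ₐ[k] ExtField I k) (γ : symGroup I) (r : k) :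
    polyMap τ γ (algebraMap k (PolyExt I k) r) = algebraMap k (PolyExt I k) r :=
  (polyMap_C τ γ _).trans (congrArg MvPolynomial.C (τ.commutes r))

theorem polyMap_mul (τ τ' : ExtField I k ≃ₐ[k] ExtField I k) (γ γ' : symGroup I)
    (f : PolyExt I k) : polyMap (τ * τ') (γ * γ') f = polyMap τ γ (polyMap τ' γ' f) := by
  induction f using MvPolynomial.induction_on' with
  | monomial e r =>
    rw [polyMap_monomial, polyMap_monomial, polyMap_monomial]
    rfl
  | add f g hf hg => rw [map_add, map_add, map_add, hf, hg]

theorem polyMap_one (f : PolyExt I k) : polyMap (1 : ExtField I k ≃ₐ[k] ExtField I k) 1 f = f := by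
  induction f using MvPolynomial.induction_on' with
  | monomial e r =>
    rw [polyMap_monomial]
    rfl
  | add f g hf hg => rw [map_add, hf, hg]

theorem lcmMap_eq (τ : ExtField I k ≃ₐ[k] ExtField I k) (γ : symGroup I) (n : ℕ)
    (x : LcmMod I (ExtField I k) n) :
    lcmMap τ γ n x = semiMap (polyMap τ γ) (faceEquiv γ n) x := rfl

theorem lcmMap_single (τ : ExtField I k ≃ₐ[k] ExtField I k) (γ : symGroup I) (n : ℕ)
    (c : Face I n) (f : PolyExt I k) : lcmMap τ γ n (Finsupp.single c f) =
      Finsupp.single (faceEquiv γ n c) (polyMap τ γ f) :=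
  semiMap_single _ _ c f

theorem lcmMap_mul (τ τ' : ExtField I k ≃ₐ[k] ExtField I k) (γ γ' : symGroup I) (n : ℕ)
    (x : LcmMod I (ExtField I k) n) :
    lcmMap (τ * τ') (γ * γ') n x = lcmMap τ γ n (lcmMap τ' γ' n x) := by
  induction x using Finsupp.induction_linear with
  | zero => simp only [lcmMap_eq, map_zero]
  | add x y hx hy =>
    simp only [lcmMap_eq, map_add] at hx hy ⊢
    rw [hx, hy]
  | single c f =>
    rw [lcmMap_single, lcmMap_single, lcmMap_single, polyMap_mul]
    rfl

theorem lcmMap_one (n : ℕ) (x : LcmMod I (ExtField I k) n) :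
    lcmMap (1 : ExtField I k ≃ₐ[k] ExtField I k) 1 n x = x := by
  induction x using Finsupp.induction_linear with
  | zero => simp only [lcmMap_eq, map_zero]
  | add x y hx hy =>
    simp only [lcmMap_eq, map_add] at hx hy ⊢
    rw [hx, hy]
  | single c f =>
    rw [lcmMap_single, polyMap_one]
    rfl

/-- Subtraction of exponents is truncated, so additivity of γ gives this only when `b ≤ a`; vertices
of a face satisfy this. -/
theorem symAut_tsub (γ : symGroup I) {a b : X →₀ ℕ} (h : b ≤ a) :
    symAut γ (a - b) = symAut γ a - symAut γ b := by
  rw [eq_tsub_iff_add_eq_of_le ((aut_le_iff _ _ _).2 h), ← map_add, tsub_add_cancel_of_le h]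

theorem lcmMap_lcmD (τ : ExtField I k ≃ₐ[k] ExtField I k) (γ : symGroup I) (n : ℕ)
    (x : LcmMod I (ExtField I k) (n + 1)) : lcmD I (ExtField I k) n (lcmMap τ γ (n + 1) x) =
      lcmMap τ γ n (lcmD I (ExtField I k) n x) := by
  refine semiMap_comm (polyMap τ γ) (faceEquiv γ (n + 1)) (faceEquiv γ n) _ _ (fun c => ?_) x
  rw [lcmD_single, lcmD_single, map_sum]
  refine Finset.sum_congr rfl fun i _ => ?_
  rw [map_zsmul, semiMap_single, polyMap_monomial, symAut_tsub γ (c.del_top_le i), map_one τ]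
  rfl

theorem lcmAug_lcmMap (τ : ExtField I k ≃ₐ[k] ExtField I k) (γ : symGroup I)
    (x : LcmMod I (ExtField I k) 0) : lcmAug I (ExtField I k) (lcmMap τ γ 0 x) =
      polyMap τ γ (lcmAug I (ExtField I k) x) := by
  induction x using Finsupp.induction_linear with
  | zero => simp only [lcmMap_eq, map_zero]
  | add x y hx hy =>
    simp only [lcmMap_eq, map_add] at hx hy ⊢
    rw [hx, hy]
  | single c f =>
    rw [lcmMap_single, lcmAug_single, lcmAug_single, map_mul, polyMap_monomial, map_one τ]
    rfl

theorem lcmMap_mem_lcmDeg (τ : ExtField I k ≃ₐ[k] ExtField I k) (γ : symGroup I) (n : ℕ)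
    (e : X →₀ ℕ) (x : LcmMod I (ExtField I k) n) (hx : x ∈ lcmDeg I (ExtField I k) n e) :
    lcmMap τ γ n x ∈ lcmDeg I (ExtField I k) n (symAut γ e) := by
  induction hx using Submodule.span_induction with
  | mem x hx =>
    obtain ⟨c, e', rfl, rfl⟩ := hx
    rw [lcmMap_single, polyMap_monomial, map_one τ]
    exact Submodule.subset_span ⟨faceEquiv γ n c, symAut γ e', (map_add _ _ _).symm, rfl⟩
  | zero => rw [lcmMap_eq, map_zero]; exact Submodule.zero_mem _
  | add x y _ _ hx hy =>
    rw [lcmMap_eq] at hx hy ⊢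
    rw [map_add]
    exact Submodule.add_mem _ hx hy
  | smul r x _ hx =>
    have : lcmMap τ γ n (r • x) = τ r • lcmMap τ γ n x := by
      rw [← algebraMap_smul (PolyExt I k) r x, lcmMap_eq, LinearMap.map_smulₛₗ,
        MvPolynomial.algebraMap_eq, polyMap_C, ← MvPolynomial.algebraMap_eq, algebraMap_smul]
      rfl
    rw [this]
    exact Submodule.smul_mem _ _ hx

end Equivariance

/-! ### Equivariance of the projection and the action on the minimal resolution. -/

section FieldEquivariance

variable {X : Type u} {I : AddSemigroupIdeal (X →₀ ℕ)} {k : Type v} [Field k]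

/-- The semilinear action on the chains of the strata. -/
def stratumMap (τ : ExtField I k ≃ₐ[k] ExtField I k) (γ : symGroup I) (a : lcmPoset I) (n : ℕ) :
    (StratumFace a n →₀ PolyExt I k) →ₛₗ[polyMap τ γ]
      (StratumFace (latticeIso γ a) n →₀ PolyExt I k) :=
  semiMap (polyMap τ γ) (stratumEquiv γ a n)

variable (τ : ExtField I k ≃ₐ[k] ExtField I k) (γ : symGroup I)

theorem stratumIncl_stratumMap (a : lcmPoset I) (n : ℕ) (x : StratumFace a n →₀ PolyExt I k) :
    stratumIncl I (ExtField I k) (latticeIso γ a) n (stratumMap τ γ a n x) =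
      lcmMap τ γ n (stratumIncl I (ExtField I k) a n x) := by
  induction x using Finsupp.induction_linear with
  | zero => simp only [lcmMap_eq, map_zero]
  | add x y hx hy =>
    simp only [lcmMap_eq, map_add] at hx hy ⊢
    rw [hx, hy]
  | single c f =>
    rw [stratumMap, semiMap_single, stratumIncl_single, stratumIncl_single, lcmMap_single]
    rfl

theorem stratumD_stratumMap (a : lcmPoset I) (n : ℕ)
    (x : StratumFace a (n + 1) →₀ PolyExt I k) :
    stratumD (PolyExt I k) (latticeIso γ a) n (stratumMap τ γ a (n + 1) x) =
      stratumMap τ γ a n (stratumD (PolyExt I k) a n x) := by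
  refine semiMap_comm (polyMap τ γ) _ _ _ _ (fun c => ?_) x
  have h1 := stratumD_equiv (PolyExt I k) γ a n (Finsupp.single c 1)
  rw [Finsupp.domLCongr_single] at h1
  have h2 := LinearMap.congr_fun (stratumD_eq_extendScalars (polyMap τ γ) a n)
    (Finsupp.single c 1)
  rw [extendScalars_single] at h2
  rw [h1, semiMap_apply, ← h2]
  exact Finsupp.equivMapDomain_eq_mapDomain _ _

/-- The matrix of σ has entries in the prime field, which every γ fixes, so γ only permutes the
faces. -/
theorem extendScalars_stratumMap (a : lcmPoset I) (n : ℕ) (σ : StratumHomotopy k a)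
    (x : StratumFace a n →₀ PolyExt I k) :
    extendScalars (primeToPoly I k) (homotopyMap k γ a σ n) (stratumMap τ γ a n x) =
      stratumMap τ γ a (n + 1) (extendScalars (primeToPoly I k) (σ n) x) := by
  refine semiMap_extendScalars (primeToPoly I k) (polyMap τ γ)
    (fun r => polyMap_algebraMap τ γ _) _ _ _ _ (fun c => ?_) x
  have h := homotopyMap_apply k γ a σ n (Finsupp.single c 1)
  rw [Finsupp.domLCongr_single] at h
  rw [h]
  exact Finsupp.equivMapDomain_eq_mapDomain _ _

variable [Finite X]

/-- γ carries each summand at `a`, with its weight, to a summand at `γ a`; the sum is merely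
reindexed. A single splitting need not be preserved by the stabilizer of `a`, which is why all of
them are averaged. -/
theorem averageHomotopy_stratumMap (a : lcmPoset I) (n : ℕ)
    (x : StratumFace a n →₀ PolyExt I k) :
    averageHomotopy k (latticeIso γ a) n (stratumMap (extAction k γ) γ a n x) =
      stratumMap (extAction k γ) γ a (n + 1) (averageHomotopy k a n x) := by
  have := Fintype.ofFinite (MSpl k a)
  have := Fintype.ofFinite (MSpl k (latticeIso γ a))
  rw [averageHomotopy_eq, averageHomotopy_eq, finsum_eq_sum_of_fintype, finsum_eq_sum_of_fintype,
    LinearMap.sum_apply, LinearMap.sum_apply, map_sum, ← (msplEquiv k γ a).sum_comp]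
  refine Finset.sum_congr rfl fun σ _ => ?_
  rw [LinearMap.smul_apply, LinearMap.smul_apply, LinearMap.map_smulₛₗ, polyMap_C,
    extAction_weight, ← extendScalars_stratumMap]
  rfl

theorem hat_stratumMap (a : lcmPoset I) (n : ℕ) (x : StratumFace a n →₀ PolyExt I k) :
    hat (stratumD (PolyExt I k) (latticeIso γ a)) (averageHomotopy k (latticeIso γ a)) n
        (stratumMap (extAction k γ) γ a n x) =
      stratumMap (extAction k γ) γ a (n + 1)
        (hat (stratumD (PolyExt I k) a) (averageHomotopy k a) n x) := by
  have h : homotopyD (stratumD (PolyExt I k) (latticeIso γ a))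
      (averageHomotopy k (latticeIso γ a)) n (stratumMap (extAction k γ) γ a n x) =
      stratumMap (extAction k γ) γ a n
        (homotopyD (stratumD (PolyExt I k) a) (averageHomotopy k a) n x) := by
    cases n with
    | zero => exact (map_zero _).symm
    | succ n =>
      change averageHomotopy k (latticeIso γ a) n (stratumD (PolyExt I k) (latticeIso γ a) n
        (stratumMap (extAction k γ) γ a (n + 1) x)) = _
      rw [stratumD_stratumMap, averageHomotopy_stratumMap]
      rfl
  rw [hat_apply, hat_apply, h, ← map_sub, averageHomotopy_stratumMap, stratumD_stratumMap,
    averageHomotopy_stratumMap]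

omit [Finite X] in
theorem vectorField_stratumIncl (a : lcmPoset I) (n : ℕ) (y : StratumFace a n →₀ PolyExt I k) :
    vectorField I k n (stratumIncl I (ExtField I k) a n y) =
      stratumIncl I (ExtField I k) a (n + 1)
        (hat (stratumD (PolyExt I k) a) (averageHomotopy k a) n y) :=
  inducedField_stratumIncl _ _ _

theorem lcmMap_vectorField_stratumIncl (a : lcmPoset I) (n : ℕ)
    (y : StratumFace a n →₀ PolyExt I k) :
    vectorField I k n (lcmMap (extAction k γ) γ n (stratumIncl I (ExtField I k) a n y)) =
      lcmMap (extAction k γ) γ (n + 1)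
        (vectorField I k n (stratumIncl I (ExtField I k) a n y)) := by
  rw [vectorField_stratumIncl, ← stratumIncl_stratumMap, ← stratumIncl_stratumMap,
    vectorField_stratumIncl, hat_stratumMap]

theorem lcmMap_vectorField (n : ℕ) (x : LcmMod I (ExtField I k) n) :
    vectorField I k n (lcmMap (extAction k γ) γ n x) =
      lcmMap (extAction k γ) γ (n + 1) (vectorField I k n x) := by
  induction x using Finsupp.induction_linear with
  | zero => simp only [lcmMap_eq, map_zero]
  | add x y hx hy =>
    simp only [lcmMap_eq, map_add] at hx hy ⊢
    rw [hx, hy]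
  | single c f =>
    have h : (Finsupp.single c f : LcmMod I (ExtField I k) n) =
        stratumIncl I (ExtField I k) c.top n (Finsupp.single ⟨c, rfl⟩ f) :=
      (stratumIncl_single c.top n ⟨c, rfl⟩ f).symm
    rw [h, lcmMap_vectorField_stratumIncl]

theorem lcmMap_flow (n : ℕ) (x : LcmMod I (ExtField I k) n) :
    flow (lcmD I (ExtField I k)) (vectorField I k) n (lcmMap (extAction k γ) γ n x) =
      lcmMap (extAction k γ) γ n (flow (lcmD I (ExtField I k)) (vectorField I k) n x) := by
  have h : homotopyD (lcmD I (ExtField I k)) (vectorField I k) n (lcmMap (extAction k γ) γ n x) =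
      lcmMap (extAction k γ) γ n (homotopyD (lcmD I (ExtField I k)) (vectorField I k) n x) := by
    cases n with
    | zero => exact (map_zero (semiMap (polyMap (extAction k γ) γ) (faceEquiv γ 0))).symm
    | succ n =>
      change vectorField I k n (lcmD I (ExtField I k) n _) = _
      rw [lcmMap_lcmD, lcmMap_vectorField]
      rfl
  rw [flow_apply, flow_apply, h, lcmMap_vectorField, lcmMap_lcmD]
  simp only [lcmMap_eq, map_sub]

theorem lcmMap_proj (n : ℕ) (x : LcmMod I (ExtField I k) n) :
    proj I k n (lcmMap (extAction k γ) γ n x) = lcmMap (extAction k γ) γ n (proj I k n x) := by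
  have h : ∀ j, (flow (lcmD I (ExtField I k)) (vectorField I k) n ^ j)
      (lcmMap (extAction k γ) γ n x) = lcmMap (extAction k γ) γ n
        ((flow (lcmD I (ExtField I k)) (vectorField I k) n ^ j) x) := by
    intro j
    induction j with
    | zero => rfl
    | succ j ih =>
      rw [pow_succ', Module.End.mul_apply, Module.End.mul_apply, ih, lcmMap_flow]
  exact h _

theorem lcmMap_mem_minRes {n : ℕ} {x : LcmMod I (ExtField I k) n} (hx : x ∈ minRes I k n) :
    lcmMap (extAction k γ) γ n x ∈ minRes I k n := by
  obtain ⟨y, rfl⟩ := hx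
  exact ⟨_, lcmMap_proj γ n y⟩

omit [Finite X] in
theorem lcmMap_smul (n : ℕ) (f : PolyExt I k) (x : LcmMod I (ExtField I k) n) :
    lcmMap τ γ n (f • x) = polyMap τ γ f • lcmMap τ γ n x := by
  rw [lcmMap_eq, LinearMap.map_smulₛₗ]
  rfl

omit [Finite X] in
theorem lcmMap_smul_base (n : ℕ) (r : k) (x : LcmMod I (ExtField I k) n) :
    lcmMap τ γ n (r • x) = r • lcmMap τ γ n x := by
  rw [← algebraMap_smul (PolyExt I k) r x, lcmMap_smul, polyMap_algebraMap, algebraMap_smul]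

/-- The action of an element of `G_I` on a module of the minimal resolution. -/
def minResMap (n : ℕ) : minRes I k n →ₗ[k] minRes I k n where
  toFun x := ⟨lcmMap (extAction k γ) γ n x, lcmMap_mem_minRes γ x.2⟩
  map_add' _ _ := Subtype.ext (map_add (semiMap _ _) _ _)
  map_smul' r x := Subtype.ext (lcmMap_smul_base _ γ n r x)

theorem minResMap_coe (n : ℕ) (x : minRes I k n) :
    (minResMap γ n x : LcmMod I (ExtField I k) n) = lcmMap (extAction k γ) γ n x := rfl

theorem minResMap_mul (γ δ : symGroup I) (n : ℕ) (x : minRes I k n) :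
    minResMap (γ * δ) n x = minResMap γ n (minResMap δ n x) := by
  apply Subtype.ext
  rw [minResMap_coe, map_mul, lcmMap_mul]
  rfl

theorem minResMap_one (n : ℕ) (x : minRes I k n) : minResMap (1 : symGroup I) n x = x := by
  apply Subtype.ext
  rw [minResMap_coe, map_one, lcmMap_one]

/-- The action of an element of `G_I` on a module of the minimal resolution, as an
automorphism. -/
def minResEquiv (n : ℕ) : minRes I k n ≃ₗ[k] minRes I k n :=
  LinearEquiv.ofLinearMap (minResMap γ n) (minResMap γ⁻¹ n)
    (LinearMap.ext fun x => by
      rw [LinearMap.comp_apply, ← minResMap_mul, mul_inv_cancel, minResMap_one]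
      rfl)
    (LinearMap.ext fun x => by
      rw [LinearMap.comp_apply, ← minResMap_mul, inv_mul_cancel, minResMap_one]
      rfl)

variable (I k) in
/-- The action of `G_I` on the minimal resolution. -/
def minResAction : symGroup I →* complexAut (N := fun n => minRes I k n)
    (fun n => (minResD (lcmD_mem_minRes I k) n).restrictScalars k) where
  toFun γ := ⟨fun n => minResEquiv γ n, fun n x => Subtype.ext (lcmMap_lcmD _ γ n x.1)⟩
  map_one' := Subtype.ext (funext fun n => LinearEquiv.ext fun x => minResMap_one n x)
  map_mul' γ δ := Subtype.ext (funext fun n => LinearEquiv.ext fun x => minResMap_mul γ δ n x)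

theorem minResAction_coe (n : ℕ) (x : minRes I k n) :
    (((minResAction I k γ).1 n x : minRes I k n) : LcmMod I (ExtField I k) n) =
      lcmMap (extAction k γ) γ n x := rfl

theorem minResAction_smul (n : ℕ) (f : PolyExt I k) (x : minRes I k n) :
    (minResAction I k γ).1 n (f • x) =
      polyMap (extAction k γ) γ f • (minResAction I k γ).1 n x :=
  Subtype.ext (lcmMap_smul _ γ n f x.1)

theorem mem_minResDeg_iff (n : ℕ) (e : X →₀ ℕ) (x : minRes I k n) :
    x ∈ minResDeg I k n e ↔ (minResAction I k γ).1 n x ∈ minResDeg I k n (symAut γ e) := by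
  constructor
  · exact fun h => lcmMap_mem_lcmDeg _ γ n e x.1 h
  · intro h
    -- The converse follows by applying the forward direction to the inverse of γ.
    have h1 := lcmMap_mem_lcmDeg (extAction k γ⁻¹) γ⁻¹ n _ _ h
    have h2 : lcmMap (extAction k γ⁻¹) γ⁻¹ n (lcmMap (extAction k γ) γ n x.1) = x.1 := by
      rw [← lcmMap_mul, ← map_mul, inv_mul_cancel, map_one, lcmMap_one]
    have h3 : symAut γ⁻¹ (symAut γ e) = e := (symAut γ).symm_apply_apply e
    rw [h3] at h1
    exact (congrArg (· ∈ lcmDeg I (ExtField I k) n e) h2).mp h1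

end FieldEquivariance

end LcmRes

end

open LcmRes
theorem theoremT {X : Type*} [Finite X] (I : AddSemigroupIdeal (X →₀ ℕ)) (k : Type*) [Field k] :
    -- the poset `L'` is finite and the numbers `m(a)` are well defined and positive
    (Finite (lcmPoset I) ∧ ∀ a : lcmPoset I, 0 < msplCount k a) ∧
    -- the extension `k'` of `k` is a finitely generated field extension
    (IsField (ExtField I k) ∧ Algebra.EssFiniteType k (ExtField I k)) ∧
    -- it equals `k` in characteristic zero
    (CharZero k → Function.Bijective (algebraMap k (ExtField I k))) ∧
    -- it is purely transcendental of degree `∑ (m(a) - 1)`, the sum over the critical elements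
    Nonempty (ExtField I k ≃ₐ[k]
      FractionRing (MvPolynomial (Fin (∑ᶠ a : Crit I k, (msplCount k a.1 - 1))) k)) ∧
    -- the lcm-resolution is a multigraded free resolution of the ideal `I k'[X]`
    IsGradedFreeResolution (lcmDeg I (ExtField I k)) (lcmD I (ExtField I k))
      (lcmAug I (ExtField I k)) (monomialIdeal I (ExtField I k)) ∧
    -- `proj` is a multihomogeneous chain map and it is idempotent
    ((∀ n x, lcmD I (ExtField I k) n (proj I k (n + 1) x) =
        proj I k n (lcmD I (ExtField I k) n x)) ∧
      (∀ n e, ∀ x ∈ lcmDeg I (ExtField I k) n e, proj I k n x ∈ lcmDeg I (ExtField I k) n e) ∧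
      (∀ n x, proj I k n (proj I k n x) = proj I k n x)) ∧
    -- the image of `proj` is a subcomplex
    ∃ hd : ∀ n, ∀ x ∈ minRes I k (n + 1), lcmD I (ExtField I k) n x ∈ minRes I k n,
      -- which is a minimal multigraded free resolution of `I k'[X]`
      IsGradedFreeResolution (N := fun n => minRes I k n) (minResDeg I k) (minResD hd)
        (minResAug I k) (monomialIdeal I (ExtField I k)) ∧
      IsMinimalComplex (N := fun n => minRes I k n) (minResD hd) ∧
      -- `G_I` acts on `k'` over `k`, by its action on the elements `y_σ`
      ∃ ρ : symGroup I →* (ExtField I k ≃ₐ[k] ExtField I k),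
        (∀ γ y, ρ γ (yElt k y) = yElt k (yMap k γ y)) ∧
        -- and on the minimal resolution, by `k`-linear automorphisms of chain complexes
        ∃ M : symGroup I →* complexAut (N := fun n => minRes I k n)
            (fun n => (minResD hd n).restrictScalars k),
          ∀ γ,
            -- given by the action on linear combinations of faces
            (∀ n (x : minRes I k n), (((M γ).1 n x : minRes I k n) : LcmMod I (ExtField I k) n) =
              lcmMap (ρ γ) γ n x) ∧
            -- it is linear over `k'[X]` as a map to the module twisted by `γ`
            (∀ n (f : PolyExt I k) (x : minRes I k n),
              (M γ).1 n (f • x) = polyMap (ρ γ) γ f • (M γ).1 n x) ∧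
            -- it preserves multidegrees, where the degree `e` part of the twisted module
            -- is the degree `γ e` part of the module
            (∀ n e (x : minRes I k n),
              x ∈ minResDeg I k n e ↔ (M γ).1 n x ∈ minResDeg I k n (symAut γ e)) ∧
            -- it lifts the isomorphism from `I k'[X]` to its twist that is induced by `γ`
            (∀ x : minRes I k 0, minResAug I k ((M γ).1 0 x) =
              polyMap (ρ γ) γ (minResAug I k x)) := by
  refine ⟨⟨finite_lcmPoset I, msplCount_pos k⟩,
    ⟨isField_extField I k, essFiniteType_extField I k⟩,
    fun _ => bijective_algebraMap_of_charZero I k, nonempty_extField_equiv I k,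
    isGradedFreeResolution_lcm I (ExtField I k),
    ⟨lcmD_proj I k, proj_mem_lcmDeg I k, proj_proj I k⟩, lcmD_mem_minRes I k,
    isGradedFreeResolution_minRes I k, isMinimalComplex_minRes I k,
    extAction k, extAction_yElt k, minResAction I k, fun γ => ⟨minResAction_coe γ,
      minResAction_smul γ, mem_minResDeg_iff γ, fun x => lcmAug_lcmMap _ γ x.1⟩⟩
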